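/- Let $\mathfrak g$ be a finite-dimensional complex simple Lie algebra with Cartan subalgebra $\mathfrak h$, simple roots $\alpha_1,\dots,\alpha_d$, integral weight lattice $X\subset\mathfrak h^*$, and Weyl group $W=\langle s_1,\dots,s_d\rangle$ with length function $\ell$. Let $W$ act on $X$ on the right by $\mathbf i w=w^{-1}(\mathbf i)$, and write $\mathbf i\preceq\mathbf j$ if $\mathbf j-\mathbf i\in\sum_k\mathbb N\alpha_k$. Let $\bar X_f\subset X$ be a finite $W$-stable subset containing a regular orbit (weights are written in $\rho$-shifted coordinates $\mathbf i=\lambda+\rho$, so that the dot action becomes the linear action), and let $\bar X_f^-$ be the set of its anti-dominant elements, i.e. those with $\langle\mathbf i,\alpha_k^\vee\rangle\le 0$ for all $k$. Let $\mathcal A=\mathbb Z[q,q^{-1}]$ and let $\mathcal H$ be the Hecke algebra of $W$ over $\mathcal A$, generated by $H_1,\dots,H_d$ with relations $(H_k-q^{-1})(H_k+q)=0$ and the braid relations $H_kH_lH_k\cdots=H_lH_kH_l\cdots$ ($m_{kl}$ factors on each side, $m_{kl}$ the order of $s_ks_l$, $k\neq l$). For $w\in W$ let $H_w$ be the product of the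 generators along a reduced word of $w$. Let $\mathbb T_f=\bigoplus_{\mathbf i\in\bar X_f}\mathcal A v_{\mathbf i}$ be the right $\mathcal H$-module with $$v_{\mathbf i}H_k=\begin{cases}q^{-1}v_{\mathbf i}&\mathbf i s_k=\mathbf i,\\ v_{\mathbf i s_k}&\mathbf i s_k\succ\mathbf i,\\ v_{\mathbf i s_k}+(q^{-1}-q)v_{\mathbf i}&\mathbf i s_k\prec\mathbf i,\end{cases}$$ let $\mathcal S_q=\mathrm{End}_{\mathcal H}(\mathbb T_f)$, and define $c_{\mathbf i,\mathbf j}(\eta)\in\mathcal A$ for $\eta\in\mathcal S_q$ by $\eta(v_{\mathbf j})=\sum_{\mathbf i}c_{\mathbf i,\mathbf j}(\eta)v_{\mathbf i}$. Let $\bar X_f^{(2)}$ be the set of pairs $(\mathbf i,\mathbf j)\in\bar X_f\times\bar X_f$ such that $\mathbf j\in\bar X_f^-$ and, for every $k$ with $\mathbf j s_k=\mathbf j$, $\mathbf i s_k\succeq\mathbf i$. Let $\Lambda_f$ be the set of $W$-orbits on $\bar X_f$; for $\gamma\in\Lambda_f$ let $\mathbf i_\gamma^-$ be its anti-dominant element,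 $J_\gamma=\{k:\mathbf i_\gamma^-s_k=\mathbf i_\gamma^-\}$, $W_\gamma=\langle s_k: k\in J_\gamma\rangle$, $w_\circ^\gamma$ the longest element of $W_\gamma$, and $x_\gamma=\sum_{w\in W_\gamma}q^{\ell(w_\circ^\gamma)-\ell(w)}H_w$. Let $\mathcal D_\gamma=\{w\in W:\ell(uw)=\ell(u)+\ell(w)\ \forall u\in W_\gamma\}$, $\mathcal D_{\gamma\nu}=\mathcal D_\gamma\cap\mathcal D_\nu^{-1}$, $\Xi=\{(\gamma,g,\nu):\gamma,\nu\in\Lambda_f,\ g\in\mathcal D_{\gamma\nu}\}$, and $H_Y=\sum_{w\in Y}q^{-\ell(w)}H_w$ for $Y\subseteq W$. Then: 1. $\bar X_f^{(2)}$ is a transversal for the diagonal $W$-orbits on $\bar X_f\times\bar X_f$. 2. The $\mathcal A$-module $\mathcal S_q^*=\mathrm{Hom}_{\mathcal A}(\mathcal S_q,\mathcal A)$ is free with basis $\{c_{\mathbf i,\mathbf j}:(\mathbf i,\mathbf j)\in\bar X_f^{(2)}\}$. 3. For each $(\mathbf i,\mathbf j)\in\bar X_f^{(2)}$ there is a unique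 $\eta_{\mathbf i,\mathbf j}\in\mathcal S_q$ with $c_{\mathbf k,\mathbf l}(\eta_{\mathbf i,\mathbf j})=\delta_{(\mathbf i,\mathbf j),(\mathbf k,\mathbf l)}$ for all $(\mathbf k,\mathbf l)\in\bar X_f^{(2)}$, and the $\mathcal A$-module $\mathcal S_q$ is free with basis $\{\eta_{\mathbf i,\mathbf j}:(\mathbf i,\mathbf j)\in\bar X_f^{(2)}\}$. 4. There is a unique isomorphism of right $\mathcal H$-modules $\Omega:\mathbb T_f\to\bigoplus_{\gamma\in\Lambda_f}x_\gamma\mathcal H$ with $\Omega(v_{\mathbf i_\gamma^-})=x_\gamma$ for all $\gamma$. Identifying the two modules through $\Omega$, for each $(\gamma,g,\nu)\in\Xi$ there is a unique $\phi^g_{\gamma\nu}\in\mathcal S_q$ with $\phi^g_{\gamma\nu}(x_{\nu'})=\delta_{\nu,\nu'}\,q^{\ell(w_\circ^\nu)}H_{W_\gamma gW_\nu}\in x_\gamma\mathcal H$ for all $\nu'\in\Lambda_f$. The map $(\gamma,g,\nu)\mapsto(\mathbf i_\gamma^-g,\mathbf i_\nu^-)$ is a bijection $\Xi\to\bar X_f^{(2)}$,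 and $$\phi^g_{\gamma\nu}=q^{\ell(w_\circ^\nu)-\ell(w_\circ^\gamma)-\ell(g)}\,\eta_{\mathbf i_\gamma^-g,\,\mathbf i_\nu^-}.$$ Hence $\{\phi^g_{\gamma\nu}:(\gamma,g,\nu)\in\Xi\}$ is an $\mathcal A$-basis of $\mathcal S_q$. -/

import Mathlib

namespace QSchur

/-- The ring `𝒜 = ℤ[q, q⁻¹]`. -/
abbrev LaurentZ : Type := LaurentPolynomial ℤ

/-- The power `q ^ n`. -/
noncomputable def qpow (n : ℤ) : LaurentZ := LaurentPolynomial.T n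

section WeylGroup

variable {ι K M N : Type*} [Field K] [AddCommGroup M] [Module K M]
  [AddCommGroup N] [Module K N] {P : RootPairing ι K M N}

/-- The weight lattice: the vectors on which all coroots are integral. -/
def weightLattice (P : RootPairing ι K M N) : Set M :=
  {x | ∀ i : ι, ∃ n : ℤ, P.coroot' i x = n}

/-- The simple reflection `s_k`. -/
noncomputable def simpleReflection (b : P.Base) (k : b.support) : P.weylGroup :=
  RootPairing.weylGroup.ofIdx P k

/-- The order `x ⪯ y`: the difference `y - x` is a sum of simple roots. -/
def DomLE (b : P.Base) (x y : M) : Prop :=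
  y - x ∈ AddSubmonoid.closure (P.root '' b.support)

/-- The strict order `x ≺ y`. -/
def DomLT (b : P.Base) (x y : M) : Prop := DomLE b x y ∧ x ≠ y

/-- Anti-dominance, in `ρ`-shifted coordinates `i = λ + ρ`: the pairings with all simple coroots are
nonpositive integers. -/
def IsAntidominant (b : P.Base) (x : M) : Prop :=
  ∀ k : b.support, ∃ n : ℤ, n ≤ 0 ∧ P.coroot' (k : ι) x = n

/-- The length `ℓ(w)`: the least number of simple reflections whose product is `w`. -/
noncomputable def length (b : P.Base) (w : P.weylGroup) : ℕ :=
  sInf {n | ∃ l : List b.support, (l.map (simpleReflection b)).prod = w ∧ l.length = n}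

theorem simpleReflection_smul (b : P.Base) (k : b.support) (x : M) :
    simpleReflection b k • x = x - P.coroot' (k : ι) x • P.root k := rfl

theorem simpleReflection_mul_self (b : P.Base) (k : b.support) :
    simpleReflection b k * simpleReflection b k = 1 := by
  apply Subtype.ext
  apply RootPairing.Equiv.weightHom_injective
  ext x
  exact P.reflection_same (k : ι) x

theorem simpleReflection_inv (b : P.Base) (k : b.support) :
    (simpleReflection b k)⁻¹ = simpleReflection b k :=
  inv_eq_of_mul_eq_one_left (simpleReflection_mul_self b k)

theorem exists_word [CharZero K] [Finite ι] [P.IsCrystallographic] [P.IsReduced] (b : P.Base)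
    (w : P.weylGroup) :
    ∃ l : List b.support, (l.map (simpleReflection b)).prod = w := by
  let S : Subgroup P.Aut :=
    Subgroup.closure (Set.range fun k : b.support ↦ RootPairing.Equiv.reflection P k)
  have hinv : ∀ i, (RootPairing.Equiv.reflection P i)⁻¹ = RootPairing.Equiv.reflection P i :=
    fun i ↦ RootPairing.Equiv.reflection_inv P i
  have key : ∀ i, RootPairing.Equiv.reflection P i ∈ S := by
    intro i
    have conj : ∀ i j, RootPairing.Equiv.reflection P (P.reflectionPerm j i) =
        RootPairing.Equiv.reflection P j * RootPairing.Equiv.reflection P i *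
          RootPairing.Equiv.reflection P j := by
      intro i j
      apply RootPairing.Equiv.weightHom_injective
      rw [map_mul, map_mul]
      ext x
      exact LinearEquiv.congr_fun (P.reflection_reflectionPerm (i := i) (j := j)) x
    refine RootPairing.Base.induction_reflect (b := b) i
      (p := fun i ↦ RootPairing.Equiv.reflection P i ∈ S) ?_ ?_ ?_
    · intro i hi
      rw [conj]
      exact mul_mem (mul_mem hi hi) hi
    · intro i hi
      exact Subgroup.subset_closure ⟨⟨i, hi⟩, rfl⟩
    · intro i j hi hj
      have : RootPairing.Equiv.reflection P j ∈ S := Subgroup.subset_closure ⟨⟨j, hj⟩, rfl⟩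
      rw [conj]
      exact mul_mem (mul_mem this hi) this
  have hw : (w : P.Aut) ∈ S := by
    have : P.weylGroup ≤ S := by
      rw [RootPairing.weylGroup, Subgroup.closure_le]
      rintro _ ⟨i, rfl⟩
      exact key i
    exact this w.2
  have : ∀ u ∈ S, ∃ l : List b.support,
      ((l.map (simpleReflection b)).prod : P.weylGroup) = (u : P.Aut) := by
    intro u hu
    induction hu using Subgroup.closure_induction'' with
    | one => exact ⟨[], rfl⟩
    | mem x hx =>
      obtain ⟨k, rfl⟩ := hx
      exact ⟨[k], by simp [simpleReflection, RootPairing.weylGroup.ofIdx]⟩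
    | inv_mem x hx =>
      obtain ⟨k, rfl⟩ := hx
      exact ⟨[k], by simp [simpleReflection, RootPairing.weylGroup.ofIdx, hinv]⟩
    | mul x y _ _ hx hy =>
      obtain ⟨l, hl⟩ := hx
      obtain ⟨l', hl'⟩ := hy
      exact ⟨l ++ l', by simp [← hl, ← hl']⟩
  obtain ⟨l, hl⟩ := this w hw
  exact ⟨l, Subtype.ext hl⟩

theorem exists_reduced_word [CharZero K] [Finite ι] [P.IsCrystallographic] [P.IsReduced] (b : P.Base)
    (w : P.weylGroup) :
    ∃ l : List b.support, (l.map (simpleReflection b)).prod = w ∧ l.length = length b w :=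
  Nat.sInf_mem (s := {n | ∃ l : List b.support,
    (l.map (simpleReflection b)).prod = w ∧ l.length = n}) <| by
      obtain ⟨l, hl⟩ := exists_word b w
      exact ⟨l.length, l, hl, rfl⟩

theorem DomLE.antisymm [CharZero K] {b : P.Base} {x y : M} (h : DomLE b x y) (h' : DomLE b y x) : x = y := by
  have key : ∀ z, z ∈ AddSubmonoid.closure (P.root '' b.support) →
      ∃ f : b.support → ℕ, z = ∑ k, f k • P.root k := by
    intro z hz
    rw [← Submodule.span_nat_eq_addSubmonoidClosure, Submodule.mem_toAddSubmonoid,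
      Fintype.mem_span_image_iff_exists_fun] at hz
    obtain ⟨c, hc⟩ := hz
    exact ⟨c, hc.symm⟩
  obtain ⟨f, hf⟩ := key _ h
  obtain ⟨g, hg⟩ := key _ h'
  have hli : LinearIndependent ℤ (fun k : b.support ↦ P.root k) :=
    LinearIndependent.restrict_scalars' ℤ b.linearIndepOn_root
  have h0 : ∑ k, ((f k : ℤ) + g k) • P.root k = 0 := by
    have : (y - x) + (x - y) = 0 := by abel
    rw [hf, hg, ← Finset.sum_add_distrib] at this
    rw [← this]
    refine Finset.sum_congr rfl fun k _ ↦ ?_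
    rw [add_smul, natCast_zsmul, natCast_zsmul]
  have h1 := Fintype.linearIndependent_iff.mp hli _ h0
  have h2 : ∀ k, f k = 0 := fun k ↦ by have := h1 k; omega
  have h3 : y - x = 0 := by rw [hf]; simp [h2]
  exact (sub_eq_zero.mp h3).symm

theorem domLE_smul_iff [CharZero K] {b : P.Base} (k : b.support) {x : M} {n : ℤ}
    (hn : P.coroot' (k : ι) x = n) :
    (simpleReflection b k • x = x ↔ n = 0) ∧
    (DomLT b x (simpleReflection b k • x) ↔ n < 0) := by
  have hr : P.root k ≠ 0 := P.ne_zero k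
  have hx : simpleReflection b k • x = x - n • P.root k := by
    rw [simpleReflection_smul, hn, Int.cast_smul_eq_zsmul]
  have h1 : simpleReflection b k • x = x ↔ n = 0 := by
    rw [simpleReflection_smul, hn, sub_eq_self, smul_eq_zero]
    simp [hr]
  have mem : ∀ m : ℕ, (m : ℤ) • P.root k ∈ AddSubmonoid.closure (P.root '' b.support) := by
    intro m
    rw [natCast_zsmul]
    exact AddSubmonoid.nsmul_mem _ (AddSubmonoid.subset_closure (Set.mem_image_of_mem _ k.2)) m
  refine ⟨h1, ?_, ?_⟩
  · rintro ⟨hle, hne⟩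
    by_contra! hge
    have hle' : DomLE b (simpleReflection b k • x) x := by
      unfold DomLE
      rw [hx]
      have := mem n.toNat
      rw [Int.toNat_of_nonneg hge] at this
      simpa using this
    exact hne (DomLE.antisymm hle hle')
  · intro hlt
    refine ⟨?_, fun h ↦ hlt.ne (h1.mp h.symm)⟩
    unfold DomLE
    rw [hx]
    have := mem (-n).toNat
    rw [Int.toNat_of_nonneg (by omega)] at this
    simpa using this


/-! ### The order of a product of two simple reflections -/

/-- The alternating product `a * b * a * ⋯` with `n` factors. -/
def braidWord {G : Type*} [Monoid G] : ℕ → G → G → G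
  | 0, _, _ => 1
  | n + 1, a, c => a * braidWord n c a

theorem braidWord_comm {G : Type*} [Group G] {s t : G} (hs : s * s = 1) (ht : t * t = 1) {m : ℕ}
    (h : (s * t) ^ m = 1) : braidWord m s t = braidWord m t s := by
  have key : ∀ n, braidWord n s t = (s * t) ^ n * braidWord n t s := by
    intro n
    induction n with
    | zero => simp [braidWord]
    | succ n ih =>
      have h1 : t * (s * t) ^ n = ((s * t) ^ n)⁻¹ * t := by
        have hc : SemiconjBy t (s * t) (t * s) := by simp [SemiconjBy, mul_assoc]
        have hi : (s * t)⁻¹ = t * s := by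
          rw [mul_inv_rev, inv_eq_of_mul_eq_one_left hs, inv_eq_of_mul_eq_one_left ht]
        rw [← inv_pow, hi]
        exact hc.pow_right n
      calc braidWord (n + 1) s t = s * (t * t) * braidWord n t s := by rw [ht, mul_one]; rfl
        _ = (s * t) ^ (n + 1) * (((s * t) ^ n)⁻¹ * t) * braidWord n t s := by
          rw [pow_succ' (s * t) n]; group
        _ = (s * t) ^ (n + 1) * (t * braidWord n s t) := by
          rw [← h1, ih]; group
        _ = _ := rfl
  rw [key, h, one_mul]

/-- The action of `s_k s_l` on the coefficients `c` of `x + c₁ α_k + c₂ α_l`, where `u`, `v` are the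
pairings of `x` with the two coroots and `A`, `B` are the off-diagonal Cartan integers. -/
def rotCoeff (A B u v : K) (c : K × K) : K × K :=
  let c₂ := c.2 - (v + c.1 * A + 2 * c.2)
  (c.1 - (u + 2 * c.1 + c₂ * B), c₂)

theorem pow_smul_eq (b : P.Base) (k l : b.support) (x : M) (n : ℕ) :
    (simpleReflection b k * simpleReflection b l) ^ n • x =
      x + ((rotCoeff (P.pairing k l) (P.pairing l k) (P.coroot' (k : ι) x)
        (P.coroot' (l : ι) x))^[n] (0, 0)).1 • P.root k +
      ((rotCoeff (P.pairing k l) (P.pairing l k) (P.coroot' (k : ι) x)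
        (P.coroot' (l : ι) x))^[n] (0, 0)).2 • P.root l := by
  induction n with
  | zero => simp
  | succ n ih =>
    rw [pow_succ', mul_smul, ih, Function.iterate_succ_apply', mul_smul,
      simpleReflection_smul, simpleReflection_smul]
    generalize (rotCoeff (P.pairing k l) (P.pairing l k) (P.coroot' (k : ι) x)
        (P.coroot' (l : ι) x))^[n] (0, 0) = c
    simp only [map_add, map_sub, map_smul, RootPairing.root_coroot'_eq_pairing,
      RootPairing.pairing_same, rotCoeff, smul_eq_mul]
    module

theorem pow_eq_one_of_forall (b : P.Base) (k l : b.support) (n : ℕ)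
    (h : ∀ u v : K, (rotCoeff (P.pairing k l) (P.pairing l k) u v)^[n] (0, 0) = (0, 0)) :
    (simpleReflection b k * simpleReflection b l) ^ n = 1 := by
  apply Subtype.ext
  apply RootPairing.Equiv.weightHom_injective
  ext x
  have := pow_smul_eq b k l x n
  rw [h] at this
  rw [Prod.fst, Prod.snd, zero_smul, zero_smul, add_zero, add_zero] at this
  exact this

theorem pow_ne_one_of_ne (b : P.Base) {k l : b.support} (hkl : k ≠ l) (n : ℕ)
    (h : (rotCoeff (P.pairing k l) (P.pairing l k) 2 (P.pairing k l))^[n] (0, 0) ≠ (0, 0)) :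
    (simpleReflection b k * simpleReflection b l) ^ n ≠ 1 := by
  intro h1
  have h2 := pow_smul_eq b k l (P.root k) n
  rw [h1, one_smul] at h2
  simp only [RootPairing.root_coroot'_eq_pairing, RootPairing.pairing_same] at h2
  generalize (rotCoeff (P.pairing k l) (P.pairing l k) 2 (P.pairing k l))^[n] (0, 0) = c at h h2
  have hli := b.linearIndependent_pair_of_ne hkl
  rw [LinearIndependent.pair_iff] at hli
  have h3 : c.1 • P.root k + c.2 • P.root l = 0 := by
    rw [add_assoc] at h2
    simpa using h2.symm
  obtain ⟨h4, h5⟩ := hli _ _ h3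
  exact h (Prod.ext h4 h5)

theorem rotCoeff_succ {A B u v x y x' y' : K} {n : ℕ}
    (h : (rotCoeff A B u v)^[n] (0, 0) = (x, y)) (hx : x - (u + 2 * x + y' * B) = x')
    (hy : y - (v + x * A + 2 * y) = y') :
    (rotCoeff A B u v)^[n + 1] (0, 0) = (x', y') := by
  rw [Function.iterate_succ_apply', h, rotCoeff]
  simp only [hx, hy]

theorem orderOf_eq_two [CharZero K] (b : P.Base) {k l : b.support} (hkl : k ≠ l)
    (h₁ : P.pairing k l = 0) (h₂ : P.pairing l k = 0) :
    orderOf (simpleReflection b k * simpleReflection b l) = 2 := by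
  have e0 (u v : K) : (rotCoeff (0) (0) u v)^[0] (0, 0) = (0, 0) := rfl
  have e1 (u v : K) : (rotCoeff (0) (0) u v)^[1] (0, 0) =
      (-u, -v) :=
    rotCoeff_succ (e0 u v) (by ring) (by ring)
  have e2 (u v : K) : (rotCoeff (0) (0) u v)^[2] (0, 0) =
      (0, 0) :=
    rotCoeff_succ (e1 u v) (by ring) (by ring)
  refine orderOf_eq_of_pow_and_pow_div_prime (by norm_num)
    (pow_eq_one_of_forall b k l _ fun u v ↦ by rw [h₁, h₂, e2]) fun p hp hpm ↦ ?_
  have n1 : (simpleReflection b k * simpleReflection b l) ^ 1 ≠ 1 :=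
    pow_ne_one_of_ne b hkl _ (by rw [h₁, h₂, e1]; norm_num)
  have hle : p ≤ 2 := Nat.le_of_dvd (by norm_num) hpm
  have h2le := hp.two_le
  interval_cases p
  · exact n1

theorem orderOf_eq_three [CharZero K] (b : P.Base) {k l : b.support} (hkl : k ≠ l)
    (h₁ : P.pairing k l = -1) (h₂ : P.pairing l k = -1) :
    orderOf (simpleReflection b k * simpleReflection b l) = 3 := by
  have e0 (u v : K) : (rotCoeff (-1) (-1) u v)^[0] (0, 0) = (0, 0) := rfl
  have e1 (u v : K) : (rotCoeff (-1) (-1) u v)^[1] (0, 0) =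
      (-u - v, -v) :=
    rotCoeff_succ (e0 u v) (by ring) (by ring)
  have e2 (u v : K) : (rotCoeff (-1) (-1) u v)^[2] (0, 0) =
      (-u, -u - v) :=
    rotCoeff_succ (e1 u v) (by ring) (by ring)
  have e3 (u v : K) : (rotCoeff (-1) (-1) u v)^[3] (0, 0) =
      (0, 0) :=
    rotCoeff_succ (e2 u v) (by ring) (by ring)
  refine orderOf_eq_of_pow_and_pow_div_prime (by norm_num)
    (pow_eq_one_of_forall b k l _ fun u v ↦ by rw [h₁, h₂, e3]) fun p hp hpm ↦ ?_
  have n1 : (simpleReflection b k * simpleReflection b l) ^ 1 ≠ 1 :=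
    pow_ne_one_of_ne b hkl _ (by rw [h₁, h₂, e1]; norm_num)
  have hle : p ≤ 3 := Nat.le_of_dvd (by norm_num) hpm
  have h2le := hp.two_le
  interval_cases p
  · exact absurd hpm (by norm_num)
  · exact n1

theorem orderOf_eq_four [CharZero K] (b : P.Base) {k l : b.support} (hkl : k ≠ l)
    (h₁ : P.pairing k l = -1) (h₂ : P.pairing l k = -2) :
    orderOf (simpleReflection b k * simpleReflection b l) = 4 := by
  have e0 (u v : K) : (rotCoeff (-1) (-2) u v)^[0] (0, 0) = (0, 0) := rfl
  have e1 (u v : K) : (rotCoeff (-1) (-2) u v)^[1] (0, 0) =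
      (-u - 2 * v, -v) :=
    rotCoeff_succ (e0 u v) (by ring) (by ring)
  have e2 (u v : K) : (rotCoeff (-1) (-2) u v)^[2] (0, 0) =
      (-2 * u - 2 * v, -u - 2 * v) :=
    rotCoeff_succ (e1 u v) (by ring) (by ring)
  have e3 (u v : K) : (rotCoeff (-1) (-2) u v)^[3] (0, 0) =
      (-u, -u - v) :=
    rotCoeff_succ (e2 u v) (by ring) (by ring)
  have e4 (u v : K) : (rotCoeff (-1) (-2) u v)^[4] (0, 0) =
      (0, 0) :=
    rotCoeff_succ (e3 u v) (by ring) (by ring)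
  refine orderOf_eq_of_pow_and_pow_div_prime (by norm_num)
    (pow_eq_one_of_forall b k l _ fun u v ↦ by rw [h₁, h₂, e4]) fun p hp hpm ↦ ?_
  have n2 : (simpleReflection b k * simpleReflection b l) ^ 2 ≠ 1 :=
    pow_ne_one_of_ne b hkl _ (by rw [h₁, h₂, e2]; norm_num)
  have hle : p ≤ 4 := Nat.le_of_dvd (by norm_num) hpm
  have h2le := hp.two_le
  interval_cases p
  · exact n2
  · exact absurd hpm (by norm_num)
  · exact absurd hp (by norm_num)

theorem orderOf_eq_six [CharZero K] (b : P.Base) {k l : b.support} (hkl : k ≠ l)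
    (h₁ : P.pairing k l = -1) (h₂ : P.pairing l k = -3) :
    orderOf (simpleReflection b k * simpleReflection b l) = 6 := by
  have e0 (u v : K) : (rotCoeff (-1) (-3) u v)^[0] (0, 0) = (0, 0) := rfl
  have e1 (u v : K) : (rotCoeff (-1) (-3) u v)^[1] (0, 0) =
      (-u - 3 * v, -v) :=
    rotCoeff_succ (e0 u v) (by ring) (by ring)
  have e2 (u v : K) : (rotCoeff (-1) (-3) u v)^[2] (0, 0) =
      (-3 * u - 6 * v, -u - 3 * v) :=
    rotCoeff_succ (e1 u v) (by ring) (by ring)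
  have e3 (u v : K) : (rotCoeff (-1) (-3) u v)^[3] (0, 0) =
      (-4 * u - 6 * v, -2 * u - 4 * v) :=
    rotCoeff_succ (e2 u v) (by ring) (by ring)
  have e4 (u v : K) : (rotCoeff (-1) (-3) u v)^[4] (0, 0) =
      (-3 * u - 3 * v, -2 * u - 3 * v) :=
    rotCoeff_succ (e3 u v) (by ring) (by ring)
  have e5 (u v : K) : (rotCoeff (-1) (-3) u v)^[5] (0, 0) =
      (-u, -u - v) :=
    rotCoeff_succ (e4 u v) (by ring) (by ring)
  have e6 (u v : K) : (rotCoeff (-1) (-3) u v)^[6] (0, 0) =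
      (0, 0) :=
    rotCoeff_succ (e5 u v) (by ring) (by ring)
  refine orderOf_eq_of_pow_and_pow_div_prime (by norm_num)
    (pow_eq_one_of_forall b k l _ fun u v ↦ by rw [h₁, h₂, e6]) fun p hp hpm ↦ ?_
  have n3 : (simpleReflection b k * simpleReflection b l) ^ 3 ≠ 1 :=
    pow_ne_one_of_ne b hkl _ (by rw [h₁, h₂, e3]; norm_num)
  have n2 : (simpleReflection b k * simpleReflection b l) ^ 2 ≠ 1 :=
    pow_ne_one_of_ne b hkl _ (by rw [h₁, h₂, e2]; norm_num)
  have hle : p ≤ 6 := Nat.le_of_dvd (by norm_num) hpm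
  have h2le := hp.two_le
  interval_cases p
  · exact n3
  · exact n2
  · exact absurd hp (by norm_num)
  · exact absurd hpm (by norm_num)
  · exact absurd hp (by norm_num)


/-! ### The weights and the module -/

/-- The set `X̄_f` of `ρ`-shifted weights: a finite set of integral weights which is stable under the
(linear) action of the Weyl group and contains a regular orbit. -/
structure WeightSet (P : RootPairing ι K M N) where
  carrier : Set M
  finite : carrier.Finite
  integral : carrier ⊆ weightLattice P
  smul_mem : ∀ (w : P.weylGroup), ∀ x ∈ carrier, w • x ∈ carrier
  exists_regular : ∃ x ∈ carrier, ∀ w : P.weylGroup, w • x = x → w = 1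

/-- The right action `i ↦ i w = w⁻¹ i`. -/
noncomputable def WeightSet.act (X : WeightSet P) (i : X.carrier) (w : P.weylGroup) : X.carrier :=
  ⟨w⁻¹ • (i : M), X.smul_mem w⁻¹ i i.2⟩

/-- The free module `𝕋_f`. -/
def WeightModule (X : WeightSet P) : Type _ := X.carrier →₀ LaurentZ

noncomputable instance (X : WeightSet P) : AddCommGroup (WeightModule X) :=
  inferInstanceAs (AddCommGroup (X.carrier →₀ LaurentZ))

noncomputable instance (X : WeightSet P) : Module LaurentZ (WeightModule X) :=
  inferInstanceAs (Module LaurentZ (X.carrier →₀ LaurentZ))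

/-- The standard basis. -/
noncomputable def stdBasis (X : WeightSet P) :
    Module.Basis X.carrier LaurentZ (WeightModule X) :=
  Finsupp.basisSingleOne

open Classical in
/-- The operator `v ↦ v H_k`. The last case is the case `i s_k ≺ i`, because `i - i s_k` is an integer
multiple of the simple root `α_k`. -/
noncomputable def heckeOp (b : P.Base) (X : WeightSet P) (k : b.support) :
    WeightModule X →ₗ[LaurentZ] WeightModule X :=
  (stdBasis X).constr LaurentZ fun i ↦
    if X.act i (simpleReflection b k) = i then qpow (-1) • stdBasis X i
    else if DomLT b (i : M) (X.act i (simpleReflection b k)) then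
      stdBasis X (X.act i (simpleReflection b k))
    else stdBasis X (X.act i (simpleReflection b k)) + (qpow (-1) - qpow 1) • stdBasis X i

theorem WeightSet.act_mul (X : WeightSet P) (i : X.carrier) (w w' : P.weylGroup) :
    X.act i (w * w') = X.act (X.act i w) w' :=
  Subtype.ext (by simp [WeightSet.act, mul_smul])

theorem WeightSet.act_one (X : WeightSet P) (i : X.carrier) : X.act i 1 = i :=
  Subtype.ext (by simp [WeightSet.act])

theorem WeightSet.coe_act_simple (X : WeightSet P) (b : P.Base) (i : X.carrier) (k : b.support) :
    (X.act i (simpleReflection b k) : M) = simpleReflection b k • (i : M) := by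
  simp only [WeightSet.act, simpleReflection_inv]

theorem qpow_quadratic : qpow (-1) * qpow (-1) = (qpow (-1) - qpow 1) * qpow (-1) + 1 := by
  have : qpow 1 * qpow (-1) = 1 := by
    rw [qpow, qpow, ← LaurentPolynomial.T_add]
    exact LaurentPolynomial.T_zero
  linear_combination this

section

variable (b : P.Base) (X : WeightSet P)

theorem heckeOp_of_nonpos [CharZero K] (k : b.support) (i : X.carrier) {n : ℤ}
    (hn : P.coroot' (k : ι) i = n) (hle : n ≤ 0) :
    heckeOp b X k (stdBasis X i) =
      qpow (-([n].count 0 : ℤ)) • stdBasis X (X.act i (simpleReflection b k)) := by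
  obtain ⟨h1, h2⟩ := domLE_smul_iff k hn
  rw [heckeOp, Module.Basis.constr_basis]
  rw [← WeightSet.coe_act_simple, ← Subtype.ext_iff] at h1
  rw [← WeightSet.coe_act_simple] at h2
  by_cases h0 : n = 0
  · rw [if_pos (h1.mpr h0), h1.mpr h0, h0]
    simp
  · rw [if_neg (mt h1.mp h0), if_pos (h2.mpr (by omega))]
    simp [h0, qpow]

theorem heckeOp_of_pos [CharZero K] (k : b.support) (i : X.carrier) {n : ℤ}
    (hn : P.coroot' (k : ι) i = n) (hlt : 0 < n) :
    heckeOp b X k (stdBasis X i) = stdBasis X (X.act i (simpleReflection b k)) +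
      (qpow (-1) - qpow 1) • stdBasis X i := by
  obtain ⟨h1, h2⟩ := domLE_smul_iff k hn
  rw [heckeOp, Module.Basis.constr_basis]
  rw [← WeightSet.coe_act_simple, ← Subtype.ext_iff] at h1
  rw [← WeightSet.coe_act_simple] at h2
  rw [if_neg (mt h1.mp (by omega)), if_neg (mt h2.mp (by omega))]

theorem coroot_act (k l : b.support) (i : X.carrier) {m n a : ℤ} (hk : P.coroot' (k : ι) i = m)
    (hl : P.coroot' (l : ι) i = n) (ha : P.pairing k l = a) :
    P.coroot' (l : ι) (X.act i (simpleReflection b k)) = (n - m * a : ℤ) := by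
  rw [WeightSet.coe_act_simple, simpleReflection_smul, map_sub, map_smul, hl, hk,
    RootPairing.root_coroot'_eq_pairing, ha]
  push_cast
  rfl

theorem coroot_act_self (k : b.support) (i : X.carrier) {m : ℤ} (hk : P.coroot' (k : ι) i = m) :
    P.coroot' (k : ι) (X.act i (simpleReflection b k)) = (-m : ℤ) := by
  rw [coroot_act b X k k i (a := 2) hk hk (by simp)]
  congr 1
  ring

theorem act_simple_simple (k : b.support) (i : X.carrier) :
    X.act (X.act i (simpleReflection b k)) (simpleReflection b k) = i := by
  rw [← X.act_mul, simpleReflection_mul_self, X.act_one]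

theorem heckeOp_quadratic [CharZero K] (k : b.support) (v : WeightModule X) :
    heckeOp b X k (heckeOp b X k v) = (qpow (-1) - qpow 1) • heckeOp b X k v + v := by
  have : heckeOp b X k ∘ₗ heckeOp b X k =
      (qpow (-1) - qpow 1) • heckeOp b X k + LinearMap.id := by
    refine (stdBasis X).ext fun i ↦ ?_
    obtain ⟨n, hn⟩ := X.integral i.2 (k : ι)
    have hn' := coroot_act_self b X k i hn
    simp only [LinearMap.comp_apply, LinearMap.add_apply, LinearMap.smul_apply, LinearMap.id_apply]
    rcases lt_trichotomy n 0 with h | h | h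
    · rw [heckeOp_of_nonpos b X k i hn h.le]
      have hc : [n].count 0 = 0 := by simp [h.ne]
      rw [hc, map_smul, heckeOp_of_pos b X k _ hn' (by omega), act_simple_simple]
      simp only [qpow, Nat.cast_zero, neg_zero, LaurentPolynomial.T_zero, one_smul]
      rw [add_comm]
    · have hfix : X.act i (simpleReflection b k) = i := by
        apply Subtype.ext
        rw [WeightSet.coe_act_simple]
        exact (domLE_smul_iff k hn).1.mpr h
      have hv : heckeOp b X k (stdBasis X i) = qpow (-1) • stdBasis X i := by
        rw [heckeOp_of_nonpos b X k i hn h.le, hfix, h]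
        simp
      rw [hv, map_smul, hv, smul_smul, smul_smul, qpow_quadratic, add_smul, one_smul]
    · rw [heckeOp_of_pos b X k i hn h, map_add, map_smul, heckeOp_of_pos b X k i hn h,
        heckeOp_of_nonpos b X k _ hn' (by omega), act_simple_simple]
      have hc : [-n].count 0 = 0 := by simp [h.ne']
      rw [hc]
      simp only [qpow, Nat.cast_zero, neg_zero, LaurentPolynomial.T_zero, one_smul]
      rw [add_comm]
  exact LinearMap.congr_fun this v

/-! ### The braid relations on the module -/

/-- The pairings met along the walk `i, i s_k, i s_k s_l, …`. -/
def walk : ℕ → ℤ → ℤ → ℤ → ℤ → List ℤ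
  | 0, _, _, _, _ => []
  | n + 1, a, c, x, y => x :: walk n c a (y - x * a) (-x)

theorem braidWord_op_apply [CharZero K] (n : ℕ) : ∀ (k l : b.support) (i : X.carrier) (a c x y : ℤ),
    P.pairing k l = a → P.pairing l k = c → P.coroot' (k : ι) i = x → P.coroot' (l : ι) i = y →
    (∀ z ∈ walk n a c x y, z ≤ 0) →
    (braidWord n (MulOpposite.op (heckeOp b X k : Module.End LaurentZ (WeightModule X)))
      (MulOpposite.op (heckeOp b X l))).unop (stdBasis X i) =
    qpow (-((walk n a c x y).count 0 : ℤ)) •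
      stdBasis X (X.act i (braidWord n (simpleReflection b k) (simpleReflection b l))) := by
  induction n with
  | zero =>
    intro k l i a c x y _ _ _ _ _
    simp [braidWord, walk, WeightSet.act_one, qpow]
  | succ n ih =>
    intro k l i a c x y ha hc hx hy hz
    have h0 : x ≤ 0 := hz x (by simp [walk])
    have h1 := heckeOp_of_nonpos b X k i hx h0
    have h2 := ih l k (X.act i (simpleReflection b k)) c a (y - x * a) (-x) hc ha
      (coroot_act b X k l i hx hy ha) (coroot_act_self b X k i hx)
      (fun z hm ↦ hz z (by simp [walk, hm]))
    rw [braidWord, MulOpposite.unop_mul, Module.End.mul_apply, MulOpposite.unop_op, h1, map_smul,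
      h2, smul_smul, braidWord, X.act_mul]
    congr 1
    rw [qpow, qpow, qpow, ← LaurentPolynomial.T_add, walk,
      show x :: walk n c a (y - x * a) (-x) = [x] ++ walk n c a (y - x * a) (-x) from rfl,
      List.count_append]
    congr 1
    push_cast
    ring

theorem braid_of_walk [CharZero K] (k l : b.support) (i : X.carrier) (a c x y : ℤ) (m : ℕ)
    (ha : P.pairing k l = a) (hc : P.pairing l k = c) (hx : P.coroot' (k : ι) i = x)
    (hy : P.coroot' (l : ι) i = y)
    (hm : (simpleReflection b k * simpleReflection b l) ^ m = 1)
    (hz : ∀ z ∈ walk m a c x y, z ≤ 0) (hr : walk m c a y x = (walk m a c x y).reverse) :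
    (braidWord m (MulOpposite.op (heckeOp b X k : Module.End LaurentZ (WeightModule X)))
      (MulOpposite.op (heckeOp b X l))).unop (stdBasis X i) =
    (braidWord m (MulOpposite.op (heckeOp b X l : Module.End LaurentZ (WeightModule X)))
      (MulOpposite.op (heckeOp b X k))).unop (stdBasis X i) := by
  rw [braidWord_op_apply b X m k l i a c x y ha hc hx hy hz,
    braidWord_op_apply b X m l k i c a y x hc ha hy hx (by
      intro z h
      rw [hr, List.mem_reverse] at h
      exact hz z h),
    hr, List.count_reverse,
    braidWord_comm (simpleReflection_mul_self b k) (simpleReflection_mul_self b l) hm]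

/-- If the two braid words agree on a vector, they agree on its image under `H_k`. -/
theorem braid_mul_left {R S : Type*} [CommRing R] [Ring S] [Algebra R S] (z : R) (s t : S)
    (hs : s * s = z • s + 1) (ht : t * t = z • t + 1) {m : ℕ} (hm : 0 < m) :
    ∃ e, s * (braidWord m s t - braidWord m t s) =
      (braidWord m s t - braidWord m t s) * e := by
  have last : ∀ n, ∀ s t : S, braidWord (n + 1) s t =
      braidWord n s t * (if Even n then s else t) := by
    intro n
    induction n with
    | zero => intro s t; simp [braidWord]
    | succ n ih =>
      intro s t
      rw [braidWord, ih t s, braidWord, mul_assoc]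
      congr 2
      simp only [Nat.even_add_one]
      split_ifs <;> rfl
  obtain ⟨n, rfl⟩ : ∃ n, m = n + 1 := ⟨m - 1, by omega⟩
  set e : S := if Even (n + 1) then s else t with he
  have hee : e * e = z • e + 1 := by
    rw [he]; split_ifs <;> assumption
  have he' : (if Even n then t else s) = e := by
    rw [he]
    simp only [Nat.even_add_one]
    split_ifs <;> rfl
  have h1 : s * braidWord (n + 1) t s = braidWord (n + 1) s t * e := last (n + 1) s t
  have h2 : braidWord (n + 1) t s = braidWord n t s * e := by rw [last n t s, he']
  have h3 : s * braidWord (n + 1) s t = z • braidWord (n + 1) s t + braidWord n t s := by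
    rw [braidWord, ← mul_assoc, hs, add_mul, one_mul, smul_mul_assoc]
  have h4 : braidWord (n + 1) t s * e = z • braidWord (n + 1) t s + braidWord n t s := by
    rw [h2, mul_assoc, hee, mul_add, mul_one, mul_smul_comm]
  refine ⟨z • 1 - e, ?_⟩
  rw [mul_sub, h1, h3, sub_mul, mul_sub, mul_sub, h4]
  simp only [mul_smul_comm, mul_one]
  abel

theorem orderOf_swap (k l : b.support) :
    orderOf (simpleReflection b l * simpleReflection b k) =
      orderOf (simpleReflection b k * simpleReflection b l) := by
  rw [← orderOf_inv, mul_inv_rev, simpleReflection_inv, simpleReflection_inv]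

theorem cartan_cases [CharZero K] [Finite ι] [P.IsCrystallographic] [P.IsReduced]
    {k l : b.support} (hkl : k ≠ l) :
    (P.pairingIn ℤ k l, P.pairingIn ℤ l k) ∈
      ({(0, 0), (-1, -1), (-1, -2), (-1, -3)} : Set (ℤ × ℤ)) ∨
    (P.pairingIn ℤ l k, P.pairingIn ℤ k l) ∈
      ({(0, 0), (-1, -1), (-1, -2), (-1, -3)} : Set (ℤ × ℤ)) := by
  have hkl' : (k : ι) ≠ l := fun h ↦ hkl (Subtype.ext h)
  have hmem := P.pairingIn_pairingIn_mem_set_of_isCrystal_of_isRed' k l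
    (fun h ↦ hkl' (P.root.injective h)) (b.root_ne_neg_of_ne k.2 l.2 hkl')
  have hle := b.pairingIn_le_zero_of_ne hkl' k.2 l.2
  generalize P.pairingIn ℤ k l = p at *
  generalize P.pairingIn ℤ l k = p' at *
  simp only [Set.mem_insert_iff, Set.mem_singleton_iff, Prod.mk.injEq] at hmem ⊢
  rcases hmem with ⟨rfl, rfl⟩ | ⟨rfl, rfl⟩ | ⟨rfl, rfl⟩ | ⟨rfl, rfl⟩ | ⟨rfl, rfl⟩ | ⟨rfl, rfl⟩ |
    ⟨rfl, rfl⟩ | ⟨rfl, rfl⟩ | ⟨rfl, rfl⟩ | ⟨rfl, rfl⟩ | ⟨rfl, rfl⟩ <;> revert hle <;> decide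

theorem orderOf_simple_pos [CharZero K] [Finite ι] [P.IsCrystallographic] [P.IsReduced]
    {k l : b.support} (hkl : k ≠ l) :
    0 < orderOf (simpleReflection b k * simpleReflection b l) := by
  have aux : ∀ k l : b.support, k ≠ l → (P.pairingIn ℤ k l, P.pairingIn ℤ l k) ∈
      ({(0, 0), (-1, -1), (-1, -2), (-1, -3)} : Set (ℤ × ℤ)) →
      0 < orderOf (simpleReflection b k * simpleReflection b l) := by
    intro k l hkl h
    have c1 : P.pairing k l = (P.pairingIn ℤ k l : ℤ) := (P.algebraMap_pairingIn ℤ k l).symm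
    have c2 : P.pairing l k = (P.pairingIn ℤ l k : ℤ) := (P.algebraMap_pairingIn ℤ l k).symm
    simp only [Set.mem_insert_iff, Set.mem_singleton_iff, Prod.mk.injEq] at h
    rcases h with ⟨h1, h2⟩ | ⟨h1, h2⟩ | ⟨h1, h2⟩ | ⟨h1, h2⟩ <;> rw [h1] at c1 <;> rw [h2] at c2 <;>
      push_cast at c1 c2
    · rw [orderOf_eq_two b hkl c1 c2]; norm_num
    · rw [orderOf_eq_three b hkl c1 c2]; norm_num
    · rw [orderOf_eq_four b hkl c1 c2]; norm_num
    · rw [orderOf_eq_six b hkl c1 c2]; norm_num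
  rcases cartan_cases b hkl with h | h
  · exact aux k l hkl h
  · rw [← orderOf_swap]
    exact aux l k hkl.symm h

theorem braid_antidominant [CharZero K] [Finite ι] [P.IsCrystallographic] [P.IsReduced]
    {k l : b.support} (hkl : k ≠ l)
    (i : X.carrier) {x y : ℤ} (hx : P.coroot' (k : ι) i = x) (hy : P.coroot' (l : ι) i = y)
    (hx0 : x ≤ 0) (hy0 : y ≤ 0) :
    (braidWord (orderOf (simpleReflection b k * simpleReflection b l))
      (MulOpposite.op (heckeOp b X k : Module.End LaurentZ (WeightModule X)))
      (MulOpposite.op (heckeOp b X l))).unop (stdBasis X i) =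
    (braidWord (orderOf (simpleReflection b k * simpleReflection b l))
      (MulOpposite.op (heckeOp b X l : Module.End LaurentZ (WeightModule X)))
      (MulOpposite.op (heckeOp b X k))).unop (stdBasis X i) := by
  have wlog : ∀ (k l : b.support), k ≠ l → ∀ x y : ℤ, P.coroot' (k : ι) i = x →
      P.coroot' (l : ι) i = y → x ≤ 0 → y ≤ 0 →
      (P.pairingIn ℤ k l, P.pairingIn ℤ l k) ∈ ({(0, 0), (-1, -1), (-1, -2), (-1, -3)} :
        Set (ℤ × ℤ)) →
      (braidWord (orderOf (simpleReflection b k * simpleReflection b l))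
        (MulOpposite.op (heckeOp b X k : Module.End LaurentZ (WeightModule X)))
        (MulOpposite.op (heckeOp b X l))).unop (stdBasis X i) =
      (braidWord (orderOf (simpleReflection b k * simpleReflection b l))
        (MulOpposite.op (heckeOp b X l : Module.End LaurentZ (WeightModule X)))
        (MulOpposite.op (heckeOp b X k))).unop (stdBasis X i) := by
    intro k l hkl x y hx hy hx0 hy0 h
    have hm := pow_orderOf_eq_one (simpleReflection b k * simpleReflection b l)
    have c1 : P.pairing k l = (P.pairingIn ℤ k l : ℤ) := (P.algebraMap_pairingIn ℤ k l).symm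
    have c2 : P.pairing l k = (P.pairingIn ℤ l k : ℤ) := (P.algebraMap_pairingIn ℤ l k).symm
    simp only [Set.mem_insert_iff, Set.mem_singleton_iff, Prod.mk.injEq] at h
    rcases h with ⟨h1, h2⟩ | ⟨h1, h2⟩ | ⟨h1, h2⟩ | ⟨h1, h2⟩ <;> rw [h1] at c1 <;> rw [h2] at c2
    · have ho := orderOf_eq_two b hkl (by simpa using c1) (by simpa using c2)
      refine braid_of_walk b X k l i _ _ x y _ c1 c2 hx hy hm ?_ ?_ <;> rw [ho]
      · simp [walk, hx0, hy0]
      · simp [walk]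
    · have ho := orderOf_eq_three b hkl (by simpa using c1) (by simpa using c2)
      refine braid_of_walk b X k l i _ _ x y _ c1 c2 hx hy hm ?_ ?_ <;> rw [ho]
      · simp only [walk, List.mem_cons, List.not_mem_nil, or_false, forall_eq_or_imp, forall_eq]
        omega
      · simp only [walk, List.reverse_cons, List.reverse_nil, List.nil_append, List.cons_append,
          List.cons.injEq, and_true]
        omega
    · have ho := orderOf_eq_four b hkl (by simpa using c1) (by simpa using c2)
      refine braid_of_walk b X k l i _ _ x y _ c1 c2 hx hy hm ?_ ?_ <;> rw [ho]
      · simp only [walk, List.mem_cons, List.not_mem_nil, or_false, forall_eq_or_imp, forall_eq]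
        omega
      · simp only [walk, List.reverse_cons, List.reverse_nil, List.nil_append, List.cons_append,
          List.cons.injEq, and_true]
        omega
    · have ho := orderOf_eq_six b hkl (by simpa using c1) (by simpa using c2)
      refine braid_of_walk b X k l i _ _ x y _ c1 c2 hx hy hm ?_ ?_ <;> rw [ho]
      · simp only [walk, List.mem_cons, List.not_mem_nil, or_false, forall_eq_or_imp, forall_eq]
        omega
      · simp only [walk, List.reverse_cons, List.reverse_nil, List.nil_append, List.cons_append,
          List.cons.injEq, and_true]
        omega
  have ho := orderOf_swap b k l
  rcases cartan_cases b hkl with h | h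
  · exact wlog k l hkl x y hx hy hx0 hy0 h
  · have := wlog l k hkl.symm y x hy hx hy0 hx0 h
    rw [ho] at this
    exact this.symm

theorem domLT_wellFounded [CharZero K] :
    WellFounded fun i j : X.carrier ↦ DomLT b (i : M) (j : M) := by
  have hfin : Finite X.carrier := X.finite
  let r : X.carrier → X.carrier → Prop := fun i j ↦ DomLT b (i : M) j
  have hirr : Std.Irrefl r := ⟨fun i h ↦ h.2 rfl⟩
  have htr : IsTrans X.carrier r := ⟨fun i j h hij hjh ↦ by
    have h1 : DomLE b (i : M) h := by
      have := add_mem hjh.1 hij.1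
      simpa [DomLE] using this
    refine ⟨h1, fun heq ↦ ?_⟩
    have h2 : DomLE b (h : M) j := heq ▸ hij.1
    exact hjh.2 (DomLE.antisymm hjh.1 h2)⟩
  exact Finite.wellFounded_of_trans_of_irrefl r

theorem heckeOp_op_mul_self [CharZero K] (k : b.support) :
    MulOpposite.op (heckeOp b X k : Module.End LaurentZ (WeightModule X)) *
      MulOpposite.op (heckeOp b X k) =
    (qpow (-1) - qpow 1) • MulOpposite.op (heckeOp b X k) + 1 := by
  apply MulOpposite.unop_injective
  ext1 v
  exact heckeOp_quadratic b X k v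

theorem heckeOp_braid [CharZero K] [Finite ι] [P.IsCrystallographic] [P.IsReduced]
    {k l : b.support} (hkl : k ≠ l) :
    braidWord (orderOf (simpleReflection b k * simpleReflection b l))
      (MulOpposite.op (heckeOp b X k : Module.End LaurentZ (WeightModule X)))
      (MulOpposite.op (heckeOp b X l)) =
    braidWord (orderOf (simpleReflection b k * simpleReflection b l))
      (MulOpposite.op (heckeOp b X l : Module.End LaurentZ (WeightModule X)))
      (MulOpposite.op (heckeOp b X k)) := by
  set m := orderOf (simpleReflection b k * simpleReflection b l) with hm
  set s := MulOpposite.op (heckeOp b X k : Module.End LaurentZ (WeightModule X)) with hs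
  set t := MulOpposite.op (heckeOp b X l : Module.End LaurentZ (WeightModule X)) with ht
  have hm0 : 0 < m := orderOf_simple_pos b hkl
  obtain ⟨e, he⟩ := braid_mul_left (qpow (-1) - qpow 1) s t (heckeOp_op_mul_self b X k)
    (heckeOp_op_mul_self b X l) hm0
  obtain ⟨f, hf⟩ := braid_mul_left (qpow (-1) - qpow 1) t s (heckeOp_op_mul_self b X l)
    (heckeOp_op_mul_self b X k) hm0
  have stepk : ∀ v, (braidWord m s t - braidWord m t s).unop v = 0 →
      (braidWord m s t - braidWord m t s).unop (heckeOp b X k v) = 0 := by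
    intro v hv
    have := congrArg (fun D : (Module.End LaurentZ (WeightModule X))ᵐᵒᵖ ↦ D.unop v) he
    simp only [MulOpposite.unop_mul, Module.End.mul_apply, hv, map_zero] at this
    exact this
  have stepl : ∀ v, (braidWord m s t - braidWord m t s).unop v = 0 →
      (braidWord m s t - braidWord m t s).unop (heckeOp b X l v) = 0 := by
    intro v hv
    rw [← neg_sub (braidWord m t s), MulOpposite.unop_neg, LinearMap.neg_apply, neg_eq_zero] at hv ⊢
    have := congrArg (fun D : (Module.End LaurentZ (WeightModule X))ᵐᵒᵖ ↦ D.unop v) hf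
    simp only [MulOpposite.unop_mul, Module.End.mul_apply, hv, map_zero] at this
    exact this
  have hwf := domLT_wellFounded b X
  have main : ∀ i : X.carrier, (braidWord m s t - braidWord m t s).unop (stdBasis X i) = 0 := by
    intro i
    induction i using hwf.induction with
    | _ i ih =>
    obtain ⟨x, hx⟩ := X.integral i.2 (k : ι)
    obtain ⟨y, hy⟩ := X.integral i.2 (l : ι)
    have down : ∀ (k : b.support) (x : ℤ), P.coroot' (k : ι) i = x → 0 < x →
        DomLT b (X.act i (simpleReflection b k) : M) i ∧
        heckeOp b X k (stdBasis X (X.act i (simpleReflection b k))) = stdBasis X i := by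
      intro k x hx h
      have hx' := coroot_act_self b X k i hx
      constructor
      · have := (domLE_smul_iff k hx').2.mpr (by omega)
        rwa [← WeightSet.coe_act_simple, act_simple_simple] at this
      · rw [heckeOp_of_nonpos b X k _ hx' (by omega), act_simple_simple]
        have hc : [-x].count 0 = 0 := by simp [h.ne']
        simp [hc, qpow]
    by_cases h1 : 0 < x
    · obtain ⟨hr, hv⟩ := down k x hx h1
      rw [← hv]
      exact stepk _ (ih _ hr)
    by_cases h2 : 0 < y
    · obtain ⟨hr, hv⟩ := down l y hy h2
      rw [← hv]
      exact stepl _ (ih _ hr)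
    have := braid_antidominant b X hkl i hx hy (by omega) (by omega)
    rw [MulOpposite.unop_sub, LinearMap.sub_apply, sub_eq_zero]
    exact this
  rw [← sub_eq_zero]
  apply MulOpposite.unop_injective
  exact (stdBasis X).ext main

end


/-! ### The Hecke algebra -/

/-- The quadratic and the braid relations. -/
inductive HeckeRel (b : P.Base) :
    FreeAlgebra LaurentZ b.support → FreeAlgebra LaurentZ b.support → Prop
  | quadratic (k : b.support) : HeckeRel b
      ((FreeAlgebra.ι LaurentZ k - algebraMap LaurentZ _ (qpow (-1))) *
        (FreeAlgebra.ι LaurentZ k + algebraMap LaurentZ _ (qpow 1))) 0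
  | braid (k l : b.support) (hkl : k ≠ l) : HeckeRel b
      (braidWord (orderOf (simpleReflection b k * simpleReflection b l))
        (FreeAlgebra.ι LaurentZ k) (FreeAlgebra.ι LaurentZ l))
      (braidWord (orderOf (simpleReflection b k * simpleReflection b l))
        (FreeAlgebra.ι LaurentZ l) (FreeAlgebra.ι LaurentZ k))

/-- The Hecke algebra of the Weyl group, by generators and relations. -/
def Hecke (b : P.Base) : Type _ := RingQuot (HeckeRel b)

noncomputable instance (b : P.Base) : Ring (Hecke b) :=
  inferInstanceAs (Ring (RingQuot (HeckeRel b)))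

noncomputable instance (b : P.Base) : Algebra LaurentZ (Hecke b) :=
  inferInstanceAs (Algebra LaurentZ (RingQuot (HeckeRel b)))

/-- The generator `H_k`. -/
noncomputable def heckeGen (b : P.Base) (k : b.support) : Hecke b :=
  RingQuot.mkAlgHom LaurentZ (HeckeRel b) (FreeAlgebra.ι LaurentZ k)

theorem map_braidWord {G H F : Type*} [Monoid G] [Monoid H] [FunLike F G H] [MonoidHomClass F G H]
    (f : F) (n : ℕ) : ∀ a c : G, f (braidWord n a c) = braidWord n (f a) (f c) := by
  induction n with
  | zero => intro a c; exact map_one f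
  | succ n ih => intro a c; rw [braidWord, map_mul, ih, braidWord]

/-- The set `Λ_f` of linkage classes, i.e. `W`-orbits on `X̄_f`. -/
def LinkageClass (X : WeightSet P) : Type _ :=
  {S : Set M // ∃ x ∈ X.carrier, S = MulAction.orbit P.weylGroup x}

theorem exists_antidominant [CharZero K] (b : P.Base) (X : WeightSet P) (γ : LinkageClass X) :
    ∃ i : X.carrier, (i : M) ∈ γ.1 ∧ IsAntidominant b (i : M) := by
  obtain ⟨S, x, hx, rfl⟩ := γ
  obtain ⟨i, hi, hmin⟩ := (domLT_wellFounded b X).has_min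
    {i : X.carrier | (i : M) ∈ MulAction.orbit P.weylGroup x}
    ⟨⟨x, hx⟩, MulAction.mem_orbit_self x⟩
  refine ⟨i, hi, fun k ↦ ?_⟩
  obtain ⟨n, hn⟩ := X.integral i.2 (k : ι)
  refine ⟨n, ?_, hn⟩
  by_contra! hpos
  refine hmin (X.act i (simpleReflection b k)) ?_ ?_
  · obtain ⟨w, hw⟩ := hi
    refine ⟨simpleReflection b k * w, ?_⟩
    rw [WeightSet.coe_act_simple]
    simp only [mul_smul]
    exact congrArg _ hw
  · have := (domLE_smul_iff k (coroot_act_self b X k i hn)).2.mpr (by omega)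
    rwa [← WeightSet.coe_act_simple, act_simple_simple] at this

variable [CharZero K] [Finite ι] [P.IsCrystallographic] [P.IsReduced]

/-- The right action of the Hecke algebra, as a homomorphism to the opposite of `End_𝒜(𝕋_f)`. -/
noncomputable def heckeAction (b : P.Base) (X : WeightSet P) :
    Hecke b →ₐ[LaurentZ] (Module.End LaurentZ (WeightModule X))ᵐᵒᵖ :=
  RingQuot.liftAlgHom LaurentZ
    ⟨FreeAlgebra.lift LaurentZ fun k ↦ MulOpposite.op (heckeOp b X k), by
      intro x y h
      cases h with
      | quadratic k =>
        rw [map_mul, map_sub, map_add, map_zero, AlgHom.commutes, AlgHom.commutes,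
          FreeAlgebra.lift_ι_apply, sub_mul, mul_add, mul_add, heckeOp_op_mul_self b X k,
          Algebra.algebraMap_eq_smul_one, Algebra.algebraMap_eq_smul_one]
        have h1 : qpow 1 * qpow (-1) = 1 := by
          rw [qpow, qpow, ← LaurentPolynomial.T_add]
          exact LaurentPolynomial.T_zero
        simp only [smul_mul_assoc, mul_smul_comm, one_mul, mul_one, smul_smul, sub_smul]
        rw [h1, one_smul]
        abel
      | braid k l hkl =>
        rw [map_braidWord, map_braidWord, FreeAlgebra.lift_ι_apply, FreeAlgebra.lift_ι_apply]
        exact heckeOp_braid b X hkl⟩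

theorem heckeAction_gen (b : P.Base) (X : WeightSet P) (k : b.support) :
    heckeAction b X (heckeGen b k) = MulOpposite.op (heckeOp b X k) := by
  rw [heckeAction, heckeGen]
  erw [RingQuot.liftAlgHom_mkAlgHom_apply]
  exact FreeAlgebra.lift_ι_apply _ _

/-- `𝕋_f` as a right `ℋ`-module: `MulOpposite.op h • v` is `v h`. -/
noncomputable instance (b : P.Base) (X : WeightSet P) : Module (Hecke b)ᵐᵒᵖ (WeightModule X) :=
  Module.compHom (WeightModule X) (AlgHom.opComm (heckeAction b X)).toRingHom

theorem op_smul_eq (b : P.Base) (X : WeightSet P) (h : Hecke b) (v : WeightModule X) :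
    MulOpposite.op h • v = (heckeAction b X h).unop v := rfl

theorem op_gen_smul (b : P.Base) (X : WeightSet P) (k : b.support) (v : WeightModule X) :
    MulOpposite.op (heckeGen b k) • v = heckeOp b X k v := by
  rw [op_smul_eq, heckeAction_gen]
  rfl

instance (b : P.Base) (X : WeightSet P) :
    SMulCommClass (Hecke b)ᵐᵒᵖ LaurentZ (WeightModule X) where
  smul_comm h a v := map_smul (heckeAction b X h.unop).unop a v

instance (b : P.Base) (X : WeightSet P) :
    SMulCommClass LaurentZ (Hecke b)ᵐᵒᵖ (WeightModule X) := SMulCommClass.symm _ _ _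

instance (b : P.Base) (X : WeightSet P) :
    IsScalarTower LaurentZ (Hecke b)ᵐᵒᵖ (WeightModule X) where
  smul_assoc a h v := by
    change (heckeAction b X (a • h.unop)).unop v = a • (heckeAction b X h.unop).unop v
    rw [map_smul]
    rfl

/-- The `q`-Schur algebra `End_ℋ(𝕋_f)`. -/
abbrev SchurAlgebra (b : P.Base) (X : WeightSet P) : Type _ :=
  Module.End (Hecke b)ᵐᵒᵖ (WeightModule X)

/-- The coordinate function `c_{i,j}` on the `q`-Schur algebra. -/
noncomputable def coordFn (b : P.Base) (X : WeightSet P) (i j : X.carrier) :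
    Module.Dual LaurentZ (SchurAlgebra b X) where
  toFun η := (stdBasis X).repr (η (stdBasis X j)) i
  map_add' η ζ := by simp
  map_smul' a η := by simp

/-! ### The index sets -/

/-- The transversal `X̄_f^(2)`: pairs `(i, j)` with `j` anti-dominant, and with `i ⪯ i s_k` whenever
`j s_k = j`. -/
def PairIndex (b : P.Base) (X : WeightSet P) : Type _ :=
  {p : X.carrier × X.carrier // IsAntidominant b (p.2 : M) ∧
    ∀ k : b.support, X.act p.2 (simpleReflection b k) = p.2 →
      DomLE b (p.1 : M) (X.act p.1 (simpleReflection b k))}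

/-- The anti-dominant element `i_γ⁻` of a linkage class. -/
noncomputable def antidomRep (b : P.Base) (X : WeightSet P) (γ : LinkageClass X) : X.carrier :=
  (exists_antidominant b X γ).choose

/-- The set `J_γ` of those `k` for which `s_k` fixes `i_γ⁻`. -/
def stabSet (b : P.Base) (X : WeightSet P) (γ : LinkageClass X) : Set b.support :=
  {k | X.act (antidomRep b X γ) (simpleReflection b k) = antidomRep b X γ}

/-- The parabolic subgroup `W_J`. -/
noncomputable def parabolic (b : P.Base) (J : Set b.support) : Subgroup P.weylGroup :=
  Subgroup.closure (simpleReflection b '' J)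

/-- The length of the longest element of `W_J`. -/
noncomputable def longestLength (b : P.Base) (J : Set b.support) : ℕ :=
  sSup (length b '' (parabolic b J : Set P.weylGroup))

/-- The set `𝒟_γ` of minimal length representatives of the right cosets `W_γ w`. -/
def minReps (b : P.Base) (X : WeightSet P) (γ : LinkageClass X) : Set P.weylGroup :=
  {w | ∀ u ∈ parabolic b (stabSet b X γ), length b (u * w) = length b u + length b w}

/-- The set `Ξ` of triples `(γ, g, ν)` with `g` a minimal length `(W_γ, W_ν)`-double coset
representative. -/
structure DoubleCosetIndex (b : P.Base) (X : WeightSet P) where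
  left : LinkageClass X
  elt : P.weylGroup
  right : LinkageClass X
  elt_mem : elt ∈ minReps b X left
  inv_mem : elt⁻¹ ∈ minReps b X right

/-! ### Permutation modules -/

/-- `H_w`, the product of the generators along a reduced word of `w`. By the braid relations it does
not depend on the word. -/
noncomputable def heckeElt (b : P.Base) (w : P.weylGroup) : Hecke b :=
  ((exists_reduced_word b w).choose.map (heckeGen b)).prod

/-- `H_Y = ∑_{w ∈ Y} q^{-ℓ(w)} H_w`. -/
noncomputable def heckeSum (b : P.Base) (Y : Set P.weylGroup) : Hecke b :=
  ∑ᶠ w ∈ Y, qpow (-(length b w : ℤ)) • heckeElt b w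

/-- The `q`-symmetrizer `x_J = ∑_{w ∈ W_J} q^{ℓ(w_∘^J) - ℓ(w)} H_w`. -/
noncomputable def symmetrizer (b : P.Base) (J : Set b.support) : Hecke b :=
  ∑ᶠ w ∈ (parabolic b J : Set P.weylGroup),
    qpow ((longestLength b J : ℤ) - length b w) • heckeElt b w

/-- The right ideal `x_γ ℋ`. -/
noncomputable def permModule (b : P.Base) (X : WeightSet P) (γ : LinkageClass X) :
    Submodule (Hecke b)ᵐᵒᵖ (Hecke b) :=
  Submodule.span _ {symmetrizer b (stabSet b X γ)}

/-- The generator `x_γ` of `x_γ ℋ`. -/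
noncomputable def permGen (b : P.Base) (X : WeightSet P) (γ : LinkageClass X) :
    permModule b X γ :=
  ⟨symmetrizer b (stabSet b X γ), Submodule.mem_span_singleton_self _⟩

/-- The direct sum `⨁_γ x_γ ℋ`. -/
abbrev PermSum (b : P.Base) (X : WeightSet P) : Type _ :=
  DirectSum (LinkageClass X) fun γ ↦ permModule b X γ

open Classical in
/-- The element `x_γ` of `⨁_γ x_γ ℋ`. -/
noncomputable def permSumGen (b : P.Base) (X : WeightSet P) (γ : LinkageClass X) : PermSum b X :=
  DirectSum.of (fun γ ↦ permModule b X γ) γ (permGen b X γ)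

/-- `Ω` is the identification `𝕋_f ≅ ⨁_γ x_γ ℋ` sending `v_{i_γ⁻}` to `x_γ`. -/
def IsPermIdentification (b : P.Base) (X : WeightSet P)
    (Ω : WeightModule X ≃ₗ[(Hecke b)ᵐᵒᵖ] PermSum b X) : Prop :=
  ∀ γ, Ω (stdBasis X (antidomRep b X γ)) = permSumGen b X γ

open Classical in
/-- `ζ` is the element `η_{i,j}`: among the coordinates indexed by the transversal, only `c_{i,j}`
is nonzero on `ζ`, and it is `1`. -/
def IsEta (b : P.Base) (X : WeightSet P) (p : PairIndex b X) (ζ : SchurAlgebra b X) : Prop :=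
  ∀ r : PairIndex b X, coordFn b X r.1.1 r.1.2 ζ = if p = r then 1 else 0

open Classical in
/-- Transported through `Ω`, `ζ` is the endomorphism `φ_{γν}^g` of `⨁_γ x_γ ℋ`, given by
`x_{ν'} ↦ δ_{ν,ν'} q^{ℓ(w_∘^ν)} H_{W_γ g W_ν}`, an element of the summand `x_γ ℋ`. -/
def IsPhi (b : P.Base) (X : WeightSet P) (Ω : WeightModule X ≃ₗ[(Hecke b)ᵐᵒᵖ] PermSum b X)
    (ξ : DoubleCosetIndex b X) (ζ : SchurAlgebra b X) : Prop :=
  ∀ ν' γ' : LinkageClass X, ((Ω (ζ (Ω.symm (permSumGen b X ν'))) γ' : permModule b X γ') : Hecke b) =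
    if ν' = ξ.right ∧ γ' = ξ.left then
      qpow (longestLength b (stabSet b X ξ.right)) •
        heckeSum b (DoubleCoset.doubleCoset ξ.elt (parabolic b (stabSet b X ξ.left))
          (parabolic b (stabSet b X ξ.right)))
    else 0

end WeylGroup
end QSchur

namespace QSchur

section RootCombinatorics

set_option linter.unusedSectionVars false

variable {ι K M N : Type*} [Field K] [AddCommGroup M] [Module K M]
  [AddCommGroup N] [Module K N] {P : RootPairing ι K M N}

/-! ### The action of the Weyl group on the indices of roots -/

/-- The action of the Weyl group on the indices of roots. -/
noncomputable def rootAct (w : P.weylGroup) (β : ι) : ι := P.weylGroupToPerm w β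

theorem rootAct_mul (w w' : P.weylGroup) (β : ι) :
    rootAct (w * w') β = rootAct w (rootAct w' β) := by
  simp [rootAct]

theorem rootAct_one (β : ι) : rootAct (1 : P.weylGroup) β = β := by
  simp [rootAct]

theorem rootAct_inv_rootAct (w : P.weylGroup) (β : ι) : rootAct w⁻¹ (rootAct w β) = β := by
  rw [← rootAct_mul, inv_mul_cancel, rootAct_one]

theorem rootAct_rootAct_inv (w : P.weylGroup) (β : ι) : rootAct w (rootAct w⁻¹ β) = β := by
  rw [← rootAct_mul, mul_inv_cancel, rootAct_one]

theorem smul_root (w : P.weylGroup) (β : ι) : w • P.root β = P.root (rootAct w β) :=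
  P.weylGroup_apply_root w β

theorem rootAct_ofIdx (α β : ι) :
    rootAct (RootPairing.weylGroup.ofIdx P α) β = P.reflectionPerm α β := by
  apply P.root.injective
  rw [← smul_root, RootPairing.root_reflectionPerm]
  rfl

theorem rootAct_simpleReflection (b : P.Base) (k : b.support) (β : ι) :
    rootAct (simpleReflection b k) β = P.reflectionPerm k β := rootAct_ofIdx _ _

theorem root_reflectionPerm_self (β : ι) : P.root (P.reflectionPerm β β) = -P.root β := by
  rw [RootPairing.root_reflectionPerm, RootPairing.reflection_apply_self]

theorem coroot'_reflectionPerm_self (β : ι) (x : M) :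
    P.coroot' (P.reflectionPerm β β) x = -P.coroot' β x := by
  rw [← P.coroot'_reflection, RootPairing.reflection_apply, map_sub, map_smul,
    RootPairing.root_coroot'_eq_pairing, RootPairing.pairing_same, smul_eq_mul]
  ring

theorem rootAct_reflectionPerm_self (w : P.weylGroup) (β : ι) :
    rootAct w (P.reflectionPerm β β) = P.reflectionPerm (rootAct w β) (rootAct w β) := by
  apply P.root.injective
  rw [← smul_root, root_reflectionPerm_self, root_reflectionPerm_self, smul_neg, smul_root]

variable [CharZero K] [Finite ι] [P.IsCrystallographic] [P.IsReduced]

theorem coroot'_inv_smul (b : P.Base) (w : P.weylGroup) (β : ι) (x : M) :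
    P.coroot' β (w⁻¹ • x) = P.coroot' (rootAct w β) x := by
  obtain ⟨l, rfl⟩ := exists_word b w
  induction l generalizing x with
  | nil => simp [rootAct_one]
  | cons k l ih =>
    rw [List.map_cons, List.prod_cons, mul_inv_rev, mul_smul, ih, rootAct_mul,
      rootAct_simpleReflection, simpleReflection_inv, ← P.coroot'_reflection]
    rfl

/-! ### Positive roots -/

/-- The indices of the positive roots, characterised through the corresponding coroots. -/
def IsPosIdx (b : P.Base) (β : ι) : Prop := b.flip.IsPos β

theorem isPosIdx_simple (b : P.Base) (k : b.support) : IsPosIdx b k :=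
  RootPairing.Base.isPos_of_mem_support (b := b.flip) k.2

theorem isPosIdx_neg (b : P.Base) (β : ι) :
    IsPosIdx b (P.reflectionPerm β β) ↔ ¬ IsPosIdx b β :=
  RootPairing.Base.IsPos.neg_iff_not b.flip β

theorem IsPosIdx.rootAct_simple {b : P.Base} {β : ι} (hβ : IsPosIdx b β) {k : b.support}
    (hk : β ≠ k) : IsPosIdx b (rootAct (simpleReflection b k) β) := by
  rw [rootAct_simpleReflection]
  exact RootPairing.Base.IsPos.reflectionPerm (b := b.flip) hβ k.2 hk

theorem not_isPosIdx_rootAct_simple (b : P.Base) (k : b.support) :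
    ¬ IsPosIdx b (rootAct (simpleReflection b k) k) := by
  rw [rootAct_simpleReflection, isPosIdx_neg, not_not]
  exact isPosIdx_simple b k

theorem IsPosIdx.exists_coroot_eq {b : P.Base} {β : ι} (hβ : IsPosIdx b β) :
    ∃ f : b.support → ℕ, P.coroot β = ∑ k, f k • P.coroot k := by
  obtain ⟨f, -, hf⟩ := b.flip.exists_root_eq_sum_nat_or_neg β
  have key : P.coroot β = ∑ j ∈ b.support, f j • P.coroot j := by
    rcases hf with h | h
    · exact h
    · exfalso
      have := b.flip.height_eq_sum (i := β) (f := fun j ↦ -(f j : ℤ)) (by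
        rw [h, ← Finset.sum_neg_distrib]
        refine Finset.sum_congr rfl fun j _ ↦ ?_
        rw [neg_smul, natCast_zsmul])
      have h2 : 0 < b.flip.height β := hβ
      rw [this, Finset.sum_neg_distrib] at h2
      have h3 : (0 : ℤ) ≤ ∑ j ∈ b.flip.support, (f j : ℤ) :=
        Finset.sum_nonneg fun _ _ ↦ by positivity
      omega
  refine ⟨fun k ↦ f k, ?_⟩
  rw [key, ← Finset.sum_coe_sort]

theorem IsPosIdx.coroot'_eq {b : P.Base} {β : ι} (hβ : IsPosIdx b β) :
    ∃ f : b.support → ℕ, ∀ x, P.coroot' β x = ∑ k, (f k : K) * P.coroot' (k : ι) x := by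
  obtain ⟨f, hf⟩ := hβ.exists_coroot_eq
  refine ⟨f, fun x ↦ ?_⟩
  rw [RootPairing.coroot', hf, map_sum, LinearMap.sum_apply]
  simp

/-- Positive coroots which vanish on an antidominant weight `j` are combinations of the simple
coroots which vanish on `j`. -/
theorem IsPosIdx.coroot'_nonpos_of_eq_zero {b : P.Base} {β : ι} (hβ : IsPosIdx b β) {j : M}
    (hj : IsAntidominant b j) (h0 : P.coroot' β j = 0) {x : M}
    (hx : ∀ k : b.support, P.coroot' (k : ι) j = 0 → ∃ n : ℤ, n ≤ 0 ∧ P.coroot' (k : ι) x = n) :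
    ∃ n : ℤ, n ≤ 0 ∧ P.coroot' β x = n := by
  obtain ⟨f, hf⟩ := hβ.coroot'_eq
  choose n hn hjn using hj
  rw [hf] at h0
  have h1 : ∑ k, (f k : ℤ) * n k = 0 := by
    have : ((∑ k, (f k : ℤ) * n k : ℤ) : K) = 0 := by
      rw [← h0]; push_cast; exact Finset.sum_congr rfl fun k _ ↦ by rw [hjn]
    exact_mod_cast this
  have h2 : ∀ k, (f k : ℤ) * n k = 0 := fun k ↦
    (Finset.sum_eq_zero_iff_of_nonpos (fun k _ ↦
      mul_nonpos_of_nonneg_of_nonpos (by positivity) (hn k))).mp h1 k (Finset.mem_univ k)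
  have h3 : ∀ k, ∃ m : ℤ, m ≤ 0 ∧ (f k : K) * P.coroot' (k : ι) x = m := by
    intro k
    rcases mul_eq_zero.mp (h2 k) with h | h
    · refine ⟨0, le_rfl, ?_⟩
      rw [Nat.cast_eq_zero.mp h]; simp
    · obtain ⟨m, hm, hxm⟩ := hx k (by rw [hjn, h]; simp)
      refine ⟨f k * m, mul_nonpos_of_nonneg_of_nonpos (by positivity) hm, ?_⟩
      rw [hxm]; push_cast; rfl
  choose m hm hm' using h3
  refine ⟨∑ k, m k, Finset.sum_nonpos fun k _ ↦ hm k, ?_⟩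
  rw [hf]; push_cast
  exact Finset.sum_congr rfl fun k _ ↦ hm' k

theorem isAntidominant_zero (b : P.Base) : IsAntidominant b (0 : M) :=
  fun _ ↦ ⟨0, le_rfl, by simp⟩

theorem IsPosIdx.coroot'_nonpos {b : P.Base} {β : ι} (hβ : IsPosIdx b β) {j : M}
    (hj : IsAntidominant b j) : ∃ n : ℤ, n ≤ 0 ∧ P.coroot' β j = n :=
  hβ.coroot'_nonpos_of_eq_zero (isAntidominant_zero b) (by simp) fun k _ ↦ hj k

theorem IsPosIdx.coroot'_nonneg_of_neg {b : P.Base} {β : ι} (hβ : ¬ IsPosIdx b β) {j : M}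
    (hj : IsAntidominant b j) : ∃ n : ℤ, 0 ≤ n ∧ P.coroot' β j = n := by
  rw [← isPosIdx_neg] at hβ
  obtain ⟨n, hn, h⟩ := hβ.coroot'_nonpos hj
  rw [coroot'_reflectionPerm_self] at h
  exact ⟨-n, by omega, by rw [Int.cast_neg, ← h, neg_neg]⟩

/-! ### The exchange condition and the length function -/

theorem weyl_ext {w w' : P.weylGroup} (h : ∀ x : M, w • x = w' • x) : w = w' := by
  apply Subtype.ext
  apply RootPairing.Equiv.weightHom_injective
  ext x
  exact h x

theorem mul_simple_eq (b : P.Base) {w : P.weylGroup} {k l : b.support}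
    (h : rootAct w (k : ι) = l) : w * simpleReflection b k = simpleReflection b l * w := by
  refine weyl_ext fun x ↦ ?_
  rw [mul_smul, mul_smul, simpleReflection_smul, simpleReflection_smul, ← h, ← coroot'_inv_smul b,
    inv_smul_smul, ← smul_root, smul_sub, sub_right_inj]
  exact (map_smul (RootPairing.Equiv.weightEquiv P P (w : P.Aut)) _ _)

theorem length_le (b : P.Base) (l : List b.support) :
    length b (l.map (simpleReflection b)).prod ≤ l.length :=
  Nat.sInf_le ⟨l, rfl, rfl⟩

theorem length_one (b : P.Base) : length b (1 : P.weylGroup) = 0 :=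
  Nat.le_zero.mp (length_le b [])

theorem eq_one_of_length_eq_zero {b : P.Base} {w : P.weylGroup} (h : length b w = 0) : w = 1 := by
  obtain ⟨l, rfl, hl⟩ := exists_reduced_word b w
  rw [h, List.length_eq_zero_iff] at hl
  simp [hl]

theorem length_mul_le (b : P.Base) (w w' : P.weylGroup) :
    length b (w * w') ≤ length b w + length b w' := by
  obtain ⟨l, hl, hl'⟩ := exists_reduced_word b w
  obtain ⟨m, hm, hm'⟩ := exists_reduced_word b w'
  rw [← hl', ← hm', ← List.length_append]
  convert length_le b (l ++ m)
  simp [hl, hm]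

theorem length_simple_le (b : P.Base) (k : b.support) : length b (simpleReflection b k) ≤ 1 := by
  simpa using length_le b [k]

theorem length_inv_le (b : P.Base) (w : P.weylGroup) : length b w⁻¹ ≤ length b w := by
  obtain ⟨l, hl, hl'⟩ := exists_reduced_word b w
  rw [← hl', ← List.length_reverse]
  convert length_le b l.reverse
  rw [← hl, List.prod_inv_reverse]
  simp [Function.comp_def, simpleReflection_inv]

theorem length_inv (b : P.Base) (w : P.weylGroup) : length b w⁻¹ = length b w :=
  le_antisymm (length_inv_le b w) (by simpa using length_inv_le b w⁻¹)

theorem exchange (b : P.Base) (l : List b.support) (k : b.support)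
    (h : ¬ IsPosIdx b (rootAct (l.map (simpleReflection b)).prod (k : ι))) :
    ∃ l' : List b.support, l'.length + 1 = l.length ∧
      (l'.map (simpleReflection b)).prod =
        (l.map (simpleReflection b)).prod * simpleReflection b k := by
  induction l with
  | nil => exact absurd (isPosIdx_simple b k) (by simpa [rootAct_one] using h)
  | cons a t ih =>
    by_cases ht : IsPosIdx b (rootAct (t.map (simpleReflection b)).prod (k : ι))
    · rw [List.map_cons, List.prod_cons, rootAct_mul] at h
      have h1 : rootAct (t.map (simpleReflection b)).prod (k : ι) = a := by
        by_contra hne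
        exact h (ht.rootAct_simple hne)
      refine ⟨t, by simp, ?_⟩
      rw [List.map_cons, List.prod_cons, mul_assoc, mul_simple_eq b h1, ← mul_assoc,
        simpleReflection_mul_self, one_mul]
    · obtain ⟨l', h1, h2⟩ := ih ht
      exact ⟨a :: l', by simp [h1], by simp [h2, mul_assoc]⟩

theorem length_mul_simple_of_neg {b : P.Base} {w : P.weylGroup} {k : b.support}
    (h : ¬ IsPosIdx b (rootAct w (k : ι))) :
    length b (w * simpleReflection b k) + 1 = length b w := by
  obtain ⟨l, rfl, hl⟩ := exists_reduced_word b w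
  obtain ⟨l', h1, h2⟩ := exchange b l k h
  have h3 := length_le b l'
  rw [h2] at h3
  have h4 := length_mul_le b ((l.map (simpleReflection b)).prod * simpleReflection b k)
    (simpleReflection b k)
  rw [mul_assoc, simpleReflection_mul_self, mul_one] at h4
  have h5 := length_simple_le b k
  omega

theorem isPosIdx_rootAct_mul_simple (b : P.Base) (w : P.weylGroup) (k : b.support) :
    IsPosIdx b (rootAct (w * simpleReflection b k) (k : ι)) ↔ ¬ IsPosIdx b (rootAct w (k : ι)) := by
  rw [rootAct_mul, rootAct_simpleReflection, rootAct_reflectionPerm_self, isPosIdx_neg]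

theorem length_mul_simple_of_pos {b : P.Base} {w : P.weylGroup} {k : b.support}
    (h : IsPosIdx b (rootAct w (k : ι))) :
    length b (w * simpleReflection b k) = length b w + 1 := by
  have := length_mul_simple_of_neg (b := b) (w := w * simpleReflection b k) (k := k)
    (by rwa [isPosIdx_rootAct_mul_simple, not_not])
  rw [mul_assoc, simpleReflection_mul_self, mul_one] at this
  exact this.symm

theorem exists_neg_of_ne_one {b : P.Base} {w : P.weylGroup} (h : w ≠ 1) :
    ∃ k : b.support, ¬ IsPosIdx b (rootAct w (k : ι)) := by
  obtain ⟨l, hl, hl'⟩ := exists_reduced_word b w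
  rcases l.eq_nil_or_concat with rfl | ⟨t, k, rfl⟩
  · exact absurd hl.symm (by simpa using h)
  · refine ⟨k, fun hpos ↦ ?_⟩
    have h1 := length_mul_simple_of_pos hpos
    have h2 : w * simpleReflection b k = (t.map (simpleReflection b)).prod := by
      rw [← hl]
      simp [mul_assoc, simpleReflection_mul_self]
    have h3 := length_le b t
    rw [← h2] at h3
    simp at hl'
    omega

/-- The set of inversions of `w`. -/
def inversions (b : P.Base) (w : P.weylGroup) : Set ι :=
  {β | IsPosIdx b β ∧ ¬ IsPosIdx b (rootAct w β)}

theorem rootAct_injective (w : P.weylGroup) : Function.Injective (rootAct w : ι → ι) :=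
  fun β γ h ↦ by rw [← rootAct_inv_rootAct w β, h, rootAct_inv_rootAct]

theorem rootAct_simple_rootAct_simple (b : P.Base) (k : b.support) (β : ι) :
    rootAct (simpleReflection b k) (rootAct (simpleReflection b k) β) = β := by
  rw [← rootAct_mul, simpleReflection_mul_self, rootAct_one]

theorem inversions_mul_simple {b : P.Base} {w : P.weylGroup} {k : b.support}
    (h : IsPosIdx b (rootAct w (k : ι))) :
    inversions b (w * simpleReflection b k) =
      insert (k : ι) (rootAct (simpleReflection b k) '' inversions b w) := by
  ext β
  simp only [inversions, Set.mem_ofPred_eq, Set.mem_insert_iff, Set.mem_image]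
  constructor
  · rintro ⟨h1, h2⟩
    by_cases hk : β = k
    · exact Or.inl hk
    · refine Or.inr ⟨_, ⟨h1.rootAct_simple hk, ?_⟩, rootAct_simple_rootAct_simple b k β⟩
      rwa [← rootAct_mul]
  · rintro (rfl | ⟨γ, ⟨h1, h2⟩, rfl⟩)
    · exact ⟨isPosIdx_simple b k, by rwa [isPosIdx_rootAct_mul_simple, not_not]⟩
    · refine ⟨h1.rootAct_simple fun hk ↦ h2 (hk ▸ h), ?_⟩
      rwa [rootAct_mul, rootAct_simple_rootAct_simple]

theorem ncard_inversions (b : P.Base) (w : P.weylGroup) :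
    (inversions b w).ncard = length b w := by
  induction hn : length b w generalizing w with
  | zero =>
    rw [eq_one_of_length_eq_zero hn]
    simp [inversions, rootAct_one]
  | succ n ih =>
    obtain ⟨k, hk⟩ := exists_neg_of_ne_one (b := b) (w := w) (by
      rintro rfl
      rw [length_one] at hn
      omega)
    have h1 := length_mul_simple_of_neg hk
    have h2 := ih (w * simpleReflection b k) (by omega)
    have h3 : IsPosIdx b (rootAct (w * simpleReflection b k) (k : ι)) := by
      rwa [isPosIdx_rootAct_mul_simple]
    have h4 := inversions_mul_simple h3
    rw [mul_assoc, simpleReflection_mul_self, mul_one] at h4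
    rw [h4, Set.ncard_insert_of_notMem, Set.ncard_image_of_injective _ (rootAct_injective _), h2]
    rintro ⟨γ, ⟨h5, -⟩, h6⟩
    have : γ = rootAct (simpleReflection b k) (k : ι) := by
      rw [← h6, rootAct_simple_rootAct_simple]
    exact not_isPosIdx_rootAct_simple b k (this ▸ h5)

/-! ### Stabilizers of antidominant weights -/

theorem simple_smul_eq_of_coroot'_eq_zero {b : P.Base} {k : b.support} {x : M}
    (h : P.coroot' (k : ι) x = 0) : simpleReflection b k • x = x := by
  rw [simpleReflection_smul, h, zero_smul, sub_zero]

/-- An element of the stabilizer of an antidominant weight which is not trivial has a descent at a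
simple reflection in the stabilizer. -/
theorem exists_descent_of_smul_eq {b : P.Base} {j : M} (hj : IsAntidominant b j)
    {u : P.weylGroup} (hu : u • j = j) (h1 : u ≠ 1) :
    ∃ k : b.support, ¬ IsPosIdx b (rootAct u (k : ι)) ∧ P.coroot' (k : ι) j = 0 ∧
      P.coroot' (rootAct u (k : ι)) j = 0 := by
  obtain ⟨k, hk⟩ := exists_neg_of_ne_one (b := b) h1
  have hu' : u⁻¹ • j = j := by rw [inv_smul_eq_iff, hu]
  have h2 := coroot'_inv_smul b u k j
  rw [hu'] at h2
  obtain ⟨n, hn, h3⟩ := hj k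
  obtain ⟨m, hm, h4⟩ := IsPosIdx.coroot'_nonneg_of_neg hk hj
  have h5 : n = m := by
    have : (n : K) = m := by rw [← h3, h2, h4]
    exact_mod_cast this
  have h6 : n = 0 := by omega
  have h7 : P.coroot' (k : ι) j = 0 := by rw [h3, h6]; simp
  exact ⟨k, hk, h7, by rw [← h2, h7]⟩

/-- The stabilizer of an antidominant weight is generated by simple reflections. -/
theorem mem_parabolic_of_smul_eq {b : P.Base} {j : M} (hj : IsAntidominant b j)
    {u : P.weylGroup} (hu : u • j = j) :
    u ∈ parabolic b {k | P.coroot' (k : ι) j = 0} := by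
  induction hn : length b u using Nat.strong_induction_on generalizing u with
  | _ n ih =>
    by_cases h1 : u = 1
    · rw [h1]; exact one_mem _
    obtain ⟨k, hk, hk0, -⟩ := exists_descent_of_smul_eq hj hu h1
    have hlen := length_mul_simple_of_neg hk
    have h2 := ih _ (by omega) (u := u * simpleReflection b k)
      (by rw [mul_smul, simple_smul_eq_of_coroot'_eq_zero hk0, hu]) rfl
    have h3 : simpleReflection b k ∈ parabolic b {k | P.coroot' (k : ι) j = 0} :=
      Subgroup.subset_closure ⟨k, hk0, rfl⟩
    have := mul_mem h2 h3
    rwa [mul_assoc, simpleReflection_mul_self, mul_one] at this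

/-- In an orbit of the stabilizer of `j`, there is at most one weight which is antidominant with
respect to that stabilizer. -/
theorem eq_of_smul_eq_of_antidominant {b : P.Base} {j : M} (hj : IsAntidominant b j)
    {u : P.weylGroup} (hu : u • j = j) {x y : M} (hxy : u • y = x)
    (hx : ∀ k : b.support, P.coroot' (k : ι) j = 0 → ∃ n : ℤ, n ≤ 0 ∧ P.coroot' (k : ι) x = n)
    (hy : ∀ k : b.support, P.coroot' (k : ι) j = 0 → ∃ n : ℤ, n ≤ 0 ∧ P.coroot' (k : ι) y = n) :
    y = x := by
  induction hn : length b u using Nat.strong_induction_on generalizing u with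
  | _ n ih =>
    by_cases h1 : u = 1
    · rw [← hxy, h1, one_smul]
    obtain ⟨k, hk, hk0, hk1⟩ := exists_descent_of_smul_eq hj hu h1
    have hlen := length_mul_simple_of_neg hk
    obtain ⟨p, hp, hp'⟩ := hy k hk0
    have h2 : P.coroot' (k : ι) y = P.coroot' (rootAct u (k : ι)) x := by
      rw [← coroot'_inv_smul b, ← hxy, inv_smul_smul]
    rw [← isPosIdx_neg] at hk
    obtain ⟨q, hq, hq'⟩ := hk.coroot'_nonpos_of_eq_zero hj
      (by rw [coroot'_reflectionPerm_self, hk1, neg_zero]) hx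
    rw [coroot'_reflectionPerm_self, ← h2, hp'] at hq'
    have h3 : -p = q := by exact_mod_cast hq'
    have h4 : P.coroot' (k : ι) y = 0 := by rw [hp', show p = 0 by omega]; simp
    refine ih _ (by omega) (u := u * simpleReflection b k) ?_ ?_ rfl
    · rw [mul_smul, simple_smul_eq_of_coroot'_eq_zero hk0, hu]
    · rw [mul_smul, simple_smul_eq_of_coroot'_eq_zero h4, hxy]

end RootCombinatorics

section Weights

set_option linter.unusedSectionVars false

variable {ι K M N : Type*} [Field K] [AddCommGroup M] [Module K M]
  [AddCommGroup N] [Module K N] {P : RootPairing ι K M N}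
  [CharZero K] [Finite ι] [P.IsCrystallographic] [P.IsReduced]

/-! ### Pairings of weights with coroots -/

/-- The integer `⟨i, β^∨⟩`. -/
noncomputable def pairZ (X : WeightSet P) (i : X.carrier) (β : ι) : ℤ :=
  (X.integral i.2 β).choose

variable (b : P.Base) (X : WeightSet P)

theorem coroot'_eq_pairZ (i : X.carrier) (β : ι) : P.coroot' β i = (pairZ X i β : K) :=
  (X.integral i.2 β).choose_spec

variable {X} in
theorem pairZ_eq {i : X.carrier} {β : ι} {n : ℤ} (h : P.coroot' β i = n) : pairZ X i β = n := by
  rw [coroot'_eq_pairZ] at h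
  exact_mod_cast h

theorem pairZ_act (b : P.Base) (X : WeightSet P) (i : X.carrier) (w : P.weylGroup) (β : ι) :
    pairZ X (X.act i w) β = pairZ X i (rootAct w β) := by
  apply pairZ_eq
  rw [← coroot'_eq_pairZ, ← coroot'_inv_smul b]
  rfl

theorem pairZ_reflectionPerm_self (i : X.carrier) (β : ι) :
    pairZ X i (P.reflectionPerm β β) = -pairZ X i β := by
  apply pairZ_eq
  rw [coroot'_reflectionPerm_self, coroot'_eq_pairZ, Int.cast_neg]

theorem pairZ_act_simple_self (i : X.carrier) (k : b.support) :
    pairZ X (X.act i (simpleReflection b k)) k = -pairZ X i k :=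
  pairZ_eq (coroot_act_self b X k i (coroot'_eq_pairZ X i k))

theorem act_simple_eq_iff (i : X.carrier) (k : b.support) :
    X.act i (simpleReflection b k) = i ↔ pairZ X i k = 0 := by
  rw [← (domLE_smul_iff k (coroot'_eq_pairZ X i k)).1, Subtype.ext_iff, X.coe_act_simple]

theorem domLT_act_simple_iff (i : X.carrier) (k : b.support) :
    DomLT b (i : M) (X.act i (simpleReflection b k)) ↔ pairZ X i k < 0 := by
  rw [← (domLE_smul_iff k (coroot'_eq_pairZ X i k)).2, X.coe_act_simple]

theorem domLE_act_simple_iff (i : X.carrier) (k : b.support) :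
    DomLE b (i : M) (X.act i (simpleReflection b k)) ↔ pairZ X i k ≤ 0 := by
  rw [le_iff_lt_or_eq, ← domLT_act_simple_iff, ← act_simple_eq_iff, DomLT]
  constructor
  · intro h
    by_cases h1 : X.act i (simpleReflection b k) = i
    · exact Or.inr h1
    · exact Or.inl ⟨h, fun h2 ↦ h1 (Subtype.ext h2.symm)⟩
  · rintro (h | h)
    · exact h.1
    · rw [h, DomLE, sub_self]
      exact zero_mem _

variable {X} in
theorem isAntidominant_iff {i : X.carrier} :
    IsAntidominant b (i : M) ↔ ∀ k : b.support, pairZ X i k ≤ 0 := by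
  refine forall_congr' fun k ↦ ⟨?_, fun h ↦ ⟨_, h, coroot'_eq_pairZ X i k⟩⟩
  rintro ⟨n, hn, h⟩
  rwa [pairZ_eq h]

theorem pairZ_nonpos {β : ι} (hβ : IsPosIdx b β) {j : X.carrier} (hj : IsAntidominant b (j : M)) :
    pairZ X j β ≤ 0 := by
  obtain ⟨n, hn, h⟩ := hβ.coroot'_nonpos hj
  rwa [pairZ_eq h]

theorem pairZ_nonneg {β : ι} (hβ : ¬ IsPosIdx b β) {j : X.carrier}
    (hj : IsAntidominant b (j : M)) : 0 ≤ pairZ X j β := by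
  obtain ⟨n, hn, h⟩ := IsPosIdx.coroot'_nonneg_of_neg hβ hj
  rwa [pairZ_eq h]

/-! ### The height of a weight in its orbit -/

/-- The positive coroots on which the weight is positive. -/
def posPairs (i : X.carrier) : Set ι := {β | IsPosIdx b β ∧ 0 < pairZ X i β}

/-- The height of a weight above the antidominant weight of its orbit. -/
noncomputable def weightHeight (i : X.carrier) : ℕ := (posPairs b X i).ncard

theorem weightHeight_act_of_neg {i : X.carrier} {k : b.support} (h : pairZ X i k < 0) :
    weightHeight b X (X.act i (simpleReflection b k)) = weightHeight b X i + 1 := by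
  have key : posPairs b X (X.act i (simpleReflection b k)) =
      insert (k : ι) (rootAct (simpleReflection b k) '' posPairs b X i) := by
    ext β
    simp only [posPairs, Set.mem_ofPred_eq, Set.mem_insert_iff, Set.mem_image]
    constructor
    · rintro ⟨h1, h2⟩
      by_cases hk : β = k
      · exact Or.inl hk
      · refine Or.inr ⟨_, ⟨h1.rootAct_simple hk, ?_⟩, rootAct_simple_rootAct_simple b k β⟩
        rwa [pairZ_act b X] at h2
    · rintro (rfl | ⟨γ, ⟨h1, h2⟩, rfl⟩)
      · refine ⟨isPosIdx_simple b k, ?_⟩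
        rw [pairZ_act_simple_self]
        omega
      · refine ⟨h1.rootAct_simple ?_, ?_⟩
        · rintro rfl
          omega
        · rwa [pairZ_act b X, rootAct_simple_rootAct_simple]
  rw [weightHeight, key, Set.ncard_insert_of_notMem,
    Set.ncard_image_of_injective _ (rootAct_injective _), weightHeight]
  rintro ⟨γ, ⟨h1, -⟩, h2⟩
  have : γ = rootAct (simpleReflection b k) (k : ι) := by
    rw [← h2, rootAct_simple_rootAct_simple]
  exact not_isPosIdx_rootAct_simple b k (this ▸ h1)

theorem weightHeight_act_of_pos {i : X.carrier} {k : b.support} (h : 0 < pairZ X i k) :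
    weightHeight b X (X.act i (simpleReflection b k)) + 1 = weightHeight b X i := by
  have := weightHeight_act_of_neg b X (i := X.act i (simpleReflection b k)) (k := k)
    (by rw [pairZ_act_simple_self]; omega)
  rw [act_simple_simple] at this
  exact this.symm

theorem weightHeight_act_le (i : X.carrier) (k : b.support) :
    weightHeight b X (X.act i (simpleReflection b k)) ≤ weightHeight b X i + 1 := by
  rcases lt_trichotomy (pairZ X i k) 0 with h | h | h
  · exact (weightHeight_act_of_neg b X h).le
  · rw [(act_simple_eq_iff b X i k).mpr h]
    exact Nat.le_succ _
  · have := weightHeight_act_of_pos b X h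
    omega

theorem weightHeight_eq_zero {j : X.carrier} (hj : IsAntidominant b (j : M)) :
    weightHeight b X j = 0 := by
  rw [weightHeight, Set.ncard_eq_zero, Set.eq_empty_iff_forall_notMem]
  rintro β ⟨h1, h2⟩
  have := pairZ_nonpos b X h1 hj
  omega

/-! ### Antidominant representatives -/

theorem act_inv_of_act {i i' : X.carrier} {w : P.weylGroup} (h : X.act i w = i') :
    X.act i' w⁻¹ = i := by
  rw [← h, ← X.act_mul, mul_inv_cancel, X.act_one]

theorem smul_eq_of_act {i i' : X.carrier} {w : P.weylGroup} (h : X.act i w = i') :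
    w • (i' : M) = i := by
  rw [← h]
  exact smul_inv_smul w (i : M)

theorem act_of_smul_eq {i i' : X.carrier} {w : P.weylGroup} (h : w • (i' : M) = i) :
    X.act i w = i' := by
  apply Subtype.ext
  exact inv_smul_eq_iff.mpr h.symm

/-- Relative uniqueness of antidominant representatives. -/
theorem eq_of_act_eq_of_antidominant {j : X.carrier} (hj : IsAntidominant b (j : M))
    {u : P.weylGroup} (hu : X.act j u = j) {x y : X.carrier} (hxy : X.act x u = y)
    (hx : ∀ k : b.support, pairZ X j k = 0 → pairZ X x k ≤ 0)
    (hy : ∀ k : b.support, pairZ X j k = 0 → pairZ X y k ≤ 0) : y = x := by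
  have h0 : ∀ k : b.support, P.coroot' (k : ι) j = 0 → pairZ X j k = 0 := fun k hk ↦
    pairZ_eq (by rw [hk, Int.cast_zero])
  exact Subtype.ext (eq_of_smul_eq_of_antidominant hj (smul_eq_of_act X hu) (smul_eq_of_act X hxy)
    (fun k hk ↦ ⟨_, hx k (h0 k hk), coroot'_eq_pairZ X x k⟩)
    (fun k hk ↦ ⟨_, hy k (h0 k hk), coroot'_eq_pairZ X y k⟩))

theorem antidominant_unique {i j : X.carrier} (hi : IsAntidominant b (i : M))
    (hj : IsAntidominant b (j : M)) {w : P.weylGroup} (h : X.act i w = j) : j = i :=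
  Subtype.ext (eq_of_smul_eq_of_antidominant (isAntidominant_zero b) (smul_zero w)
    (smul_eq_of_act X h) (fun k _ ↦ hi k) (fun k _ ↦ hj k))

/-- The linkage class of a weight. -/
def classOf (i : X.carrier) : LinkageClass X :=
  ⟨MulAction.orbit P.weylGroup (i : M), i, i.2, rfl⟩

theorem classOf_act (i : X.carrier) (w : P.weylGroup) : classOf X (X.act i w) = classOf X i :=
  Subtype.ext (MulAction.orbit_smul w⁻¹ (i : M))

theorem antidomRep_antidominant (γ : LinkageClass X) :
    IsAntidominant b (antidomRep b X γ : M) := (exists_antidominant b X γ).choose_spec.2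

theorem classOf_antidomRep (γ : LinkageClass X) : classOf X (antidomRep b X γ) = γ := by
  have h := (exists_antidominant b X γ).choose_spec.1
  obtain ⟨S, x, hx, rfl⟩ := γ
  exact Subtype.ext (MulAction.orbit_eq_iff.mpr h)

theorem exists_act_antidomRep (i : X.carrier) :
    ∃ w, X.act (antidomRep b X (classOf X i)) w = i := by
  obtain ⟨w, hw⟩ := (exists_antidominant b X (classOf X i)).choose_spec.1
  exact ⟨w, act_of_smul_eq X hw⟩

theorem antidomRep_classOf {j : X.carrier} (hj : IsAntidominant b (j : M)) :
    antidomRep b X (classOf X j) = j := by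
  obtain ⟨w, hw⟩ := exists_act_antidomRep b X j
  exact (antidominant_unique b X (antidomRep_antidominant b X _) hj hw).symm

theorem weightHeight_act_prod_le {j : X.carrier} (hj : IsAntidominant b (j : M))
    (l : List b.support) :
    weightHeight b X (X.act j (l.map (simpleReflection b)).prod) ≤ l.length := by
  induction l using List.reverseRecOn with
  | nil => simp [X.act_one, weightHeight_eq_zero b X hj]
  | append_singleton t k ih =>
    rw [List.map_append, List.prod_append, List.map_singleton, List.prod_singleton, X.act_mul,
      List.length_append, List.length_singleton]
    exact (weightHeight_act_le b X _ k).trans (by omega)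

theorem weightHeight_act_le_length {j : X.carrier} (hj : IsAntidominant b (j : M))
    (w : P.weylGroup) : weightHeight b X (X.act j w) ≤ length b w := by
  obtain ⟨l, rfl, hl⟩ := exists_reduced_word b w
  rw [← hl]
  exact weightHeight_act_prod_le b X hj l

/-- The weight `j w` is reached from the antidominant weight `j` in `weightHeight (j w)` steps. -/
theorem exists_length_eq_weightHeight {j : X.carrier} (hj : IsAntidominant b (j : M))
    (w : P.weylGroup) :
    ∃ w', X.act j w' = X.act j w ∧ length b w' = weightHeight b X (X.act j w) := by
  induction hn : weightHeight b X (X.act j w) using Nat.strong_induction_on generalizing w with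
  | _ n ih =>
  by_cases ha : IsAntidominant b (X.act j w : M)
  · refine ⟨1, ?_, ?_⟩
    · rw [X.act_one, antidominant_unique b X hj ha rfl]
    · rw [length_one, ← hn, weightHeight_eq_zero b X ha]
  · rw [isAntidominant_iff] at ha
    push Not at ha
    obtain ⟨k, hk⟩ := ha
    have h1 := weightHeight_act_of_pos b X hk
    obtain ⟨w', h2, h3⟩ := ih _ (by rw [X.act_mul]; omega) (w * simpleReflection b k) rfl
    rw [X.act_mul] at h2 h3
    have h4 : X.act j (w' * simpleReflection b k) = X.act j w := by
      rw [X.act_mul, h2, act_simple_simple]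
    refine ⟨w' * simpleReflection b k, h4, le_antisymm ?_ ?_⟩
    · have := length_mul_le b w' (simpleReflection b k)
      have := length_simple_le b k
      omega
    · rw [← hn, ← h4]
      exact weightHeight_act_le_length b X hj _

/-! ### Minimal coset representatives -/

theorem posPairs_act_subset {j : X.carrier} (hj : IsAntidominant b (j : M)) (w : P.weylGroup) :
    posPairs b X (X.act j w) ⊆ inversions b w := by
  rintro β ⟨h1, h2⟩
  refine ⟨h1, fun h3 ↦ ?_⟩
  rw [pairZ_act b X] at h2
  have := pairZ_nonpos b X h3 hj
  omega

theorem pairZ_pos_of_mem_inversions {j : X.carrier} (hj : IsAntidominant b (j : M))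
    {w : P.weylGroup} (hw : weightHeight b X (X.act j w) = length b w) {β : ι}
    (hβ : β ∈ inversions b w) : 0 < pairZ X j (rootAct w β) := by
  have : posPairs b X (X.act j w) = inversions b w :=
    Set.eq_of_subset_of_ncard_le (posPairs_act_subset b X hj w)
      (by rw [ncard_inversions, ← hw, weightHeight])
  rw [← this] at hβ
  rw [← pairZ_act b X]
  exact hβ.2

theorem length_mul_of_stab {j : X.carrier} (hj : IsAntidominant b (j : M))
    {u w : P.weylGroup} (hu : X.act j u = j)
    (hw : weightHeight b X (X.act j w) = length b w) :
    length b (u * w) = length b u + length b w := by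
  have hpu : ∀ β, pairZ X j (rootAct u β) = pairZ X j β := fun β ↦ by
    rw [← pairZ_act b X, hu]
  have pos_of_inv : ∀ {δ}, δ ∈ inversions b u → IsPosIdx b (rootAct w⁻¹ δ) := by
    rintro δ ⟨h1, h2⟩
    by_contra h3
    have h4 := pairZ_nonneg b X h2 hj
    have h5 := pairZ_nonpos b X h1 hj
    rw [hpu] at h4
    rw [← isPosIdx_neg] at h3
    have h6 := pairZ_pos_of_mem_inversions b X hj hw (β := P.reflectionPerm (rootAct w⁻¹ δ)
      (rootAct w⁻¹ δ)) ⟨h3, by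
        rw [rootAct_reflectionPerm_self, isPosIdx_neg, rootAct_rootAct_inv, not_not]
        exact h1⟩
    rw [rootAct_reflectionPerm_self, rootAct_rootAct_inv, pairZ_reflectionPerm_self] at h6
    omega
  have key : inversions b (u * w) = inversions b w ∪ rootAct w⁻¹ '' inversions b u := by
    ext β
    constructor
    · rintro ⟨h1, h2⟩
      rw [rootAct_mul] at h2
      by_cases h3 : IsPosIdx b (rootAct w β)
      · exact Or.inr ⟨_, ⟨h3, h2⟩, rootAct_inv_rootAct w β⟩
      · exact Or.inl ⟨h1, h3⟩
    · rintro (h | ⟨δ, h, rfl⟩)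
      · refine ⟨h.1, fun h1 ↦ ?_⟩
        have h2 := pairZ_pos_of_mem_inversions b X hj hw h
        rw [rootAct_mul] at h1
        have h3 := pairZ_nonpos b X h1 hj
        rw [hpu] at h3
        omega
      · refine ⟨pos_of_inv h, ?_⟩
        rw [rootAct_mul, rootAct_rootAct_inv]
        exact h.2
  rw [← ncard_inversions, key, Set.ncard_union_eq, Set.ncard_image_of_injective _
    (rootAct_injective _), ncard_inversions, ncard_inversions, add_comm]
  rw [Set.disjoint_left]
  rintro β h ⟨δ, h1, rfl⟩
  exact h.2 (by rw [rootAct_rootAct_inv]; exact h1.1)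

theorem stabSet_eq (γ : LinkageClass X) :
    stabSet b X γ = {k : b.support | P.coroot' (k : ι) (antidomRep b X γ : M) = 0} := by
  ext k
  change X.act _ _ = _ ↔ P.coroot' (k : ι) (antidomRep b X γ : M) = 0
  rw [act_simple_eq_iff, coroot'_eq_pairZ, Int.cast_eq_zero]

theorem mem_parabolic_stabSet_iff (γ : LinkageClass X) (u : P.weylGroup) :
    u ∈ parabolic b (stabSet b X γ) ↔ X.act (antidomRep b X γ) u = antidomRep b X γ := by
  constructor
  · intro hu
    induction hu using Subgroup.closure_induction with
    | mem x hx =>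
      obtain ⟨k, hk, rfl⟩ := hx
      exact hk
    | one => exact X.act_one _
    | mul x y _ _ hx hy => rw [X.act_mul, hx, hy]
    | inv x _ hx => exact act_inv_of_act (P := P) X hx
  · intro hu
    rw [stabSet_eq]
    exact mem_parabolic_of_smul_eq (antidomRep_antidominant b X γ) (smul_eq_of_act X hu)

theorem eq_of_act_eq_of_weightHeight {j : X.carrier} (hj : IsAntidominant b (j : M))
    {w w' : P.weylGroup} (h : X.act j w' = X.act j w)
    (hw : weightHeight b X (X.act j w) = length b w)
    (hw' : length b w' ≤ length b w) : w' = w := by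
  have hu : X.act j (w' * w⁻¹) = j := by rw [X.act_mul, h, ← X.act_mul, mul_inv_cancel, X.act_one]
  have h1 := length_mul_of_stab b X hj hu hw
  rw [inv_mul_cancel_right] at h1
  have h2 := eq_one_of_length_eq_zero (b := b) (w := w' * w⁻¹) (by omega)
  exact mul_inv_eq_one.mp h2

theorem mem_minReps_iff (γ : LinkageClass X) (w : P.weylGroup) :
    w ∈ minReps b X γ ↔ weightHeight b X (X.act (antidomRep b X γ) w) = length b w := by
  have hj := antidomRep_antidominant b X γ
  constructor
  · intro h
    obtain ⟨w', h1, h2⟩ := exists_length_eq_weightHeight b X hj w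
    have hu : X.act (antidomRep b X γ) (w' * w⁻¹) = antidomRep b X γ := by
      rw [X.act_mul, h1, ← X.act_mul, mul_inv_cancel, X.act_one]
    have h3 := h _ ((mem_parabolic_stabSet_iff b X γ _).mpr hu)
    rw [inv_mul_cancel_right] at h3
    have h4 := weightHeight_act_le_length b X hj w
    omega
  · intro h u hu
    exact length_mul_of_stab b X hj ((mem_parabolic_stabSet_iff b X γ u).mp hu) h

/-- The condition defining the transversal, in terms of minimal double coset representatives. -/
theorem inv_mem_minReps_iff (γ ν : LinkageClass X) {g : P.weylGroup} (hg : g ∈ minReps b X γ) :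
    g⁻¹ ∈ minReps b X ν ↔
      ∀ k ∈ stabSet b X ν, pairZ X (X.act (antidomRep b X γ) g) k ≤ 0 := by
  have hj := antidomRep_antidominant b X γ
  have hj' := antidomRep_antidominant b X ν
  constructor
  · intro h k hk
    have h1 := h (simpleReflection b k) (Subgroup.subset_closure ⟨k, hk, rfl⟩)
    rw [length_inv, ← length_inv, mul_inv_rev, inv_inv, simpleReflection_inv] at h1
    by_contra! h2
    rw [pairZ_act b X] at h2
    have h3 : ¬ IsPosIdx b (rootAct g (k : ι)) := fun h3 ↦ by
      have := pairZ_nonpos b X h3 hj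
      omega
    have := length_mul_simple_of_neg h3
    omega
  · intro h
    rw [mem_minReps_iff] at hg ⊢
    refine le_antisymm (weightHeight_act_le_length b X hj' _) ?_
    rw [← ncard_inversions]
    refine Set.ncard_le_ncard (fun β hβ ↦ ⟨hβ.1, ?_⟩) (Set.toFinite _)
    rw [pairZ_act b X]
    have h1 := pairZ_nonneg b X hβ.2 hj'
    by_contra! h2
    have h3 : pairZ X (antidomRep b X ν) (rootAct g⁻¹ β) = 0 := by omega
    have hδ := hβ.2
    rw [← isPosIdx_neg] at hδ
    obtain ⟨n, hn, h4⟩ := hδ.coroot'_nonpos_of_eq_zero hj' (x := X.act (antidomRep b X γ) g) (by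
        rw [coroot'_reflectionPerm_self, coroot'_eq_pairZ, h3]
        simp) (fun k hk ↦ ⟨_, h k (by rw [stabSet_eq]; exact hk), coroot'_eq_pairZ X _ _⟩)
    have h5 := pairZ_eq h4
    rw [pairZ_reflectionPerm_self, pairZ_act b X, rootAct_rootAct_inv] at h5
    have h6 := pairZ_nonpos b X hβ.1 hj
    have h7 := pairZ_pos_of_mem_inversions b X hj hg ⟨hδ, by
      rw [rootAct_reflectionPerm_self, isPosIdx_neg, rootAct_rootAct_inv, not_not]
      exact hβ.1⟩
    rw [rootAct_reflectionPerm_self, rootAct_rootAct_inv, pairZ_reflectionPerm_self] at h7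
    omega

/-! ### The transversal -/

variable {b X} in
theorem PairIndex.nonpos (p : PairIndex b X) (k : b.support) (hk : pairZ X p.1.2 k = 0) :
    pairZ X p.1.1 k ≤ 0 :=
  (domLE_act_simple_iff b X _ k).mp (p.2.2 k ((act_simple_eq_iff b X _ k).mpr hk))

theorem existsUnique_pairIndex (i j : X.carrier) :
    ∃! p : PairIndex b X, ∃ w : P.weylGroup, X.act p.1.1 w = i ∧ X.act p.1.2 w = j := by
  obtain ⟨w, hw⟩ := exists_act_antidomRep b X j
  set j₀ := antidomRep b X (classOf X j) with hj₀
  have hj := antidomRep_antidominant b X (classOf X j)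
  rw [← hj₀] at hj
  refine existsUnique_of_exists_of_unique ?_ ?_
  · have hfin : Finite X.carrier := X.finite
    have main : ∀ n, ∀ i : X.carrier, weightHeight b X i = n → ∃ u, X.act j₀ u = j₀ ∧
        ∀ k : b.support, pairZ X j₀ k = 0 → pairZ X (X.act i u) k ≤ 0 := by
      intro n
      induction n with
      | zero =>
        intro i hi
        refine ⟨1, X.act_one _, fun k _ ↦ ?_⟩
        rw [X.act_one]
        by_contra! h
        have := weightHeight_act_of_pos b X h
        omega
      | succ n ih =>
        intro i hi
        by_cases h : ∃ k : b.support, pairZ X j₀ k = 0 ∧ 0 < pairZ X i k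
        · obtain ⟨k, hk, hik⟩ := h
          have := weightHeight_act_of_pos b X hik
          obtain ⟨u, hu, hu'⟩ := ih (X.act i (simpleReflection b k)) (by omega)
          refine ⟨simpleReflection b k * u, ?_, ?_⟩
          · rw [X.act_mul, (act_simple_eq_iff b X j₀ k).mpr hk, hu]
          · rwa [X.act_mul]
        · push Not at h
          exact ⟨1, X.act_one _, by simpa [X.act_one] using h⟩
    obtain ⟨u, hu, hu'⟩ := main _ (X.act i w⁻¹) rfl
    refine ⟨⟨(X.act (X.act i w⁻¹) u, j₀), hj, fun k hk ↦ ?_⟩, u⁻¹ * w, ?_, ?_⟩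
    · exact (domLE_act_simple_iff b X _ k).mpr (hu' k ((act_simple_eq_iff b X _ k).mp hk))
    · simp [← X.act_mul, X.act_one]
    · change X.act j₀ _ = j
      rw [X.act_mul, act_inv_of_act X hu, hw]
  · rintro p q ⟨u, h1, h2⟩ ⟨v, h3, h4⟩
    have h5 : p.1.2 = q.1.2 := by
      refine antidominant_unique b X q.2.1 p.2.1 (w := v * u⁻¹) ?_
      rw [X.act_mul, h4]
      exact act_inv_of_act X h2
    have h6 : p.1.1 = q.1.1 := by
      refine eq_of_act_eq_of_antidominant b X (j := q.1.2) q.2.1 (u := v * u⁻¹) ?_ ?_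
        q.nonpos (fun k hk ↦ p.nonpos k (by rwa [h5]))
      · rw [X.act_mul, h4, ← h2, ← X.act_mul, mul_inv_cancel, X.act_one, h5]
      · rw [X.act_mul, h3]
        exact act_inv_of_act X h1
    exact Subtype.ext (Prod.ext h6 h5)

end Weights

section HeckeModules

set_option linter.unusedSectionVars false

variable {ι K M N : Type*} [Field K] [AddCommGroup M] [Module K M]
  [AddCommGroup N] [Module K N] {P : RootPairing ι K M N}
  [CharZero K] [Finite ι] [P.IsCrystallographic] [P.IsReduced]

/-! ### Relations in the Hecke algebra -/

theorem qpow_add (m n : ℤ) : qpow (m + n) = qpow m * qpow n := LaurentPolynomial.T_add m n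

theorem qpow_zero : qpow 0 = 1 := LaurentPolynomial.T_zero

theorem Hecke.induction {b : P.Base} {p : Hecke b → Prop}
    (halg : ∀ a : LaurentZ, p (algebraMap LaurentZ (Hecke b) a))
    (hgen : ∀ k, p (heckeGen b k)) (hmul : ∀ x y, p x → p y → p (x * y))
    (hadd : ∀ x y, p x → p y → p (x + y)) (h : Hecke b) : p h := by
  obtain ⟨x, rfl⟩ := RingQuot.mkAlgHom_surjective LaurentZ (HeckeRel b) h
  induction x using FreeAlgebra.induction with
  | grade0 a => rw [AlgHom.commutes]; exact halg a
  | grade1 k => exact hgen k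
  | mul x y hx hy => rw [map_mul]; exact hmul _ _ hx hy
  | add x y hx hy => rw [map_add]; exact hadd _ _ hx hy

/-- The generator `H_k`, in the opposite algebra. -/
noncomputable def opGen (b : P.Base) (k : b.support) : (Hecke b)ᵐᵒᵖ :=
  MulOpposite.op (heckeGen b k)

theorem opGen_mul_self (b : P.Base) (k : b.support) :
    opGen b k * opGen b k = (qpow (-1) - qpow 1) • opGen b k + 1 := by
  have h := RingQuot.mkAlgHom_rel LaurentZ (HeckeRel.quadratic (b := b) k)
  rw [map_mul, map_sub, map_add, map_zero, AlgHom.commutes, AlgHom.commutes] at h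
  change (heckeGen b k - algebraMap LaurentZ (Hecke b) (qpow (-1))) *
    (heckeGen b k + algebraMap LaurentZ (Hecke b) (qpow 1)) = 0 at h
  rw [Algebra.algebraMap_eq_smul_one, Algebra.algebraMap_eq_smul_one, sub_mul, mul_add, mul_add] at h
  simp only [smul_mul_assoc, mul_smul_comm, one_mul, mul_one, smul_smul] at h
  rw [← qpow_add, show (1 : ℤ) + -1 = 0 from rfl, qpow_zero, one_smul] at h
  apply MulOpposite.unop_injective
  rw [MulOpposite.unop_mul, MulOpposite.unop_add, MulOpposite.unop_smul, MulOpposite.unop_one]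
  change heckeGen b k * heckeGen b k = (qpow (-1) - qpow 1) • heckeGen b k + 1
  rw [sub_smul, ← sub_eq_zero, ← h]
  abel

theorem braidWord_succ_right {G : Type*} [Monoid G] (n : ℕ) (s t : G) :
    braidWord (n + 1) s t = braidWord n s t * (if Even n then s else t) := by
  induction n generalizing s t with
  | zero => simp [braidWord]
  | succ n ih =>
    rw [braidWord, ih t s, braidWord, mul_assoc]
    congr 2
    simp only [Nat.even_add_one]
    split_ifs <;> rfl

theorem op_braidWord {G : Type*} [Monoid G] (n : ℕ) (s t : G) :
    MulOpposite.op (braidWord n s t) =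
      if Even n then braidWord n (MulOpposite.op t) (MulOpposite.op s)
      else braidWord n (MulOpposite.op s) (MulOpposite.op t) := by
  induction n generalizing s t with
  | zero => simp [braidWord]
  | succ n ih =>
    rw [braidWord_succ_right, MulOpposite.op_mul, ih]
    simp only [Nat.even_add_one]
    split_ifs <;> rfl

theorem opGen_braid (b : P.Base) {k l : b.support} (hkl : k ≠ l) :
    braidWord (orderOf (simpleReflection b k * simpleReflection b l)) (opGen b k) (opGen b l) =
      braidWord (orderOf (simpleReflection b k * simpleReflection b l)) (opGen b l) (opGen b k) := by
  have h := RingQuot.mkAlgHom_rel LaurentZ (HeckeRel.braid (b := b) k l hkl)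
  rw [map_braidWord, map_braidWord] at h
  have h' := congrArg MulOpposite.op h
  rw [op_braidWord, op_braidWord] at h'
  split_ifs at h' with he
  · exact h'.symm
  · exact h'

/-! ### Walks along a dihedral orbit -/

theorem walk_pos (b : P.Base) {k l : b.support} (hkl : k ≠ l) :
    2 ≤ orderOf (simpleReflection b k * simpleReflection b l) ∧
    (∀ x y : ℤ, 0 < x → 0 < y → ∀ z ∈ walk (orderOf (simpleReflection b k * simpleReflection b l))
      (P.pairingIn ℤ k l) (P.pairingIn ℤ l k) x y, 0 < z) ∧
    (∀ x : ℤ, 0 < x → ∀ z ∈ walk (orderOf (simpleReflection b k * simpleReflection b l) - 1)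
      (P.pairingIn ℤ k l) (P.pairingIn ℤ l k) x 0, 0 < z) := by
  have c1 : P.pairing k l = (P.pairingIn ℤ k l : ℤ) := (P.algebraMap_pairingIn ℤ k l).symm
  have c2 : P.pairing l k = (P.pairingIn ℤ l k : ℤ) := (P.algebraMap_pairingIn ℤ l k).symm
  have hs := orderOf_swap b k l
  have hc := cartan_cases b hkl
  generalize P.pairingIn ℤ k l = a at *
  generalize P.pairingIn ℤ l k = c at *
  simp only [Set.mem_insert_iff, Set.mem_singleton_iff, Prod.mk.injEq] at hc
  have ho : (orderOf (simpleReflection b k * simpleReflection b l) = 2 ∧ a = 0 ∧ c = 0) ∨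
      (orderOf (simpleReflection b k * simpleReflection b l) = 3 ∧ a = -1 ∧ c = -1) ∨
      (orderOf (simpleReflection b k * simpleReflection b l) = 4 ∧ a = -1 ∧ c = -2) ∨
      (orderOf (simpleReflection b k * simpleReflection b l) = 6 ∧ a = -1 ∧ c = -3) ∨
      (orderOf (simpleReflection b k * simpleReflection b l) = 4 ∧ a = -2 ∧ c = -1) ∨
      (orderOf (simpleReflection b k * simpleReflection b l) = 6 ∧ a = -3 ∧ c = -1) := by
    have two : a = 0 → c = 0 → orderOf (simpleReflection b k * simpleReflection b l) = 2 := by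
      rintro rfl rfl
      exact orderOf_eq_two b hkl (by simpa using c1) (by simpa using c2)
    have three : a = -1 → c = -1 →
        orderOf (simpleReflection b k * simpleReflection b l) = 3 := by
      rintro rfl rfl
      exact orderOf_eq_three b hkl (by simpa using c1) (by simpa using c2)
    rcases hc with (⟨h1, h2⟩ | ⟨h1, h2⟩ | ⟨h1, h2⟩ | ⟨h1, h2⟩) |
      (⟨h1, h2⟩ | ⟨h1, h2⟩ | ⟨h1, h2⟩ | ⟨h1, h2⟩)
    · exact Or.inl ⟨two h1 h2, h1, h2⟩
    · exact Or.inr (Or.inl ⟨three h1 h2, h1, h2⟩)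
    · subst h1 h2
      simp [orderOf_eq_four b hkl (by simpa using c1) (by simpa using c2)]
    · subst h1 h2
      simp [orderOf_eq_six b hkl (by simpa using c1) (by simpa using c2)]
    · exact Or.inl ⟨two h2 h1, h2, h1⟩
    · exact Or.inr (Or.inl ⟨three h2 h1, h2, h1⟩)
    · subst h1 h2
      rw [← hs]
      simp [orderOf_eq_four b hkl.symm (by simpa using c2) (by simpa using c1)]
    · subst h1 h2
      rw [← hs]
      simp [orderOf_eq_six b hkl.symm (by simpa using c2) (by simpa using c1)]
  rcases ho with ⟨h, rfl, rfl⟩ | ⟨h, rfl, rfl⟩ | ⟨h, rfl, rfl⟩ | ⟨h, rfl, rfl⟩ |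
    ⟨h, rfl, rfl⟩ | ⟨h, rfl, rfl⟩ <;> rw [h] <;> refine ⟨by norm_num, ?_, ?_⟩ <;>
    simp only [walk, List.mem_cons, List.not_mem_nil, or_false, forall_eq_or_imp, forall_eq] <;>
    intros <;> omega

/-! ### Homomorphisms out of `𝕋_f` -/

section Reach

variable {b : P.Base} {X : WeightSet P} {V : Type*} [AddCommGroup V] [Module LaurentZ V]
  [Module (Hecke b)ᵐᵒᵖ V] [IsScalarTower LaurentZ (Hecke b)ᵐᵒᵖ V]

/-- `Reach j v i m` says that the vector `m` is obtained from `v` by applying the generators of the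
Hecke algebra along an ascending path of weights from `j` to `i`. -/
inductive Reach (b : P.Base) (X : WeightSet P) {V : Type*} [AddCommGroup V]
    [Module (Hecke b)ᵐᵒᵖ V] (j : X.carrier) (v : V) : X.carrier → V → Prop
  | base : Reach b X j v j v
  | step {i : X.carrier} {m : V} (k : b.support) : Reach b X j v i m → pairZ X i k < 0 →
      Reach b X j v (X.act i (simpleReflection b k)) (opGen b k • m)

variable {j : X.carrier} {v : V}

theorem Reach.of_pos {i : X.carrier} {m : V} {k : b.support} (hk : 0 < pairZ X i k)
    (h : Reach b X j v (X.act i (simpleReflection b k)) m) : Reach b X j v i (opGen b k • m) := by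
  have := h.step k (by rw [pairZ_act_simple_self]; omega)
  rwa [act_simple_simple] at this

theorem Reach.exists_act {i : X.carrier} {m : V} (h : Reach b X j v i m) :
    ∃ w, X.act j w = i := by
  induction h with
  | base => exact ⟨1, X.act_one j⟩
  | step k _ _ ih =>
    obtain ⟨w, rfl⟩ := ih
    exact ⟨_, X.act_mul j w _⟩

theorem exists_reach (hj : IsAntidominant b (j : M)) (v : V) (i : X.carrier)
    (hi : ∃ w, X.act j w = i) : ∃ m, Reach b X j v i m := by
  induction hn : weightHeight b X i generalizing i with
  | zero =>
    have ha : IsAntidominant b (i : M) := by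
      rw [isAntidominant_iff]
      intro k
      by_contra! hk
      have := weightHeight_act_of_pos b X hk
      omega
    obtain ⟨w, hw⟩ := hi
    rw [antidominant_unique b X hj ha hw]
    exact ⟨v, .base⟩
  | succ n ih =>
    obtain ⟨k, hk⟩ : ∃ k : b.support, 0 < pairZ X i k := by
      by_contra! ha
      have := weightHeight_eq_zero b X ((isAntidominant_iff b).mpr ha)
      omega
    have := weightHeight_act_of_pos b X hk
    obtain ⟨w, rfl⟩ := hi
    obtain ⟨m, hm⟩ := ih (X.act (X.act j w) (simpleReflection b k)) ⟨_, X.act_mul j w _⟩ (by omega)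
    exact ⟨_, hm.of_pos hk⟩

theorem pairZ_act_simple (i : X.carrier) (k l : b.support) :
    pairZ X (X.act i (simpleReflection b k)) l =
      pairZ X i l - pairZ X i k * P.pairingIn ℤ k l :=
  pairZ_eq (coroot_act b X k l i (coroot'_eq_pairZ X i k) (coroot'_eq_pairZ X i l)
    (P.algebraMap_pairingIn ℤ k l).symm)

/-- Going back up a strictly descending dihedral path. -/
theorem Reach.braidWord (n : ℕ) {m : V} : ∀ (k l : b.support) (i : X.carrier),
    (∀ z ∈ walk n (P.pairingIn ℤ k l) (P.pairingIn ℤ l k) (pairZ X i k) (pairZ X i l), 0 < z) →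
    Reach b X j v (X.act i (braidWord n (simpleReflection b k) (simpleReflection b l))) m →
    Reach b X j v i (QSchur.braidWord n (opGen b k) (opGen b l) • m) ∧
      weightHeight b X (X.act i (QSchur.braidWord n (simpleReflection b k)
        (simpleReflection b l))) + n = weightHeight b X i := by
  induction n with
  | zero =>
    intro k l i _ h
    simpa [QSchur.braidWord, X.act_one] using h
  | succ n ih =>
    intro k l i hz h
    have h0 : 0 < pairZ X i k := hz _ (by simp [walk])
    rw [QSchur.braidWord, X.act_mul] at h
    obtain ⟨h1, h2⟩ := ih l k (X.act i (simpleReflection b k)) (fun z hm ↦ hz z (by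
      rw [pairZ_act_simple, pairZ_act_simple_self] at hm
      simp [walk, hm])) h
    have h3 := weightHeight_act_of_pos b X h0
    refine ⟨?_, ?_⟩
    · rw [QSchur.braidWord, mul_smul]
      exact h1.of_pos h0
    · rw [QSchur.braidWord, X.act_mul]
      omega

/-- The value reached at a weight does not depend on the path, and it is an eigenvector for the
simple reflections which fix the weight. -/
theorem Reach.unique_and_fixed (hj : IsAntidominant b (j : M))
    (hv : ∀ k : b.support, pairZ X j k = 0 → opGen b k • v = qpow (-1) • v) (n : ℕ) :
    ∀ i : X.carrier, weightHeight b X i = n →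
      (∀ m m' : V, Reach b X j v i m → Reach b X j v i m' → m = m') ∧
      (∀ (k : b.support) (m : V), pairZ X i k = 0 → Reach b X j v i m →
        opGen b k • m = qpow (-1) • m) := by
  induction n using Nat.strong_induction_on with
  | _ n ih =>
  intro i hi
  have hjk : ∀ k : b.support, pairZ X j k ≤ 0 := (isAntidominant_iff b).mp hj
  have last : ∀ m, Reach b X j v i m → (i = j ∧ m = v) ∨ ∃ (k : b.support) (m₁ : V), 0 < pairZ X i k ∧
      Reach b X j v (X.act i (simpleReflection b k)) m₁ ∧ m = opGen b k • m₁ := by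
    rintro m h
    cases h with
    | base => exact Or.inl ⟨rfl, rfl⟩
    | step k h hk =>
      refine Or.inr ⟨k, _, ?_, ?_, rfl⟩
      · rw [pairZ_act_simple_self]; omega
      · rwa [act_simple_simple]
  have uniq : ∀ m m' : V, Reach b X j v i m → Reach b X j v i m' → m = m' := by
    intro m m' h h'
    rcases last m h with ⟨rfl, rfl⟩ | ⟨k, m₁, hk, h₁, rfl⟩ <;>
      rcases last m' h' with ⟨h2, rfl⟩ | ⟨l, m₂, hl, h₂, rfl⟩
    · rfl
    · exact absurd (hjk l) (not_le.mpr hl)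
    · exact absurd (hjk k) (not_le.mpr (h2 ▸ hk))
    · have hkn := weightHeight_act_of_pos b X hk
      have hln := weightHeight_act_of_pos b X hl
      by_cases hkl : k = l
      · subst hkl
        rw [(ih _ (by omega) _ rfl).1 _ _ h₁ h₂]
      have key : ∀ (k l : b.support) (m₁ : V) (t : ℕ), 0 < pairZ X i k → (∀ z ∈ walk (t + 1)
          (P.pairingIn ℤ k l) (P.pairingIn ℤ l k) (pairZ X i k) (pairZ X i l), 0 < z) →
          Reach b X j v (X.act i (simpleReflection b k)) m₁ → ∀ m₀, Reach b X j v
            (X.act i (QSchur.braidWord (t + 1) (simpleReflection b k) (simpleReflection b l))) m₀ →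
          opGen b k • m₁ = QSchur.braidWord (t + 1) (opGen b k) (opGen b l) • m₀ := by
        intro k l m₁ t hk hz h₁ m₀ h₀
        rw [QSchur.braidWord, X.act_mul] at h₀
        have hkn := weightHeight_act_of_pos b X hk
        have := (Reach.braidWord t l k (X.act i (simpleReflection b k)) (fun z hm ↦ hz z (by
          rw [pairZ_act_simple, pairZ_act_simple_self] at hm
          simp [walk, hm])) h₀).1
        rw [QSchur.braidWord, mul_smul, (ih _ (by omega) _ rfl).1 _ _ h₁ this]
      obtain ⟨h2, hw, -⟩ := walk_pos b hkl
      obtain ⟨-, hw', -⟩ := walk_pos b (Ne.symm hkl)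
      have hpow := pow_orderOf_eq_one (simpleReflection b k * simpleReflection b l)
      have hbr := opGen_braid b hkl
      have hs := orderOf_swap b k l
      rw [hs] at hw'
      have hbs := braidWord_comm (simpleReflection_mul_self b k) (simpleReflection_mul_self b l) hpow
      obtain ⟨t, ht⟩ : ∃ t, orderOf (simpleReflection b k * simpleReflection b l) = t + 1 :=
        ⟨orderOf (simpleReflection b k * simpleReflection b l) - 1, by omega⟩
      rw [ht] at hw hw' hbr hbs
      obtain ⟨w, hw0⟩ := h.exists_act
      obtain ⟨m₀, h₀⟩ := exists_reach hj v (X.act i (QSchur.braidWord (t + 1)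
        (simpleReflection b k) (simpleReflection b l))) ⟨w * _, by rw [X.act_mul, hw0]⟩
      rw [key k l m₁ t hk (hw _ _ hk hl) h₁ m₀ h₀,
        key l k m₂ t hl (hw' _ _ hl hk) h₂ m₀ (by rwa [← hbs]), hbr]
  refine ⟨uniq, fun k m hk h ↦ ?_⟩
  rcases last m h with ⟨rfl, rfl⟩ | ⟨l, m₁, hl, h₁, rfl⟩
  · exact hv k hk
  have hkl : k ≠ l := by
    rintro rfl
    omega
  obtain ⟨h2, -, hw⟩ := walk_pos b (Ne.symm hkl)
  have hpow := pow_orderOf_eq_one (simpleReflection b l * simpleReflection b k)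
  have hbr := opGen_braid b (Ne.symm hkl)
  have hbs := braidWord_comm (simpleReflection_mul_self b l) (simpleReflection_mul_self b k) hpow
  obtain ⟨t, ht⟩ : ∃ t, orderOf (simpleReflection b l * simpleReflection b k) = t + 1 :=
    ⟨orderOf (simpleReflection b l * simpleReflection b k) - 1, by omega⟩
  rw [ht] at hw hbr hbs h2
  rw [Nat.add_sub_cancel] at hw
  obtain ⟨w, hw0⟩ := h.exists_act
  obtain ⟨m₀, h₀⟩ := exists_reach hj v (X.act i (QSchur.braidWord t
    (simpleReflection b l) (simpleReflection b k))) ⟨w * _, by rw [X.act_mul, hw0]⟩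
  obtain ⟨h3, h4⟩ := Reach.braidWord t l k i (by rw [hk]; exact hw _ hl) h₀
  set e : b.support := if Even t then l else k with he
  have hes : (if Even t then simpleReflection b l else simpleReflection b k) =
      simpleReflection b e := by rw [he]; split_ifs <;> rfl
  have heg : (if Even t then opGen b l else opGen b k) = opGen b e := by
    rw [he]; split_ifs <;> rfl
  have hik : X.act i (simpleReflection b k) = i := (act_simple_eq_iff b X i k).mpr hk
  have h5 : pairZ X (X.act i (QSchur.braidWord t
      (simpleReflection b l) (simpleReflection b k))) e = 0 := by
    rw [← act_simple_eq_iff, ← X.act_mul, ← hes, ← braidWord_succ_right, hbs, QSchur.braidWord,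
      X.act_mul, hik]
  have h6 := (ih _ (by omega) _ rfl).2 e m₀ h5 h₀
  rw [uniq _ _ h h3, ← mul_smul]
  change QSchur.braidWord (t + 1) (opGen b k) (opGen b l) • m₀ = _
  rw [← hbr, braidWord_succ_right, heg, mul_smul, h6]
  exact smul_comm _ _ _

theorem stdBasis_eq_opGen_smul (b : P.Base) (X : WeightSet P) {i : X.carrier} {k : b.support}
    (hk : 0 < pairZ X i k) :
    stdBasis X i = opGen b k • stdBasis X (X.act i (simpleReflection b k)) := by
  have h := pairZ_act_simple_self b X i k
  rw [opGen, op_gen_smul, heckeOp_of_nonpos b X k _ (coroot'_eq_pairZ X _ k) (by omega),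
    act_simple_simple, h, List.count_eq_zero_of_not_mem (by simp; omega)]
  simp [qpow_zero]

/-- Two homomorphisms out of `𝕋_f` agree if they agree at the antidominant weights. -/
theorem weightModule_hom_ext {f g : WeightModule X →ₗ[(Hecke b)ᵐᵒᵖ] V}
    (h : ∀ γ, f (stdBasis X (antidomRep b X γ)) = g (stdBasis X (antidomRep b X γ))) : f = g := by
  have main : ∀ n, ∀ i : X.carrier, weightHeight b X i = n →
      f (stdBasis X i) = g (stdBasis X i) := by
    intro n
    induction n using Nat.strong_induction_on with
    | _ n ih =>
    intro i hi
    by_cases ha : IsAntidominant b (i : M)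
    · rw [← antidomRep_classOf b X ha, h]
    · rw [isAntidominant_iff] at ha
      push Not at ha
      obtain ⟨k, hk⟩ := ha
      have := weightHeight_act_of_pos b X hk
      rw [stdBasis_eq_opGen_smul b X hk, map_smul, map_smul, ih _ (by omega) _ rfl]
  have : f.restrictScalars LaurentZ = g.restrictScalars LaurentZ :=
    (stdBasis X).ext fun i ↦ main _ i rfl
  ext x
  exact LinearMap.congr_fun this x

/-- A linear map out of `𝕋_f` which commutes with the generators is `ℋ`-linear. -/
theorem map_op_smul_of_gen {f : WeightModule X →ₗ[LaurentZ] V}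
    (h : ∀ (k : b.support) (i : X.carrier),
      f (heckeOp b X k (stdBasis X i)) = opGen b k • f (stdBasis X i))
    (r : (Hecke b)ᵐᵒᵖ) (x : WeightModule X) : f (r • x) = r • f x := by
  have hk : ∀ (k : b.support) (x : WeightModule X), f (opGen b k • x) = opGen b k • f x := by
    intro k x
    have : f ∘ₗ heckeOp b X k = (Algebra.lsmul LaurentZ LaurentZ V (opGen b k)) ∘ₗ f :=
      (stdBasis X).ext fun i ↦ h k i
    rw [opGen, op_gen_smul]
    exact LinearMap.congr_fun this x
  obtain ⟨r, rfl⟩ := MulOpposite.op_surjective r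
  induction r using Hecke.induction generalizing x with
  | halg a =>
    rw [Algebra.algebraMap_eq_smul_one, MulOpposite.op_smul, MulOpposite.op_one, smul_assoc,
      smul_assoc, one_smul, one_smul, map_smul]
  | hgen k => exact hk k x
  | hmul y z hy hz => rw [MulOpposite.op_mul, mul_smul, mul_smul, hz, hy]
  | hadd y z hy hz => rw [MulOpposite.op_add, add_smul, add_smul, map_add, hy, hz]

/-- The universal property of `𝕋_f`. -/
theorem exists_weightModule_hom (v : LinkageClass X → V)
    (hv : ∀ γ, ∀ k ∈ stabSet b X γ, opGen b k • v γ = qpow (-1) • v γ) :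
    ∃ f : WeightModule X →ₗ[(Hecke b)ᵐᵒᵖ] V,
      ∀ γ, f (stdBasis X (antidomRep b X γ)) = v γ := by
  have hex : ∀ i : X.carrier, ∃ m, Reach b X (antidomRep b X (classOf X i)) (v (classOf X i)) i m :=
    fun i ↦ exists_reach (antidomRep_antidominant b X _) _ i (exists_act_antidomRep b X i)
  choose m hm using hex
  have hJ : ∀ γ (k : b.support), pairZ X (antidomRep b X γ) k = 0 → k ∈ stabSet b X γ :=
    fun γ k hk ↦ (act_simple_eq_iff b X _ k).mpr hk
  have key : ∀ i, (∀ m', Reach b X (antidomRep b X (classOf X i)) (v (classOf X i)) i m' →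
      m i = m') ∧ ∀ k : b.support, pairZ X i k = 0 → opGen b k • m i = qpow (-1) • m i := by
    intro i
    have := Reach.unique_and_fixed (antidomRep_antidominant b X (classOf X i))
      (fun k hk ↦ hv _ k (hJ _ k hk)) _ i rfl
    exact ⟨fun m' hm' ↦ this.1 _ _ (hm i) hm', fun k hk ↦ this.2 k _ hk (hm i)⟩
  have hup : ∀ (i : X.carrier) (k : b.support), pairZ X i k < 0 →
      m (X.act i (simpleReflection b k)) = opGen b k • m i := by
    intro i k hk
    refine (key _).1 _ ?_
    rw [classOf_act]
    exact (hm i).step k hk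
  let f : WeightModule X →ₗ[LaurentZ] V := (stdBasis X).constr LaurentZ m
  have hf : ∀ i, f (stdBasis X i) = m i := fun i ↦ (stdBasis X).constr_basis LaurentZ m i
  refine ⟨⟨f.toAddHom, fun r x ↦ map_op_smul_of_gen ?_ r x⟩, fun γ ↦ ?_⟩
  · intro k i
    have hn := coroot'_eq_pairZ X i k
    rcases lt_trichotomy (pairZ X i k) 0 with h | h | h
    · rw [heckeOp_of_nonpos b X k i hn h.le, map_smul, hf, hf, hup i k h,
        List.count_eq_zero_of_not_mem (by simp; omega)]
      simp [qpow_zero]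
    · rw [heckeOp_of_nonpos b X k i hn h.le, map_smul, (act_simple_eq_iff b X i k).mpr h, hf,
        (key i).2 k h, h]
      simp
    · have h1 := hup (X.act i (simpleReflection b k)) k (by rw [pairZ_act_simple_self]; omega)
      rw [act_simple_simple] at h1
      rw [heckeOp_of_pos b X k i hn h, map_add, map_smul, hf, hf, h1, ← mul_smul, opGen_mul_self,
        add_smul, one_smul, smul_assoc, add_comm]
  · change f _ = v γ
    rw [hf]
    refine (key _).1 _ ?_
    rw [classOf_antidomRep]
    exact .base

end Reach

end HeckeModules

section SchurBasis

set_option linter.unusedSectionVars false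

variable {ι K M N : Type*} [Field K] [AddCommGroup M] [Module K M]
  [AddCommGroup N] [Module K N] {P : RootPairing ι K M N}
  [CharZero K] [Finite ι] [P.IsCrystallographic] [P.IsReduced]

instance (X : WeightSet P) : Finite X.carrier := X.finite

instance (b : P.Base) (X : WeightSet P) : Finite (PairIndex b X) := Subtype.finite

variable (b : P.Base) (X : WeightSet P)

/-! ### Coordinates of `v H_k` -/

theorem heckeOp_of_neg {k : b.support} {i : X.carrier} (h : pairZ X i k < 0) :
    heckeOp b X k (stdBasis X i) = stdBasis X (X.act i (simpleReflection b k)) := by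
  rw [heckeOp_of_nonpos b X k _ (coroot'_eq_pairZ X _ k) h.le,
    List.count_eq_zero_of_not_mem (by simp; omega)]
  simp [qpow_zero]

theorem heckeOp_of_eq_zero {k : b.support} {i : X.carrier} (h : pairZ X i k = 0) :
    heckeOp b X k (stdBasis X i) = qpow (-1) • stdBasis X i := by
  rw [heckeOp_of_nonpos b X k _ (coroot'_eq_pairZ X _ k) h.le,
    (act_simple_eq_iff b X i k).mpr h, h]
  simp

theorem repr_heckeOp_of_neg {k : b.support} {i : X.carrier} (h : pairZ X i k < 0)
    (v : WeightModule X) : (stdBasis X).repr (heckeOp b X k v) i =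
      (stdBasis X).repr v (X.act i (simpleReflection b k)) := by
  suffices (stdBasis X).coord i ∘ₗ heckeOp b X k =
      (stdBasis X).coord (X.act i (simpleReflection b k)) from LinearMap.congr_fun this v
  refine (stdBasis X).ext fun j ↦ ?_
  have h1 := pairZ_act_simple_self b X i k
  have h2 := pairZ_act_simple_self b X j k
  rw [LinearMap.comp_apply, Module.Basis.coord_apply, Module.Basis.coord_apply,
    Module.Basis.repr_self]
  rcases lt_trichotomy (pairZ X j k) 0 with hj | hj | hj
  · rw [heckeOp_of_neg b X hj, Module.Basis.repr_self, Finsupp.single_eq_of_ne,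
      Finsupp.single_eq_of_ne]
    · rintro rfl
      omega
    · rintro rfl
      omega
  · rw [heckeOp_of_eq_zero b X hj, map_smul, Module.Basis.repr_self, Finsupp.smul_apply,
      Finsupp.single_eq_of_ne, Finsupp.single_eq_of_ne, smul_zero]
    · rintro rfl
      omega
    · rintro rfl
      omega
  · rw [heckeOp_of_pos b X k j (coroot'_eq_pairZ X j k) hj, map_add, map_smul,
      Module.Basis.repr_self, Module.Basis.repr_self, Finsupp.add_apply, Finsupp.smul_apply,
      Finsupp.single_eq_of_ne (a := j) (a' := i), smul_zero, add_zero]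
    · by_cases hij : i = X.act j (simpleReflection b k)
      · rw [hij, act_simple_simple]
        simp
      · rw [Finsupp.single_eq_of_ne hij, Finsupp.single_eq_of_ne]
        rintro rfl
        rw [act_simple_simple] at hij
        exact hij rfl
    · rintro rfl
      omega

theorem repr_heckeOp_of_eq_zero {k : b.support} {i : X.carrier} (h : pairZ X i k = 0)
    (v : WeightModule X) : (stdBasis X).repr (heckeOp b X k v) i =
      qpow (-1) * (stdBasis X).repr v i := by
  suffices (stdBasis X).coord i ∘ₗ heckeOp b X k = qpow (-1) • (stdBasis X).coord i from
    LinearMap.congr_fun this v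
  refine (stdBasis X).ext fun j ↦ ?_
  have h1 := pairZ_act_simple_self b X i k
  have h2 := pairZ_act_simple_self b X j k
  rw [LinearMap.comp_apply, LinearMap.smul_apply, Module.Basis.coord_apply,
    Module.Basis.coord_apply, Module.Basis.repr_self]
  rcases lt_trichotomy (pairZ X j k) 0 with hj | hj | hj
  · rw [heckeOp_of_neg b X hj, Module.Basis.repr_self, Finsupp.single_eq_of_ne,
      Finsupp.single_eq_of_ne, smul_zero]
    · rintro rfl
      omega
    · rintro rfl
      omega
  · rw [heckeOp_of_eq_zero b X hj, map_smul, Module.Basis.repr_self, Finsupp.smul_apply]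
  · rw [heckeOp_of_pos b X k j (coroot'_eq_pairZ X j k) hj, map_add, map_smul,
      Module.Basis.repr_self, Module.Basis.repr_self, Finsupp.add_apply, Finsupp.smul_apply,
      Finsupp.single_eq_of_ne (a := j) (a' := i), Finsupp.single_eq_of_ne, smul_zero, smul_zero,
      add_zero]
    · rintro rfl
      omega
    · rintro rfl
      omega

theorem repr_heckeOp_of_pos {k : b.support} {i : X.carrier} (h : 0 < pairZ X i k)
    (v : WeightModule X) : (stdBasis X).repr (heckeOp b X k v) i =
      (stdBasis X).repr v (X.act i (simpleReflection b k)) +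
        (qpow (-1) - qpow 1) * (stdBasis X).repr v i := by
  suffices (stdBasis X).coord i ∘ₗ heckeOp b X k =
      (stdBasis X).coord (X.act i (simpleReflection b k)) +
        (qpow (-1) - qpow 1) • (stdBasis X).coord i from LinearMap.congr_fun this v
  refine (stdBasis X).ext fun j ↦ ?_
  have h1 := pairZ_act_simple_self b X i k
  have h2 := pairZ_act_simple_self b X j k
  rw [LinearMap.comp_apply, LinearMap.add_apply, LinearMap.smul_apply, Module.Basis.coord_apply,
    Module.Basis.coord_apply, Module.Basis.coord_apply, Module.Basis.repr_self]
  rcases lt_trichotomy (pairZ X j k) 0 with hj | hj | hj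
  · rw [heckeOp_of_neg b X hj, Module.Basis.repr_self, Finsupp.single_eq_of_ne (a := j) (a' := i),
      smul_zero, add_zero]
    · by_cases hij : i = X.act j (simpleReflection b k)
      · rw [hij, act_simple_simple]
        simp
      · rw [Finsupp.single_eq_of_ne hij, Finsupp.single_eq_of_ne]
        rintro rfl
        rw [act_simple_simple] at hij
        exact hij rfl
    · rintro rfl
      omega
  · rw [heckeOp_of_eq_zero b X hj, map_smul, Module.Basis.repr_self, Finsupp.smul_apply,
      Finsupp.single_eq_of_ne, Finsupp.single_eq_of_ne, smul_zero, smul_zero, add_zero]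
    · rintro rfl
      omega
    · rintro rfl
      omega
  · rw [heckeOp_of_pos b X k j (coroot'_eq_pairZ X j k) hj, map_add, map_smul,
      Module.Basis.repr_self, Module.Basis.repr_self, Finsupp.add_apply, Finsupp.smul_apply,
      Finsupp.single_eq_of_ne (a := X.act j _) (a' := i),
      Finsupp.single_eq_of_ne (a := j) (a' := X.act i _)]
    · rintro rfl
      omega
    · rintro rfl
      omega

theorem qpow_mul_neg (n : ℤ) : qpow n * qpow (-n) = 1 := by
  rw [← qpow_add, add_neg_cancel, qpow_zero]

theorem mul_qpow_inj {x y : LaurentZ} {n : ℤ} : x * qpow n = y * qpow n ↔ x = y := by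
  refine ⟨fun h ↦ ?_, fun h ↦ by rw [h]⟩
  have := congrArg (· * qpow (-n)) h
  simpa only [mul_assoc, qpow_mul_neg, mul_one] using this

/-- The vectors on which `H_k` acts by `q⁻¹`. -/
theorem opGen_smul_eq_iff (k : b.support) (v : WeightModule X) :
    opGen b k • v = qpow (-1) • v ↔ ∀ i, (stdBasis X).repr v (X.act i (simpleReflection b k)) *
      qpow (weightHeight b X (X.act i (simpleReflection b k))) =
        (stdBasis X).repr v i * qpow (weightHeight b X i) := by
  rw [opGen, op_gen_smul, ← (stdBasis X).repr.injective.eq_iff, Finsupp.ext_iff]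
  refine forall_congr' fun i ↦ ?_
  rw [map_smul, Finsupp.smul_apply, smul_eq_mul]
  rcases lt_trichotomy (pairZ X i k) 0 with h | h | h
  · rw [repr_heckeOp_of_neg b X h, weightHeight_act_of_neg b X h,
      ← mul_qpow_inj (n := ((weightHeight b X i + 1 : ℕ) : ℤ))]
    have : qpow (-1) * (stdBasis X).repr v i * qpow ((weightHeight b X i + 1 : ℕ) : ℤ) =
        (stdBasis X).repr v i * qpow (weightHeight b X i) := by
      rw [mul_comm (qpow (-1)), mul_assoc, ← qpow_add]
      congr 2
      push_cast
      ring
    rw [this]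
  · rw [repr_heckeOp_of_eq_zero b X h, (act_simple_eq_iff b X i k).mpr h]
    simp
  · rw [repr_heckeOp_of_pos b X h, ← weightHeight_act_of_pos b X h,
      ← mul_qpow_inj (x := _ + _)
        (n := (weightHeight b X (X.act i (simpleReflection b k)) : ℤ))]
    have : (stdBasis X).repr v i *
        qpow ((weightHeight b X (X.act i (simpleReflection b k)) + 1 : ℕ) : ℤ) =
        (stdBasis X).repr v i * qpow 1 *
          qpow (weightHeight b X (X.act i (simpleReflection b k))) := by
      rw [mul_assoc, ← qpow_add]
      congr 2
      push_cast
      ring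
    rw [this, mul_qpow_inj, mul_qpow_inj]
    constructor <;> intro h <;> linear_combination h

theorem repr_act_of_invariant {J : Set b.support} {v : WeightModule X}
    (hv : ∀ k ∈ J, opGen b k • v = qpow (-1) • v) {u : P.weylGroup} (hu : u ∈ parabolic b J)
    (i : X.carrier) : (stdBasis X).repr v (X.act i u) * qpow (weightHeight b X (X.act i u)) =
      (stdBasis X).repr v i * qpow (weightHeight b X i) := by
  induction hu using Subgroup.closure_induction generalizing i with
  | mem x hx =>
    obtain ⟨k, hk, rfl⟩ := hx
    exact (opGen_smul_eq_iff b X k v).mp (hv k hk) i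
  | one => rw [X.act_one]
  | mul x y _ _ hx hy => rw [X.act_mul, hy, hx]
  | inv x _ hx =>
    rw [← hx (X.act i x⁻¹), ← X.act_mul, inv_mul_cancel, X.act_one]

theorem opGen_smul_antidomRep (γ : LinkageClass X) {k : b.support} (hk : k ∈ stabSet b X γ) :
    opGen b k • stdBasis X (antidomRep b X γ) = qpow (-1) • stdBasis X (antidomRep b X γ) := by
  rw [opGen, op_gen_smul, heckeOp_of_eq_zero b X ((act_simple_eq_iff b X _ k).mp hk)]

theorem opGen_smul_apply_antidomRep {V : Type*} [AddCommGroup V] [Module LaurentZ V]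
    [Module (Hecke b)ᵐᵒᵖ V] [IsScalarTower LaurentZ (Hecke b)ᵐᵒᵖ V]
    (f : WeightModule X →ₗ[(Hecke b)ᵐᵒᵖ] V) (γ : LinkageClass X)
    {k : b.support} (hk : k ∈ stabSet b X γ) :
    opGen b k • f (stdBasis X (antidomRep b X γ)) =
      qpow (-1) • f (stdBasis X (antidomRep b X γ)) := by
  rw [← map_smul, opGen_smul_antidomRep b X γ hk]
  exact map_smul (f.restrictScalars LaurentZ) _ _

/-! ### The element of the transversal in a diagonal orbit -/

/-- The element of the transversal in the diagonal orbit of `(i, j)`. -/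
noncomputable def pairRep (i j : X.carrier) : PairIndex b X :=
  (existsUnique_pairIndex b X i j).choose

theorem pairRep_eq {i j : X.carrier} {p : PairIndex b X} {w : P.weylGroup}
    (h1 : X.act p.1.1 w = i) (h2 : X.act p.1.2 w = j) : pairRep b X i j = p :=
  ((existsUnique_pairIndex b X i j).choose_spec.2 p ⟨w, h1, h2⟩).symm

theorem exists_act_pairRep (i j : X.carrier) :
    ∃ w, X.act (pairRep b X i j).1.1 w = i ∧ X.act (pairRep b X i j).1.2 w = j :=
  (existsUnique_pairIndex b X i j).choose_spec.1

theorem pairRep_self (p : PairIndex b X) : pairRep b X p.1.1 p.1.2 = p :=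
  pairRep_eq b X (X.act_one _) (X.act_one _)

theorem pairRep_act (i j : X.carrier) (w : P.weylGroup) :
    pairRep b X (X.act i w) (X.act j w) = pairRep b X i j := by
  obtain ⟨u, h1, h2⟩ := exists_act_pairRep b X i j
  exact pairRep_eq b X (w := u * w) (by rw [X.act_mul, h1]) (by rw [X.act_mul, h2])

theorem pairRep_snd (i : X.carrier) {j : X.carrier} (hj : IsAntidominant b (j : M)) :
    (pairRep b X i j).1.2 = j := by
  obtain ⟨u, -, h⟩ := exists_act_pairRep b X i j
  exact (antidominant_unique b X (pairRep b X i j).2.1 hj h).symm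

theorem coordFn_apply (i j : X.carrier) (ζ : SchurAlgebra b X) :
    coordFn b X i j ζ = (stdBasis X).repr (ζ (stdBasis X j)) i := rfl

/-- All coordinates of an element of the `q`-Schur algebra at antidominant weights are determined by
those in the transversal. -/
theorem coordFn_mul_qpow (ζ : SchurAlgebra b X) (i : X.carrier) (γ : LinkageClass X) :
    coordFn b X i (antidomRep b X γ) ζ * qpow (weightHeight b X i) =
      coordFn b X (pairRep b X i (antidomRep b X γ)).1.1
        (pairRep b X i (antidomRep b X γ)).1.2 ζ *
        qpow (weightHeight b X (pairRep b X i (antidomRep b X γ)).1.1) := by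
  obtain ⟨u, h1, h2⟩ := exists_act_pairRep b X i (antidomRep b X γ)
  have h3 := pairRep_snd b X i (antidomRep_antidominant b X γ)
  generalize pairRep b X i (antidomRep b X γ) = p at *
  rw [h3] at h2 ⊢
  have := repr_act_of_invariant b X (fun k hk ↦ opGen_smul_apply_antidomRep b X ζ γ hk)
    ((mem_parabolic_stabSet_iff b X γ u).mpr h2) p.1.1
  rwa [h1] at this

/-! ### The bases of the `q`-Schur algebra and of its dual -/

/-- The coordinates in the transversal. -/
noncomputable def transversalCoords :
    SchurAlgebra b X →ₗ[LaurentZ] (PairIndex b X → LaurentZ) :=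
  LinearMap.pi fun p ↦ coordFn b X p.1.1 p.1.2

theorem transversalCoords_bijective : Function.Bijective (transversalCoords b X) := by
  constructor
  · rw [← LinearMap.ker_eq_bot, LinearMap.ker_eq_bot']
    intro ζ hζ
    refine weightModule_hom_ext fun γ ↦ (stdBasis X).repr.injective (Finsupp.ext fun i ↦ ?_)
    have h := coordFn_mul_qpow b X ζ i γ
    have h0 := congrFun hζ (pairRep b X i (antidomRep b X γ))
    change coordFn b X _ _ ζ = 0 at h0
    rw [h0, zero_mul] at h
    have h' : coordFn b X i (antidomRep b X γ) ζ * qpow (weightHeight b X i) =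
      0 * qpow (weightHeight b X i) := by rw [h, zero_mul]
    rw [mul_qpow_inj, coordFn_apply] at h'
    rw [h']
    simp
  · intro f
    let c : LinkageClass X → X.carrier → LaurentZ := fun γ i ↦
      f (pairRep b X i (antidomRep b X γ)) *
        qpow ((weightHeight b X (pairRep b X i (antidomRep b X γ)).1.1 : ℤ) - weightHeight b X i)
    let v : LinkageClass X → WeightModule X := fun γ ↦
      (stdBasis X).repr.symm (Finsupp.equivFunOnFinite.symm (c γ))
    have hv : ∀ γ i, (stdBasis X).repr (v γ) i = c γ i := fun γ i ↦ by
      simp only [v, LinearEquiv.apply_symm_apply, Finsupp.equivFunOnFinite_symm_apply_apply]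
    obtain ⟨ζ, hζ⟩ := exists_weightModule_hom (b := b) v (by
      intro γ k hk
      rw [opGen_smul_eq_iff]
      intro i
      have h1 : pairRep b X (X.act i (simpleReflection b k)) (antidomRep b X γ) =
          pairRep b X i (antidomRep b X γ) := by
        conv_lhs => rw [← show X.act (antidomRep b X γ) (simpleReflection b k) = _ from hk]
        exact pairRep_act b X _ _ _
      rw [hv, hv]
      simp only [c]
      rw [h1, mul_assoc, mul_assoc, ← qpow_add, ← qpow_add, sub_add_cancel, sub_add_cancel])
    refine ⟨ζ, funext fun p ↦ ?_⟩
    change coordFn b X p.1.1 p.1.2 ζ = f p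
    have h2 := antidomRep_classOf b X p.2.1
    rw [coordFn_apply, ← h2, hζ, hv]
    simp only [c]
    rw [h2, pairRep_self, sub_self, qpow_zero, mul_one]

/-- The basis `η_{i,j}` of the `q`-Schur algebra. -/
noncomputable def etaBasis : Module.Basis (PairIndex b X) LaurentZ (SchurAlgebra b X) :=
  Module.Basis.ofEquivFun (LinearEquiv.ofBijective _ (transversalCoords_bijective b X))

theorem etaBasis_repr (ζ : SchurAlgebra b X) (p : PairIndex b X) :
    (etaBasis b X).repr ζ p = coordFn b X p.1.1 p.1.2 ζ := by
  rw [etaBasis, Module.Basis.ofEquivFun_repr_apply]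
  rfl

theorem isEta_iff (p : PairIndex b X) (ζ : SchurAlgebra b X) :
    IsEta b X p ζ ↔ ζ = etaBasis b X p := by
  classical
  rw [← (etaBasis b X).repr.injective.eq_iff, Finsupp.ext_iff]
  refine forall_congr' fun r ↦ ?_
  rw [etaBasis_repr, Module.Basis.repr_self, Finsupp.single_apply]

theorem exists_dual_basis : ∃ c : Module.Basis (PairIndex b X) LaurentZ
    (Module.Dual LaurentZ (SchurAlgebra b X)), ∀ p, c p = coordFn b X p.1.1 p.1.2 := by
  classical
  refine ⟨(etaBasis b X).dualBasis, fun p ↦ LinearMap.ext fun ζ ↦ ?_⟩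
  rw [Module.Basis.coe_dualBasis, Module.Basis.coord_apply, etaBasis_repr]

end SchurBasis

section Permutation

set_option linter.unusedSectionVars false

variable {ι K M N : Type*} [Field K] [AddCommGroup M] [Module K M]
  [AddCommGroup N] [Module K N] {P : RootPairing ι K M N}
  [CharZero K] [Finite ι] [P.IsCrystallographic] [P.IsReduced]

variable (b : P.Base) (X : WeightSet P)

/-! ### The regular orbit -/

/-- A regular linkage class. -/
noncomputable def regClass : LinkageClass X :=
  classOf X ⟨X.exists_regular.choose, X.exists_regular.choose_spec.1⟩

/-- The antidominant weight of a regular orbit. -/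
noncomputable def regPt : X.carrier := antidomRep b X (regClass X)

theorem regPt_antidominant : IsAntidominant b (regPt b X : M) := antidomRep_antidominant b X _

variable {b X} in
theorem eq_one_of_act_regPt {w : P.weylGroup} (h : X.act (regPt b X) w = regPt b X) : w = 1 := by
  obtain ⟨u, hu⟩ := exists_act_antidomRep b X
    ⟨X.exists_regular.choose, X.exists_regular.choose_spec.1⟩
  change X.act (regPt b X) u = _ at hu
  have h1 : X.act ⟨X.exists_regular.choose, X.exists_regular.choose_spec.1⟩ (u⁻¹ * w * u) =
      ⟨X.exists_regular.choose, X.exists_regular.choose_spec.1⟩ := by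
    rw [X.act_mul, X.act_mul, act_inv_of_act X hu, h, hu]
  have h2 := X.exists_regular.choose_spec.2 _ (smul_eq_of_act X h1)
  have h3 : w = u * (u⁻¹ * w * u) * u⁻¹ := by group
  rw [h3, h2, mul_one, mul_inv_cancel]

theorem act_regPt_injective : Function.Injective (X.act (regPt b X)) := by
  intro w w' h
  have : w * w'⁻¹ = 1 := eq_one_of_act_regPt (b := b) (X := X) (by
    rw [X.act_mul, h, ← X.act_mul, mul_inv_cancel, X.act_one])
  exact mul_inv_eq_one.mp this

theorem finite_weylGroup (b : P.Base) (X : WeightSet P) : Finite P.weylGroup :=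
  Finite.of_injective _ (act_regPt_injective b X)

theorem weightHeight_act_regPt (w : P.weylGroup) :
    weightHeight b X (X.act (regPt b X) w) = length b w := by
  obtain ⟨w', h1, h2⟩ := exists_length_eq_weightHeight b X (regPt_antidominant b X) w
  rw [← h2, act_regPt_injective b X h1]

theorem simpleReflection_ne_one (k : b.support) : simpleReflection b k ≠ 1 := by
  intro h
  have := not_isPosIdx_rootAct_simple b k
  rw [h, rootAct_one] at this
  exact this (isPosIdx_simple b k)

theorem pairZ_act_regPt_ne_zero (w : P.weylGroup) (k : b.support) :
    pairZ X (X.act (regPt b X) w) k ≠ 0 := by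
  rw [Ne, ← act_simple_eq_iff, ← X.act_mul]
  intro h
  exact simpleReflection_ne_one b k (by simpa using act_regPt_injective b X h)

theorem pairZ_act_nonpos_of_neg {j : X.carrier} (hj : IsAntidominant b (j : M)) {w : P.weylGroup}
    {k : b.support} (h : pairZ X (X.act (regPt b X) w) k < 0) : pairZ X (X.act j w) k ≤ 0 := by
  rw [pairZ_act b X] at h ⊢
  by_contra! h1
  have h2 : ¬ IsPosIdx b (rootAct w (k : ι)) := fun h2 ↦ by
    have := pairZ_nonpos b X h2 hj
    omega
  have := pairZ_nonneg b X h2 (regPt_antidominant b X)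
  omega

theorem pairZ_act_nonneg_of_pos {j : X.carrier} (hj : IsAntidominant b (j : M)) {w : P.weylGroup}
    {k : b.support} (h : 0 < pairZ X (X.act (regPt b X) w) k) : 0 ≤ pairZ X (X.act j w) k := by
  rw [pairZ_act b X] at h ⊢
  by_contra! h1
  have h2 : IsPosIdx b (rootAct w (k : ι)) := by
    by_contra h2
    have := pairZ_nonneg b X h2 hj
    omega
  have := pairZ_nonpos b X h2 (regPt_antidominant b X)
  omega

/-! ### The Hecke algebra as the regular orbit module -/

/-- The map `h ↦ v h`, where `v` is the basis vector of the antidominant weight of a regular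
orbit. -/
noncomputable def heckeVec : Hecke b →ₗ[(Hecke b)ᵐᵒᵖ] WeightModule X where
  toFun h := MulOpposite.op h • stdBasis X (regPt b X)
  map_add' h h' := by rw [MulOpposite.op_add, add_smul]
  map_smul' r h := by
    rw [RingHom.id_apply, ← mul_smul]
    rfl

theorem heckeVec_apply (h : Hecke b) :
    heckeVec b X h = MulOpposite.op h • stdBasis X (regPt b X) := rfl

theorem heckeVec_injective : Function.Injective (heckeVec b X) := by
  classical
  obtain ⟨f, hf⟩ := exists_weightModule_hom (b := b) (X := X)
    (fun γ ↦ if γ = regClass X then (1 : Hecke b) else 0) (by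
      intro γ k hk
      split_ifs with h
      · subst h
        exact absurd (eq_one_of_act_regPt hk) (simpleReflection_ne_one b k)
      · simp)
  refine Function.LeftInverse.injective (g := f) fun h ↦ ?_
  rw [heckeVec_apply, map_smul, regPt, hf, if_pos rfl, op_smul_eq_mul, one_mul]

theorem op_prod_smul_stdBasis {j : X.carrier} (hj : IsAntidominant b (j : M)) (l : List b.support)
    (hl : weightHeight b X (X.act j (l.map (simpleReflection b)).prod) = l.length) :
    MulOpposite.op (l.map (heckeGen b)).prod • stdBasis X j =
      stdBasis X (X.act j (l.map (simpleReflection b)).prod) := by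
  induction l using List.reverseRecOn with
  | nil => simp [X.act_one]
  | append_singleton t k ih =>
    rw [List.map_append, List.prod_append, List.map_singleton, List.prod_singleton, X.act_mul,
      List.length_append, List.length_singleton] at hl
    have h1 := weightHeight_act_prod_le b X hj t
    have h2 := weightHeight_act_le b X (X.act j (t.map (simpleReflection b)).prod) k
    have hk : pairZ X (X.act j (t.map (simpleReflection b)).prod) k < 0 := by
      by_contra! hk
      rcases hk.lt_or_eq with h | h
      · have := weightHeight_act_of_pos b X h
        omega
      · rw [(act_simple_eq_iff b X _ k).mpr h.symm] at hl
        omega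
    rw [List.map_append, List.prod_append, List.map_append, List.prod_append,
      List.map_singleton, List.prod_singleton, List.map_singleton, List.prod_singleton,
      MulOpposite.op_mul, mul_smul, ih (by omega), op_gen_smul, heckeOp_of_neg b X hk, X.act_mul]

theorem heckeVec_heckeElt (w : P.weylGroup) :
    heckeVec b X (heckeElt b w) = stdBasis X (X.act (regPt b X) w) := by
  obtain ⟨h1, h2⟩ := (exists_reduced_word b w).choose_spec
  have h3 := op_prod_smul_stdBasis b X (regPt_antidominant b X) (exists_reduced_word b w).choose
    (by rw [h1, h2, weightHeight_act_regPt])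
  rw [h1] at h3
  exact h3

theorem heckeVec_smul (a : LaurentZ) (h : Hecke b) :
    heckeVec b X (a • h) = a • heckeVec b X h :=
  map_smul ((heckeVec b X).restrictScalars LaurentZ) a h

theorem heckeVec_finsum (Y : Set P.weylGroup) (f : P.weylGroup → LaurentZ) :
    heckeVec b X (∑ᶠ w ∈ Y, f w • heckeElt b w) =
      ∑ᶠ w ∈ Y, f w • stdBasis X (X.act (regPt b X) w) := by
  have := finite_weylGroup b X
  rw [finsum_mem_eq_finite_toFinset_sum _ (Set.toFinite Y),
    finsum_mem_eq_finite_toFinset_sum _ (Set.toFinite Y), map_sum]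
  exact Finset.sum_congr rfl fun w _ ↦ by rw [heckeVec_smul, heckeVec_heckeElt]

open Classical in
theorem repr_heckeVec_finsum (Y : Set P.weylGroup) (f : P.weylGroup → LaurentZ)
    (w : P.weylGroup) :
    (stdBasis X).repr (heckeVec b X (∑ᶠ w ∈ Y, f w • heckeElt b w)) (X.act (regPt b X) w) =
      if w ∈ Y then f w else 0 := by
  have := finite_weylGroup b X
  rw [heckeVec_finsum, finsum_mem_eq_finite_toFinset_sum _ (Set.toFinite Y), map_sum,
    Finsupp.finsetSum_apply]
  simp only [map_smul, Module.Basis.repr_self, Finsupp.smul_apply, Finsupp.single_apply,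
    (act_regPt_injective b X).eq_iff, smul_eq_mul, mul_ite, mul_one, mul_zero]
  rw [Finset.sum_ite_eq']
  simp

theorem repr_heckeVec_finsum_of_forall_ne (Y : Set P.weylGroup) (f : P.weylGroup → LaurentZ)
    {i : X.carrier} (hi : ∀ w, X.act (regPt b X) w ≠ i) :
    (stdBasis X).repr (heckeVec b X (∑ᶠ w ∈ Y, f w • heckeElt b w)) i = 0 := by
  have := finite_weylGroup b X
  rw [heckeVec_finsum, finsum_mem_eq_finite_toFinset_sum _ (Set.toFinite Y), map_sum,
    Finsupp.finsetSum_apply]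
  refine Finset.sum_eq_zero fun w _ ↦ ?_
  rw [map_smul, Module.Basis.repr_self, Finsupp.smul_apply,
    Finsupp.single_eq_of_ne (hi w).symm, smul_zero]

theorem opGen_smul_symmetrizer (X : WeightSet P) {J : Set b.support} {k : b.support} (hk : k ∈ J) :
    opGen b k • symmetrizer b J = qpow (-1) • symmetrizer b J := by
  classical
  apply heckeVec_injective b X
  rw [heckeVec_smul, map_smul, opGen_smul_eq_iff]
  intro i
  have hkJ : simpleReflection b k ∈ (parabolic b J : Set P.weylGroup) :=
    Subgroup.subset_closure ⟨k, hk, rfl⟩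
  by_cases hi : ∃ w, X.act (regPt b X) w = i
  · obtain ⟨w, rfl⟩ := hi
    rw [← X.act_mul, symmetrizer, repr_heckeVec_finsum, repr_heckeVec_finsum,
      weightHeight_act_regPt, weightHeight_act_regPt]
    have : w * simpleReflection b k ∈ (parabolic b J : Set P.weylGroup) ↔
        w ∈ (parabolic b J : Set P.weylGroup) := (parabolic b J).mul_mem_cancel_right hkJ
    simp only [this]
    split_ifs
    · rw [← qpow_add, ← qpow_add, sub_add_cancel, sub_add_cancel]
    · rw [zero_mul, zero_mul]
  · push Not at hi
    rw [symmetrizer, repr_heckeVec_finsum_of_forall_ne b X _ _ hi,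
      repr_heckeVec_finsum_of_forall_ne b X, zero_mul, zero_mul]
    intro w hw
    refine hi (w * simpleReflection b k) ?_
    rw [X.act_mul, hw, act_simple_simple]

/-! ### The identification of `𝕋_f` with the sum of permutation modules -/

variable {X} in
open Classical in
/-- The coordinates of the image of `t` in `x_γ ℋ`, transported to the regular orbit. -/
noncomputable def permCoord (γ : LinkageClass X) (t : WeightModule X) (i : X.carrier) : LaurentZ :=
  if h : ∃ w, X.act (regPt b X) w = i then
    qpow ((longestLength b (stabSet b X γ) : ℤ) +
      weightHeight b X (X.act (antidomRep b X γ) h.choose) - weightHeight b X i) *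
        (stdBasis X).repr t (X.act (antidomRep b X γ) h.choose)
  else 0

theorem permCoord_act (γ : LinkageClass X) (t : WeightModule X) (w : P.weylGroup) :
    permCoord b γ t (X.act (regPt b X) w) =
      qpow ((longestLength b (stabSet b X γ) : ℤ) +
        weightHeight b X (X.act (antidomRep b X γ) w) - length b w) *
          (stdBasis X).repr t (X.act (antidomRep b X γ) w) := by
  have h : ∃ w', X.act (regPt b X) w' = X.act (regPt b X) w := ⟨w, rfl⟩
  have h1 : h.choose = w := act_regPt_injective b X h.choose_spec
  rw [permCoord, dif_pos h, h1, weightHeight_act_regPt]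

theorem permCoord_of_forall_ne (γ : LinkageClass X) (t : WeightModule X) {i : X.carrier}
    (hi : ∀ w, X.act (regPt b X) w ≠ i) : permCoord b γ t i = 0 := by
  rw [permCoord, dif_neg (by push Not; exact hi)]

/-- The map `t ↦ permCoord b γ t`, as a linear map. -/
noncomputable def permVec (γ : LinkageClass X) : WeightModule X →ₗ[LaurentZ] WeightModule X where
  toFun t := (stdBasis X).repr.symm (Finsupp.equivFunOnFinite.symm (permCoord b γ t))
  map_add' t t' := by
    rw [← map_add]
    congr 1
    ext1 i
    simp only [Finsupp.add_apply, Finsupp.equivFunOnFinite_symm_apply_apply, permCoord, map_add]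
    split_ifs
    · rw [mul_add]
    · rw [add_zero]
  map_smul' a t := by
    rw [RingHom.id_apply, ← map_smul]
    congr 1
    ext1 i
    simp only [Finsupp.smul_apply, Finsupp.equivFunOnFinite_symm_apply_apply, permCoord, map_smul,
      smul_eq_mul]
    split_ifs
    · ring
    · rw [mul_zero]

theorem repr_permVec (γ : LinkageClass X) (t : WeightModule X) (i : X.carrier) :
    (stdBasis X).repr (permVec b X γ t) i = permCoord b γ t i := by
  simp only [permVec, LinearMap.coe_mk, AddHom.coe_mk, LinearEquiv.apply_symm_apply,
    Finsupp.equivFunOnFinite_symm_apply_apply]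

theorem permVec_heckeOp (γ : LinkageClass X) (k : b.support) (t : WeightModule X) :
    permVec b X γ (heckeOp b X k t) = heckeOp b X k (permVec b X γ t) := by
  refine (stdBasis X).repr.injective (Finsupp.ext fun i ↦ ?_)
  rw [repr_permVec]
  by_cases hi : ∃ w, X.act (regPt b X) w = i
  · obtain ⟨w, rfl⟩ := hi
    have hj := antidomRep_antidominant b X γ
    have hl := weightHeight_act_regPt b X w
    have hl' := weightHeight_act_regPt b X (w * simpleReflection b k)
    rw [X.act_mul] at hl'
    rcases lt_or_gt_of_ne (pairZ_act_regPt_ne_zero b X w k) with h | h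
    · have h1 := weightHeight_act_of_neg b X h
      rw [repr_heckeOp_of_neg b X h, repr_permVec, ← X.act_mul, permCoord_act, permCoord_act,
        X.act_mul]
      rcases (pairZ_act_nonpos_of_neg b X hj h).lt_or_eq with h2 | h2
      · rw [repr_heckeOp_of_neg b X h2, weightHeight_act_of_neg b X h2]
        congr 2
        push_cast
        omega
      · rw [repr_heckeOp_of_eq_zero b X h2, (act_simple_eq_iff b X _ k).mpr h2, ← mul_assoc,
          ← qpow_add]
        congr 2
        omega
    · have h1 := weightHeight_act_of_pos b X h
      rw [repr_heckeOp_of_pos b X h, repr_permVec, repr_permVec, ← X.act_mul, permCoord_act,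
        permCoord_act, permCoord_act, X.act_mul]
      rcases (pairZ_act_nonneg_of_pos b X hj h).lt_or_eq with h2 | h2
      · have h3 := weightHeight_act_of_pos b X h2
        rw [repr_heckeOp_of_pos b X h2, mul_add]
        congr 1
        · congr 2
          omega
        · ring
      · rw [repr_heckeOp_of_eq_zero b X h2.symm, (act_simple_eq_iff b X _ k).mpr h2.symm]
        have h3 : qpow ((longestLength b (stabSet b X γ) : ℤ) +
            weightHeight b X (X.act (antidomRep b X γ) w) -
              length b (w * simpleReflection b k)) =
            qpow ((longestLength b (stabSet b X γ) : ℤ) +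
            weightHeight b X (X.act (antidomRep b X γ) w) - length b w) * qpow 1 := by
          rw [← qpow_add]
          congr 1
          omega
        rw [h3]
        ring
  · push Not at hi
    have hi' : ∀ w, X.act (regPt b X) w ≠ X.act i (simpleReflection b k) := by
      intro w hw
      refine hi (w * simpleReflection b k) ?_
      rw [X.act_mul, hw, act_simple_simple]
    rw [permCoord_of_forall_ne b X γ _ hi]
    rcases lt_trichotomy (pairZ X i k) 0 with h | h | h
    · rw [repr_heckeOp_of_neg b X h, repr_permVec, permCoord_of_forall_ne b X γ _ hi']
    · rw [repr_heckeOp_of_eq_zero b X h, repr_permVec, permCoord_of_forall_ne b X γ _ hi, mul_zero]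
    · rw [repr_heckeOp_of_pos b X h, repr_permVec, repr_permVec,
        permCoord_of_forall_ne b X γ _ hi, permCoord_of_forall_ne b X γ _ hi', mul_zero, add_zero]

theorem act_antidomRep_eq_antidomRep {γ γ' : LinkageClass X} {w : P.weylGroup}
    (h : X.act (antidomRep b X γ) w = antidomRep b X γ') : γ = γ' := by
  rw [← classOf_antidomRep b X γ, ← classOf_antidomRep b X γ', ← h, classOf_act]

theorem permVec_antidomRep_self (γ : LinkageClass X) :
    permVec b X γ (stdBasis X (antidomRep b X γ)) =
      heckeVec b X (symmetrizer b (stabSet b X γ)) := by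
  classical
  refine (stdBasis X).repr.injective (Finsupp.ext fun i ↦ ?_)
  rw [repr_permVec, symmetrizer]
  by_cases hi : ∃ w, X.act (regPt b X) w = i
  · obtain ⟨w, rfl⟩ := hi
    rw [repr_heckeVec_finsum, permCoord_act, Module.Basis.repr_self]
    split_ifs with hw
    · rw [(mem_parabolic_stabSet_iff b X γ w).mp hw, Finsupp.single_eq_same,
        weightHeight_eq_zero b X (antidomRep_antidominant b X γ)]
      simp
    · rw [Finsupp.single_eq_of_ne, mul_zero]
      exact fun h ↦ hw ((mem_parabolic_stabSet_iff b X γ w).mpr h)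
  · push Not at hi
    rw [repr_heckeVec_finsum_of_forall_ne b X _ _ hi, permCoord_of_forall_ne b X γ _ hi]

theorem permVec_antidomRep_of_ne {γ γ' : LinkageClass X} (h : γ ≠ γ') :
    permVec b X γ (stdBasis X (antidomRep b X γ')) = 0 := by
  refine (stdBasis X).repr.injective (Finsupp.ext fun i ↦ ?_)
  rw [repr_permVec, map_zero, Finsupp.zero_apply]
  by_cases hi : ∃ w, X.act (regPt b X) w = i
  · obtain ⟨w, rfl⟩ := hi
    rw [permCoord_act, Module.Basis.repr_self, Finsupp.single_eq_of_ne, mul_zero]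
    exact fun h' ↦ h (act_antidomRep_eq_antidomRep b X h')
  · push Not at hi
    rw [permCoord_of_forall_ne b X γ _ hi]

theorem exists_permHom : ∃ Ω : WeightModule X →ₗ[(Hecke b)ᵐᵒᵖ] PermSum b X,
    ∀ γ, Ω (stdBasis X (antidomRep b X γ)) = permSumGen b X γ := by
  classical
  refine exists_weightModule_hom (permSumGen b X) fun γ k hk ↦ ?_
  have h : opGen b k • permGen b X γ = qpow (-1) • permGen b X γ :=
    Subtype.ext (opGen_smul_symmetrizer b X hk)
  have h1 := DirectSum.lof_eq_of (Hecke b)ᵐᵒᵖ (LinkageClass X) (fun γ ↦ permModule b X γ) γ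
    (permGen b X γ)
  have h2 := DirectSum.lof_eq_of LaurentZ (LinkageClass X) (fun γ ↦ permModule b X γ) γ
    (permGen b X γ)
  calc opGen b k • permSumGen b X γ
      = DirectSum.lof (Hecke b)ᵐᵒᵖ (LinkageClass X) (fun γ ↦ permModule b X γ) γ
          (opGen b k • permGen b X γ) := by rw [map_smul, h1]; rfl
    _ = DirectSum.lof LaurentZ (LinkageClass X) (fun γ ↦ permModule b X γ) γ
          (qpow (-1) • permGen b X γ) := by rw [h]; rfl
    _ = qpow (-1) • permSumGen b X γ := by rw [map_smul, h2]; rfl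

/-- The component of index `γ` of an element of `⨁_γ x_γ ℋ`, as an element of `ℋ`. -/
noncomputable def permComponent (γ : LinkageClass X) : PermSum b X →ₗ[(Hecke b)ᵐᵒᵖ] Hecke b :=
  (permModule b X γ).subtype ∘ₗ
    DirectSum.component (Hecke b)ᵐᵒᵖ (LinkageClass X) (fun γ ↦ permModule b X γ) γ

/-- The coordinates of the components of the image of `t` in `⨁_γ x_γ ℋ`. -/
theorem heckeVec_permHom {Ω : WeightModule X →ₗ[(Hecke b)ᵐᵒᵖ] PermSum b X}
    (hΩ : ∀ γ, Ω (stdBasis X (antidomRep b X γ)) = permSumGen b X γ) (γ : LinkageClass X)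
    (t : WeightModule X) : heckeVec b X (Ω t γ : Hecke b) = permVec b X γ t := by
  classical
  let G : WeightModule X →ₗ[(Hecke b)ᵐᵒᵖ] WeightModule X :=
    ⟨(permVec b X γ).toAddHom, fun r x ↦ map_op_smul_of_gen (fun k i ↦ by
      rw [permVec_heckeOp, opGen, op_gen_smul]) r x⟩
  suffices h : heckeVec b X ∘ₗ permComponent b X γ ∘ₗ Ω = G from LinearMap.congr_fun h t
  refine weightModule_hom_ext fun γ' ↦ ?_
  change heckeVec b X (Ω _ γ : Hecke b) = permVec b X γ _
  rw [hΩ, permSumGen]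
  by_cases h : γ = γ'
  · subst h
    rw [permVec_antidomRep_self, DirectSum.of_eq_same]
    rfl
  · rw [permVec_antidomRep_of_ne b X h, DirectSum.of_eq_of_ne _ _ _ h, ZeroMemClass.coe_zero,
      map_zero]

theorem permHom_bijective {Ω : WeightModule X →ₗ[(Hecke b)ᵐᵒᵖ] PermSum b X}
    (hΩ : ∀ γ, Ω (stdBasis X (antidomRep b X γ)) = permSumGen b X γ) : Function.Bijective Ω := by
  classical
  constructor
  · refine (injective_iff_map_eq_zero Ω).mpr fun t ht ↦ ?_
    refine (stdBasis X).repr.injective (Finsupp.ext fun i ↦ ?_)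
    obtain ⟨w, hw⟩ := exists_act_antidomRep b X i
    have h1 := heckeVec_permHom b X hΩ (classOf X i) t
    rw [ht, DirectSum.zero_apply, ZeroMemClass.coe_zero, map_zero] at h1
    have h2 := permCoord_act b X (classOf X i) t w
    rw [← repr_permVec, ← h1, map_zero, Finsupp.zero_apply, hw, mul_comm] at h2
    rw [map_zero, Finsupp.zero_apply]
    exact mul_qpow_inj.mp (h2.symm.trans (zero_mul _).symm)
  · rw [← LinearMap.range_eq_top, eq_top_iff]
    rintro x -
    induction x using DirectSum.induction_on with
    | zero => exact zero_mem _
    | add x y hx hy => exact add_mem hx hy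
    | of γ y =>
      obtain ⟨y, hy⟩ := y
      obtain ⟨r, rfl⟩ := Submodule.mem_span_singleton.mp hy
      refine ⟨r • stdBasis X (antidomRep b X γ), ?_⟩
      rw [map_smul, hΩ]
      exact (map_smul (DirectSum.lof (Hecke b)ᵐᵒᵖ (LinkageClass X)
        (fun γ ↦ permModule b X γ) γ) r (permGen b X γ)).symm

theorem exists_permEquiv : ∃ Ω : WeightModule X ≃ₗ[(Hecke b)ᵐᵒᵖ] PermSum b X,
    ∀ Ω', IsPermIdentification b X Ω' ↔ Ω' = Ω := by
  obtain ⟨Ω₀, h₀⟩ := exists_permHom b X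
  refine ⟨LinearEquiv.ofBijective Ω₀ (permHom_bijective b X h₀), fun Ω' ↦ ⟨fun h ↦ ?_, ?_⟩⟩
  · apply LinearEquiv.toLinearMap_injective
    have h1 : ∀ γ, Ω'.toLinearMap (stdBasis X (antidomRep b X γ)) =
        Ω₀ (stdBasis X (antidomRep b X γ)) := fun γ ↦ (h γ).trans (h₀ γ).symm
    exact weightModule_hom_ext (V := PermSum b X) h1
  · rintro rfl
    exact h₀

/-! ### Double cosets and the transversal -/

/-- The pair in the transversal which corresponds to a double coset. -/
noncomputable def doubleCosetPair (ξ : DoubleCosetIndex b X) : PairIndex b X :=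
  ⟨(X.act (antidomRep b X ξ.left) ξ.elt, antidomRep b X ξ.right),
    antidomRep_antidominant b X _, fun k hk ↦ (domLE_act_simple_iff b X _ k).mpr
      ((inv_mem_minReps_iff b X ξ.left ξ.right ξ.elt_mem).mp ξ.inv_mem k hk)⟩

theorem doubleCosetPair_bijective : Function.Bijective (doubleCosetPair b X) := by
  constructor
  · rintro ⟨γ, g, ν, h1, h2⟩ ⟨γ', g', ν', h1', h2'⟩ h
    have h3 : X.act (antidomRep b X γ) g = X.act (antidomRep b X γ') g' :=
      congrArg (fun p : PairIndex b X ↦ p.1.1) h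
    have h4 : antidomRep b X ν = antidomRep b X ν' := congrArg (fun p : PairIndex b X ↦ p.1.2) h
    have h5 : γ = γ' := by
      rw [← classOf_antidomRep b X γ, ← classOf_act X _ g, h3, classOf_act, classOf_antidomRep]
    have h6 : ν = ν' := by
      rw [← classOf_antidomRep b X ν, h4, classOf_antidomRep]
    subst h5 h6
    have h7 : g = g' := by
      rw [mem_minReps_iff] at h1 h1'
      exact eq_of_act_eq_of_weightHeight b X (antidomRep_antidominant b X γ) h3 h1'
        (by rw [← h1, ← h1', h3])
    subst h7
    rfl
  · intro p
    obtain ⟨w, hw⟩ := exists_act_antidomRep b X p.1.1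
    obtain ⟨g, h1, h2⟩ := exists_length_eq_weightHeight b X
      (antidomRep_antidominant b X (classOf X p.1.1)) w
    have hg : g ∈ minReps b X (classOf X p.1.1) := by rw [mem_minReps_iff, h1, h2]
    rw [hw] at h1
    have hj := antidomRep_classOf b X p.2.1
    refine ⟨⟨classOf X p.1.1, g, classOf X p.1.2, hg, ?_⟩, Subtype.ext (Prod.ext h1 hj)⟩
    rw [inv_mem_minReps_iff b X _ _ hg]
    intro k hk
    rw [stabSet, hj] at hk
    rw [h1, ← domLE_act_simple_iff]
    exact p.2.2 k hk

/-- The bijection between the double coset representatives and the transversal. -/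
noncomputable def doubleCosetEquiv : DoubleCosetIndex b X ≃ PairIndex b X :=
  Equiv.ofBijective _ (doubleCosetPair_bijective b X)

theorem pairRep_eq_doubleCosetEquiv_iff (ξ : DoubleCosetIndex b X) (γ ν : LinkageClass X)
    (w : P.weylGroup) :
    pairRep b X (X.act (antidomRep b X γ) w) (antidomRep b X ν) = doubleCosetEquiv b X ξ ↔
      (ν = ξ.right ∧ γ = ξ.left) ∧ w ∈ DoubleCoset.doubleCoset ξ.elt
        (parabolic b (stabSet b X ξ.left)) (parabolic b (stabSet b X ξ.right)) := by
  rw [DoubleCoset.mem_doubleCoset]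
  constructor
  · intro h
    obtain ⟨u, h1, h2⟩ := exists_act_pairRep b X (X.act (antidomRep b X γ) w) (antidomRep b X ν)
    rw [h] at h1 h2
    change X.act (X.act (antidomRep b X ξ.left) ξ.elt) u = _ at h1
    change X.act (antidomRep b X ξ.right) u = _ at h2
    have h3 := act_antidomRep_eq_antidomRep b X h2
    subst h3
    have h4 : γ = ξ.left := by
      rw [← classOf_antidomRep b X γ, ← classOf_act X _ w, ← h1, classOf_act, classOf_act,
        classOf_antidomRep]
    subst h4
    refine ⟨⟨rfl, rfl⟩, w * u⁻¹ * ξ.elt⁻¹, ?_, u, ?_, by group⟩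
    · rw [SetLike.mem_coe, mem_parabolic_stabSet_iff, X.act_mul, X.act_mul, ← h1, ← X.act_mul,
        ← X.act_mul, ← X.act_mul]
      simp [X.act_one]
    · rwa [SetLike.mem_coe, mem_parabolic_stabSet_iff]
  · rintro ⟨⟨rfl, rfl⟩, x, hx, y, hy, rfl⟩
    rw [SetLike.mem_coe, mem_parabolic_stabSet_iff] at hx hy
    refine pairRep_eq b X (w := y) ?_ hy
    change X.act (X.act (antidomRep b X ξ.left) ξ.elt) y = _
    rw [X.act_mul, X.act_mul, hx]

/-! ### The second basis of the `q`-Schur algebra -/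

/-- The powers of `q` are units. -/
noncomputable def qpowUnit (n : ℤ) : LaurentZˣ where
  val := qpow n
  inv := qpow (-n)
  val_inv := qpow_mul_neg n
  inv_val := by rw [mul_comm, qpow_mul_neg]

/-- The basis `φ_{γν}^g` of the `q`-Schur algebra. -/
noncomputable def phiBasis : Module.Basis (DoubleCosetIndex b X) LaurentZ (SchurAlgebra b X) :=
  ((etaBasis b X).reindex (doubleCosetEquiv b X).symm).unitsSMul fun ξ ↦
    qpowUnit ((longestLength b (stabSet b X ξ.right) : ℤ) -
      longestLength b (stabSet b X ξ.left) - length b ξ.elt)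

theorem phiBasis_apply (ξ : DoubleCosetIndex b X) :
    phiBasis b X ξ = qpow ((longestLength b (stabSet b X ξ.right) : ℤ) -
      longestLength b (stabSet b X ξ.left) - length b ξ.elt) •
        etaBasis b X (doubleCosetEquiv b X ξ) := by
  rw [phiBasis, Module.Basis.unitsSMul_apply, Module.Basis.reindex_apply, Equiv.symm_symm]
  rfl

open Classical in
theorem coordFn_etaBasis (p : PairIndex b X) (i : X.carrier) (γ : LinkageClass X) :
    coordFn b X i (antidomRep b X γ) (etaBasis b X p) =
      if pairRep b X i (antidomRep b X γ) = p then
        qpow ((weightHeight b X p.1.1 : ℤ) - weightHeight b X i) else 0 := by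
  have h := coordFn_mul_qpow b X (etaBasis b X p) i γ
  rw [← etaBasis_repr, Module.Basis.repr_self, Finsupp.single_apply] at h
  rw [← mul_qpow_inj, h]
  by_cases hp : pairRep b X i (antidomRep b X γ) = p
  · rw [if_pos hp.symm, if_pos hp, ← qpow_add, sub_add_cancel, one_mul, hp]
  · rw [if_neg (Ne.symm hp), if_neg hp, zero_mul, zero_mul]

theorem isPhi_iff {Ω : WeightModule X ≃ₗ[(Hecke b)ᵐᵒᵖ] PermSum b X}
    (hΩ : IsPermIdentification b X Ω) (ξ : DoubleCosetIndex b X) (ζ : SchurAlgebra b X) :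
    IsPhi b X Ω ξ ζ ↔ ζ = phiBasis b X ξ := by
  classical
  have hsymm : ∀ γ, Ω.symm (permSumGen b X γ) = stdBasis X (antidomRep b X γ) := fun γ ↦ by
    rw [← hΩ γ, LinearEquiv.symm_apply_apply]
  have key : IsPhi b X Ω ξ (phiBasis b X ξ) := by
    intro ν γ
    rw [hsymm]
    apply heckeVec_injective b X
    refine (heckeVec_permHom b X (Ω := Ω.toLinearMap) hΩ γ _).trans ?_
    have hc : ∀ w, (stdBasis X).repr (phiBasis b X ξ (stdBasis X (antidomRep b X ν)))
        (X.act (antidomRep b X γ) w) = qpow ((longestLength b (stabSet b X ξ.right) : ℤ) -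
          longestLength b (stabSet b X ξ.left) - length b ξ.elt) *
            coordFn b X (X.act (antidomRep b X γ) w) (antidomRep b X ν)
              (etaBasis b X (doubleCosetEquiv b X ξ)) := by
      intro w
      rw [← coordFn_apply, phiBasis_apply, map_smul, smul_eq_mul]
    have hlen : weightHeight b X (doubleCosetEquiv b X ξ).1.1 = length b ξ.elt :=
      (mem_minReps_iff b X _ _).mp ξ.elt_mem
    refine (stdBasis X).repr.injective (Finsupp.ext fun i ↦ ?_)
    rw [repr_permVec]
    by_cases hi : ∃ w, X.act (regPt b X) w = i
    · obtain ⟨w, rfl⟩ := hi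
      rw [permCoord_act, hc, coordFn_etaBasis]
      simp only [pairRep_eq_doubleCosetEquiv_iff]
      by_cases h1 : ν = ξ.right ∧ γ = ξ.left
      · obtain ⟨rfl, rfl⟩ := h1
        rw [if_pos (And.intro rfl rfl), heckeVec_smul, map_smul, Finsupp.smul_apply, heckeSum,
          repr_heckeVec_finsum, smul_eq_mul]
        by_cases h2 : w ∈ DoubleCoset.doubleCoset ξ.elt
          (parabolic b (stabSet b X ξ.left) : Set P.weylGroup)
          (parabolic b (stabSet b X ξ.right) : Set P.weylGroup)
        · rw [if_pos ⟨⟨rfl, rfl⟩, h2⟩, if_pos h2, ← qpow_add, ← qpow_add, ← qpow_add, hlen]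
          congr 1
          ring
        · rw [if_neg (fun h ↦ h2 h.2), if_neg h2, mul_zero, mul_zero, mul_zero]
      · rw [if_neg h1, if_neg (fun h ↦ h1 h.1), map_zero, map_zero, Finsupp.zero_apply, mul_zero,
          mul_zero]
    · push Not at hi
      rw [permCoord_of_forall_ne b X γ _ hi]
      split_ifs
      · rw [heckeVec_smul, map_smul, Finsupp.smul_apply, heckeSum,
          repr_heckeVec_finsum_of_forall_ne b X _ _ hi, smul_zero]
      · rw [map_zero, map_zero, Finsupp.zero_apply]
  refine ⟨fun h ↦ weightModule_hom_ext fun ν ↦ Ω.injective ?_, fun h ↦ h ▸ key⟩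
  refine DFinsupp.ext fun γ ↦ Subtype.ext ?_
  have h1 := h ν γ
  have h2 := key ν γ
  rw [hsymm] at h1 h2
  exact h1.trans h2.symm

end Permutation

end QSchur

theorem mainTheorem6 {𝔤 : Type*} [LieRing 𝔤] [LieAlgebra ℂ 𝔤] [FiniteDimensional ℂ 𝔤]
    [LieAlgebra.IsSimple ℂ 𝔤] (𝔥 : LieSubalgebra ℂ 𝔤) [𝔥.IsCartanSubalgebra]
    (b : (LieAlgebra.IsKilling.rootSystem 𝔥).Base)
    (X : QSchur.WeightSet (LieAlgebra.IsKilling.rootSystem 𝔥)) :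
    (∀ i j : X.carrier, ∃! p : QSchur.PairIndex b X,
      ∃ w : (LieAlgebra.IsKilling.rootSystem 𝔥).weylGroup,
        X.act p.1.1 w = i ∧ X.act p.1.2 w = j) ∧
    (∃ c : Module.Basis (QSchur.PairIndex b X) QSchur.LaurentZ
        (Module.Dual QSchur.LaurentZ (QSchur.SchurAlgebra b X)),
      ∀ p, c p = QSchur.coordFn b X p.1.1 p.1.2) ∧
    ∃ η : Module.Basis (QSchur.PairIndex b X) QSchur.LaurentZ (QSchur.SchurAlgebra b X),
      (∀ p ζ, QSchur.IsEta b X p ζ ↔ ζ = η p) ∧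
      ∃ Ω : QSchur.WeightModule X ≃ₗ[(QSchur.Hecke b)ᵐᵒᵖ] QSchur.PermSum b X,
        (∀ Ω', QSchur.IsPermIdentification b X Ω' ↔ Ω' = Ω) ∧
        ∃ φ : Module.Basis (QSchur.DoubleCosetIndex b X) QSchur.LaurentZ
            (QSchur.SchurAlgebra b X),
          (∀ ξ ζ, QSchur.IsPhi b X Ω ξ ζ ↔ ζ = φ ξ) ∧
          ∃ e : QSchur.DoubleCosetIndex b X ≃ QSchur.PairIndex b X,
            (∀ ξ, (e ξ).1 =
              (X.act (QSchur.antidomRep b X ξ.left) ξ.elt, QSchur.antidomRep b X ξ.right)) ∧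
            ∀ ξ, φ ξ = QSchur.qpow
              ((QSchur.longestLength b (QSchur.stabSet b X ξ.right) : ℤ) -
                QSchur.longestLength b (QSchur.stabSet b X ξ.left) -
                QSchur.length b ξ.elt) • η (e ξ) := by
  refine ⟨QSchur.existsUnique_pairIndex b X, QSchur.exists_dual_basis b X, QSchur.etaBasis b X,
    QSchur.isEta_iff b X, ?_⟩
  obtain ⟨Ω, hΩ⟩ := QSchur.exists_permEquiv b X
  exact ⟨Ω, hΩ, QSchur.phiBasis b X, QSchur.isPhi_iff b X ((hΩ Ω).mpr rfl),
    QSchur.doubleCosetEquiv b X, fun _ ↦ rfl, QSchur.phiBasis_apply b X⟩
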